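/- **Setting.** Let $1\le k\le k'$ be integers, $0<\varepsilon\le 1/2$ and $f:\{\pm1\}^{k'}\to\{\pm1\}$. For $S\subseteq[k']$ put $\chi_S(x)=\prod_{i\in S}x_i$ and $\hat f(S)=\mathbf E_x[f(x)\chi_S(x)]$. The *spectral sample* of $f$ is the distribution on subsets of $[k']$ that gives $S$ probability $\hat f(S)^2$. A *$k$-junta* is a function $g:\{\pm1\}^{k'}\to\{\pm1\}$ of the form $g(x)=h(x_{i_1},\dots,x_{i_k})$ with $i_1<\dots<i_k$; $\mathcal J_k$ is the set of all $k$-juntas and $\mathrm{dist}(f,\mathcal J_k)=\min_{g\in\mathcal J_k}\Pr_x[f(x)\ne g(x)]$, with $x$ uniform. **The tester.** Put $\ell=\lceil k^{2/3}\rceil$, $\rho=1-\frac1{2\ell}$, $M=\lceil (k'/\varepsilon)^4\rceil$. The remaining parameters are non-negative integers $\kappa,\Delta,r,N,t,R$ and real numbers $a_1,\dots,a_r$. Let $\alpha_j$ be the coefficient of $X^j$ in $(1-(1-X)^\kappa)^\Delta$. For $V\subseteq[k']$ let $N_{\sigma}^{V}(y)$ be the distribution of the point obtained from $y$ by independently,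 for each $i\in V$, keeping $y_i$ with probability $\sigma$ and replacing it by a uniform sign with probability $1-\sigma$. Write $x^{\oplus T}$ for $x$ with the coordinates in $T$ negated. 1. Draw $S_1,\dots,S_M$ independently from the spectral sample of $f$, and set $\gamma=0$. 2. Repeat $R$ times: (a) Draw $A_1,\dots,A_{\lceil k^{1/3}\rceil}$ independently from the spectral sample and let $C=\bigcup_i A_i$. (b) Draw uniform independent $x^{(1)},\dots,x^{(N)}\in\{\pm1\}^{k'}$. For each $x=x^{(s)}$, each $T\subseteq[k']$ with $|T|\le r$ and each $0\le j\le\kappa\Delta$, query $f$ at $t$ independent points drawn from $N^{[k']\setminus C}_{\rho^j}(x^{\oplus T})$; let $\bar f_{s,T,j}$ be the average of the $t$ answers and $w_s(T)=\sum_j\alpha_j\bar f_{s,T,j}$ (this estimates, at $x^{\oplus T}$, the function $\mathrm{SharpNoise}f=\sum_S(1-(1-\rho^{|S\setminus C|})^\kappa)^\Delta\hat f(S)\chi_S$). (c) For each $U\supseteq C$ with $|U|=k$ for which at most $\frac{\varepsilon^2}{10}M$ of the indices $i$ satisfy $S_i\subseteq U$ and $|S_i\setminus C|\ge\ell$, replace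 $\gamma$ by $\max(\gamma,\mathrm{Est}_{C,U})$, where $$\mathrm{Est}_{C,U}=\frac1N\sum_{s=1}^N\Big|w_s(\emptyset)-\sum_{i=1}^r a_i\sum_{S\subseteq[k']\setminus U,\ |S|=i}2^{-i}\sum_{T\subseteq S}(-1)^{|T|}w_s(T)\Big| .$$ 3. Output $(1-\gamma)/2$. **Theorem.** The parameters can be chosen, as functions of $k,k',\varepsilon$ only, such that the following holds. * For all $1\le k\le k'$, $0<\varepsilon\le1/2$ and all $f:\{\pm1\}^{k'}\to\{\pm1\}$, the output of the tester is within $\pm\varepsilon$ of $\mathrm{dist}(f,\mathcal J_k)$ with probability at least $97/100$. * For every $c$ there is a constant $C_0$ such that, whenever $1\le k\le k'\le(k/\varepsilon)^c$ and $0<\varepsilon\le 1/2$, the number of queries to $f$ plus the number of draws from the spectral sample is always at most $2^{k^{1/3}\cdot(C_0\log_2(k/\varepsilon))^{C_0}}$. Both statements hold for the tester as a classical randomized algorithm that has black-box query access to $f$ and can draw from the spectral sample of $f$, and also for its implementation as a quantum query algorithm, in which each classical query and each spectral-sample draw is made by one application of the quantum oracle $|x,b\rangle\mapsto|x,b\cdot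 f(x)\rangle$ (so that the count is the number of quantum queries). A spectral-sample draw is implemented by applying the oracle to the uniform superposition over $x$ with answer qubit $(|1\rangle-|{-1}\rangle)/\sqrt2$, then a Hadamard gate on each of the $k'$ query qubits, then a measurement. -/

import Mathlib

open scoped ENNReal unitInterval

/-! ### Boolean functions, Fourier coefficients, juntas -/

/-- The cube `{±1}^n`; the two-element set `{±1}` is Mathlib's `ℤˣ`. -/
abbrev Cube (n : ℕ) : Type := Fin n → ℤˣ

/-- The sign `±1` as a real number. -/
def sgn (b : ℤˣ) : ℝ := ((b : ℤ) : ℝ)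

lemma sgn_one : sgn 1 = 1 := by simp [sgn]

lemma sgn_neg_one : sgn (-1) = -1 := by simp [sgn]

lemma sgn_mul (a b : ℤˣ) : sgn (a * b) = sgn a * sgn b := by simp [sgn]

lemma sgn_mul_self (b : ℤˣ) : sgn b * sgn b = 1 := by
  rcases Int.units_eq_one_or b with h | h <;> subst h <;> simp [sgn]

lemma sum_units (g : ℤˣ → ℝ) : ∑ b, g b = g 1 + g (-1) := by
  have h : (Finset.univ : Finset ℤˣ) = {1, -1} := by decide
  rw [h, Finset.sum_pair (by decide)]

/-- The character `χ_S(x) = ∏_{i ∈ S} x_i`. -/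
def chi {n : ℕ} (S : Finset (Fin n)) (x : Cube n) : ℝ := ∏ i ∈ S, sgn (x i)

/-- The Fourier coefficient `f̂(S) = E_x [f(x) χ_S(x)]` of a `±1`-valued function. -/
noncomputable def cubeCoeff {n : ℕ} (f : Cube n → ℤˣ) (S : Finset (Fin n)) : ℝ :=
  (1 / 2 ^ n) * ∑ x : Cube n, sgn (f x) * chi S x

/-- `g` is a (`±1`-valued) `k`-junta: `g(x) = h(x_{i_1}, …, x_{i_k})` for some `h` and some
indices `i_1 < ⋯ < i_k`. -/
def IsJunta {n : ℕ} (k : ℕ) (g : Cube n → ℤˣ) : Prop :=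
  ∃ (i : Fin k ↪o Fin n) (h : Cube k → ℤˣ), ∀ x, g x = h (fun j => x (i j))

/-- `Pr_x [f(x) ≠ g(x)]` for uniform `x`. -/
noncomputable def hammingDistance {n : ℕ} (f g : Cube n → ℤˣ) : ℝ :=
  ((Finset.univ.filter fun x => f x ≠ g x).card : ℝ) / 2 ^ n

/-- `dist(f, J_k)`, the minimum of `Pr_x [f(x) ≠ g(x)]` over all `k`-juntas `g` (a nonempty finite
set of values when `k ≤ n`). -/
noncomputable def juntaDist {n : ℕ} (k : ℕ) (f : Cube n → ℤˣ) : ℝ :=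
  sInf {d | ∃ g : Cube n → ℤˣ, IsJunta k g ∧ d = hammingDistance f g}

/-! ### Orthogonality of characters and Parseval -/

lemma card_cube (n : ℕ) : (Fintype.card (Cube n) : ℝ) = 2 ^ n := by
  simp [Cube]

lemma chi_eq {n : ℕ} (S : Finset (Fin n)) (x : Cube n) :
    chi S x = ∏ i, if i ∈ S then sgn (x i) else 1 := by
  simp [chi, Finset.prod_ite_mem]

lemma chi_mul_self {n : ℕ} (S : Finset (Fin n)) (x : Cube n) : chi S x * chi S x = 1 := by
  simp [chi, ← Finset.prod_mul_distrib, sgn_mul_self]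

lemma sum_chi_mul {n : ℕ} (S T : Finset (Fin n)) :
    ∑ x : Cube n, chi S x * chi T x = if S = T then 2 ^ n else 0 := by
  split_ifs with h
  · subst h
    simp_rw [chi_mul_self]
    simp [Cube]
  · obtain ⟨i, hi⟩ : ∃ i, ¬ (i ∈ S ↔ i ∈ T) := by
      by_contra hc
      push Not at hc
      exact h (Finset.ext hc)
    simp_rw [chi_eq, ← Finset.prod_mul_distrib]
    rw [← Fintype.prod_sum (fun (i : Fin n) (b : ℤˣ) =>
      (if i ∈ S then sgn b else 1) * (if i ∈ T then sgn b else 1))]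
    apply Finset.prod_eq_zero (Finset.mem_univ i)
    rw [sum_units]
    by_cases h1 : i ∈ S <;> by_cases h2 : i ∈ T <;> simp_all [sgn_one, sgn_neg_one]

/-- The correspondence between points of the cube and subsets: `x ↦ {i : x_i = -1}`. -/
def negSet {n : ℕ} (x : Cube n) : Finset (Fin n) := Finset.univ.filter fun i => x i = -1

lemma negSet_injective {n : ℕ} : Function.Injective (negSet (n := n)) := by
  intro x y h
  funext i
  have hi : x i = -1 ↔ y i = -1 := by
    have := Finset.ext_iff.mp h i
    simpa [negSet] using this
  rcases Int.units_eq_one_or (x i) with hx | hx <;>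
    rcases Int.units_eq_one_or (y i) with hy | hy <;> simp_all

lemma chi_negSet_comm {n : ℕ} (x z : Cube n) : chi (negSet z) x = chi (negSet x) z := by
  rw [chi_eq, chi_eq]
  refine Finset.prod_congr rfl fun i _ => ?_
  rcases Int.units_eq_one_or (x i) with hx | hx <;>
    rcases Int.units_eq_one_or (z i) with hz | hz <;>
    simp [negSet, hx, hz, sgn_one]

lemma negSet_bijective {n : ℕ} : Function.Bijective (negSet (n := n)) := by
  rw [Fintype.bijective_iff_injective_and_card]
  exact ⟨negSet_injective, by simp [Cube]⟩

lemma sum_chi_mul_dual {n : ℕ} (x y : Cube n) :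
    ∑ S : Finset (Fin n), chi S x * chi S y = if x = y then 2 ^ n else 0 := by
  rw [← negSet_bijective.sum_comp (fun S => chi S x * chi S y)]
  have h : ∀ z : Cube n, chi (negSet z) x * chi (negSet z) y =
      chi (negSet x) z * chi (negSet y) z := fun z => by
    rw [chi_negSet_comm x z, chi_negSet_comm y z]
  simp_rw [h, sum_chi_mul, negSet_injective.eq_iff]

lemma parseval {n : ℕ} (f : Cube n → ℤˣ) : ∑ S, cubeCoeff f S ^ 2 = 1 := by
  have h : ∀ S, cubeCoeff f S ^ 2 = (1 / 2 ^ n) ^ 2 *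
      ∑ x : Cube n, ∑ y : Cube n, (sgn (f x) * sgn (f y)) * (chi S x * chi S y) := fun S => by
    rw [cubeCoeff, mul_pow, sq (∑ x : Cube n, sgn (f x) * chi S x), Finset.sum_mul_sum]
    congr 1
    refine Finset.sum_congr rfl fun x _ => Finset.sum_congr rfl fun y _ => by ring
  simp_rw [h]
  rw [← Finset.mul_sum, Finset.sum_comm]
  have h2 : ∀ x : Cube n, ∑ S : Finset (Fin n), ∑ y : Cube n,
      (sgn (f x) * sgn (f y)) * (chi S x * chi S y) = 2 ^ n := fun x => by
    rw [Finset.sum_comm]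
    simp_rw [← Finset.mul_sum, sum_chi_mul_dual]
    simp [sgn_mul_self]
  simp_rw [h2]
  rw [Finset.sum_const, Finset.card_univ, nsmul_eq_mul, card_cube]
  field_simp

/-- The spectral sample of `f`: the distribution on subsets of `[n]` with `Pr[S] = f̂(S)^2`. -/
noncomputable def spectralSample {n : ℕ} (f : Cube n → ℤˣ) : PMF (Finset (Fin n)) :=
  PMF.ofFintype (fun S => ENNReal.ofReal (cubeCoeff f S ^ 2)) (by
    rw [← ENNReal.ofReal_sum_of_nonneg fun S _ => sq_nonneg _, parseval, ENNReal.ofReal_one])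

/-! ### Classical randomized algorithms with classical queries and spectral-sample draws -/

/-- Classical randomized adaptive algorithms with output in `α` that access an unknown function
`f : {±1}^n → {±1}` through black-box queries and through draws from its spectral sample. As usual
for query complexity, computation between oracle calls is unrestricted and free. -/
inductive SampleAlg (n : ℕ) (α : Type) : Type 1
  /-- Output `a` and halt. -/
  | ret (a : α) : SampleAlg n α
  /-- Draw `b` from a fixed distribution (internal randomness) and continue. -/
  | toss {β : Type} (p : PMF β) (next : β → SampleAlg n α) : SampleAlg n α
  /-- Query `f(x)` and continue. -/
  | query (x : Cube n) (next : ℤˣ → SampleAlg n α) : SampleAlg n α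
  /-- Draw a set from the spectral sample of `f` and continue. -/
  | draw (next : Finset (Fin n) → SampleAlg n α) : SampleAlg n α

namespace SampleAlg

variable {n : ℕ} {α β : Type}

/-- Sequential composition. -/
def bind : SampleAlg n α → (α → SampleAlg n β) → SampleAlg n β
  | ret a, k => k a
  | toss p next, k => toss p fun b => (next b).bind k
  | query x next, k => query x fun b => (next b).bind k
  | draw next, k => draw fun S => (next S).bind k

instance : Monad (SampleAlg n) where
  pure := ret
  bind := bind

/-- The distribution of the output when the algorithm is run on `f`. -/
noncomputable def law (f : Cube n → ℤˣ) : SampleAlg n α → PMF α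
  | ret a => PMF.pure a
  | toss p next => p.bind fun b => (next b).law f
  | query x next => (next (f x)).law f
  | draw next => (spectralSample f).bind fun S => (next S).law f

/-- The worst-case number of oracle calls (queries to `f` plus spectral-sample draws), over all
answers and all internal randomness. -/
noncomputable def cost : SampleAlg n α → ℕ∞
  | ret _ => 0
  | toss _ next => ⨆ b, (next b).cost
  | query _ next => 1 + ⨆ b, (next b).cost
  | draw next => 1 + ⨆ S, (next S).cost

/-- Run `a 0`, …, `a (m - 1)` one after the other, independently; return all outputs. -/
def seqFin : {m : ℕ} → (Fin m → SampleAlg n α) → SampleAlg n (Fin m → α)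
  | 0, _ => ret Fin.elim0
  | _ + 1, a => do
    let b ← a 0
    let bs ← seqFin fun i => a i.succ
    ret (Fin.cons b bs)

/-- Run the algorithms `a i`, `i ∈ ι`, one after the other, independently; return all outputs. -/
noncomputable def seqAll {ι : Type} [Fintype ι] (a : ι → SampleAlg n α) :
    SampleAlg n (ι → α) := do
  let bs ← seqFin fun j => a ((Fintype.equivFin ι).symm j)
  ret fun i => bs (Fintype.equivFin ι i)

end SampleAlg

/-! ### Quantum query algorithms -/

/-- The register: a query register of `n` qubits and an answer qubit. The computational basis is
labelled by `{±1}^n × {±1}` (the bit value `1` is written `-1`). -/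
abbrev Register (n : ℕ) : Type := EuclideanSpace ℂ (Cube n × ℤˣ)

/-- Pure states of the register. -/
abbrev QState (n : ℕ) : Type := {ψ : Register n // ‖ψ‖ = 1}

/-- Computational basis states. -/
noncomputable def basisState {n : ℕ} (z : Cube n × ℤˣ) : QState n :=
  ⟨EuclideanSpace.single z 1, by simp⟩

/-- Unitary gates on the register. -/
abbrev Gate (n : ℕ) : Type := Register n ≃ₗᵢ[ℂ] Register n

/-- The state `U ψ`. -/
noncomputable def Gate.app {n : ℕ} (U : Gate n) (ψ : QState n) : QState n :=
  ⟨U ψ.1, by rw [LinearIsometryEquiv.norm_map]; exact ψ.2⟩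

/-- The basis permutation `(x, b) ↦ (x, b · f(x))`; in bit notation, `(x, b) ↦ (x, b ⊕ f(x))`. -/
def oraclePerm {n : ℕ} (f : Cube n → ℤˣ) : Equiv.Perm (Cube n × ℤˣ) where
  toFun z := (z.1, z.2 * f z.1)
  invFun z := (z.1, z.2 * f z.1)
  left_inv z := by ext <;> simp [mul_assoc]
  right_inv z := by ext <;> simp [mul_assoc]

/-- The standard quantum oracle `O_f |x, b⟩ = |x, b · f(x)⟩`. -/
noncomputable def oracleGate {n : ℕ} (f : Cube n → ℤˣ) : Gate n :=
  LinearIsometryEquiv.piLpCongrLeft 2 ℂ ℂ (oraclePerm f)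

/-- Born's rule for a measurement of the register in the computational basis. -/
noncomputable def born {n : ℕ} (ψ : QState n) : PMF (Cube n × ℤˣ) :=
  PMF.ofFintype (fun z => ENNReal.ofReal (‖ψ.1 z‖ ^ 2)) (by
    rw [← ENNReal.ofReal_sum_of_nonneg fun z _ => sq_nonneg _, ← EuclideanSpace.norm_sq_eq,
      ψ.2]
    simp)

/-- Quantum query algorithms with classical control, intermediate measurements and output in `α`.
The only access to the unknown function is through the quantum oracle `O_f`. -/
inductive QueryAlg (n : ℕ) (α : Type) : Type 1
  /-- Output `a` and halt. -/
  | ret (a : α) : QueryAlg n α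
  /-- Draw `b` from a fixed distribution (classical internal randomness) and continue. -/
  | toss {β : Type} (p : PMF β) (next : β → QueryAlg n α) : QueryAlg n α
  /-- Discard the register, prepare the (fixed) state `ψ` afresh, and continue. -/
  | prepare (ψ : QState n) (next : QueryAlg n α) : QueryAlg n α
  /-- Apply the (fixed) unitary `U` to the register and continue. -/
  | gate (U : Gate n) (next : QueryAlg n α) : QueryAlg n α
  /-- Make one quantum query, i.e. apply `O_f` to the register, and continue. -/
  | query (next : QueryAlg n α) : QueryAlg n α
  /-- Measure the register in the computational basis and continue, depending on the outcome. -/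
  | measure (next : Cube n × ℤˣ → QueryAlg n α) : QueryAlg n α

namespace QueryAlg

variable {n : ℕ} {α : Type}

/-- The distribution of the output when the algorithm is run with oracle `O_f`, the register being
in state `ψ` at the start. -/
noncomputable def lawFrom (f : Cube n → ℤˣ) : QueryAlg n α → QState n → PMF α
  | ret a, _ => PMF.pure a
  | toss p next, ψ => p.bind fun b => (next b).lawFrom f ψ
  | prepare φ next, _ => next.lawFrom f φ
  | gate U next, ψ => next.lawFrom f (U.app ψ)
  | query next, ψ => next.lawFrom f ((oracleGate f).app ψ)
  | measure next, ψ => (born ψ).bind fun z => (next z).lawFrom f (basisState z)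

/-- The distribution of the output, the register being in the all-zeros state at the start. -/
noncomputable def law (f : Cube n → ℤˣ) (A : QueryAlg n α) : PMF α :=
  A.lawFrom f (basisState (fun _ => 1, 1))

/-- The worst-case number of quantum queries, over all measurement outcomes and all internal
randomness. -/
noncomputable def queries : QueryAlg n α → ℕ∞
  | ret _ => 0
  | toss _ next => ⨆ b, (next b).queries
  | prepare _ next => next.queries
  | gate _ next => next.queries
  | query next => 1 + next.queries
  | measure next => ⨆ z, (next z).queries

end QueryAlg

/-- The state `2^{-n/2} ∑_x |x⟩ ⊗ (|1⟩ - |-1⟩)/√2`. -/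
noncomputable def uniformMinus (n : ℕ) : QState n :=
  ⟨WithLp.toLp 2 fun z => ((sgn z.2 / Real.sqrt (2 ^ (n + 1)) : ℝ) : ℂ), by
    have h : ∀ b : ℤˣ, sgn b ^ 2 = 1 := fun b => by rw [sq, sgn_mul_self]
    rw [← sq_eq_sq₀ (norm_nonneg _) zero_le_one, EuclideanSpace.norm_sq_eq]
    simp [div_pow, h, Cube]
    rw [← pow_succ]
    field_simp⟩

/-- The matrix of `H^{⊗n}` on the query register (identity on the answer qubit):
`⟨z, c| H^{⊗n} |x, b⟩ = 2^{-n/2} ∏_{i : z_i = -1} x_i` if `b = c` and `0` otherwise. -/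
noncomputable def hadamardMatrix (n : ℕ) : Matrix (Cube n × ℤˣ) (Cube n × ℤˣ) ℂ :=
  Matrix.of fun z x => if z.2 = x.2 then ((chi (negSet z.1) x.1 / Real.sqrt (2 ^ n) : ℝ) : ℂ) else 0

lemma hadamardMatrix_mul_self (n : ℕ) : hadamardMatrix n * hadamardMatrix n = 1 := by
  ext ⟨z, b⟩ ⟨x, c⟩
  have h : ∀ y : Cube n, (chi (negSet z) y / Real.sqrt (2 ^ n)) *
      (chi (negSet y) x / Real.sqrt (2 ^ n)) =
      (1 / 2 ^ n) * (chi (negSet z) y * chi (negSet x) y) := fun y => by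
    rw [chi_negSet_comm x y, div_mul_div_comm, Real.mul_self_sqrt (by positivity)]
    ring
  have h2 : ∑ y : Cube n, (chi (negSet z) y / Real.sqrt (2 ^ n)) *
      (chi (negSet y) x / Real.sqrt (2 ^ n)) = if z = x then 1 else 0 := by
    simp_rw [h]
    rw [← Finset.mul_sum, sum_chi_mul]
    by_cases hzx : z = x
    · simp [hzx]
    · simp [hzx, negSet_injective.eq_iff]
  have h3 : ∑ y : Cube n, ((chi (negSet z) y / Real.sqrt (2 ^ n) : ℝ) : ℂ) *
      ((chi (negSet y) x / Real.sqrt (2 ^ n) : ℝ) : ℂ) = if z = x then 1 else 0 := by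
    have := congrArg (fun r : ℝ => (r : ℂ)) h2
    push_cast at this ⊢
    rw [this]
    split_ifs <;> simp
  rw [Matrix.mul_apply, Fintype.sum_prod_type, Finset.sum_comm]
  simp only [hadamardMatrix, Matrix.of_apply, ite_mul, zero_mul, mul_ite, mul_zero]
  rw [Finset.sum_eq_single b]
  · by_cases hbc : b = c
    · subst hbc
      simp only [if_true]
      rw [h3]
      simp [Matrix.one_apply]
    · simp [hbc]
  · intro d _ hd
    simp [Ne.symm hd]
  · intro hb
    exact absurd (Finset.mem_univ b) hb

lemma hadamardMatrix_star (n : ℕ) : star (hadamardMatrix n) = hadamardMatrix n := by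
  ext ⟨z, b⟩ ⟨x, c⟩
  simp only [hadamardMatrix, Matrix.star_apply, Matrix.of_apply]
  rw [chi_negSet_comm z x]
  by_cases h : b = c
  · simp [h, -Complex.ofReal_div, Complex.conj_ofReal]
  · simp [h, Ne.symm h]

/-- The gate `H^{⊗n}` on the query register. -/
noncomputable def hadamardGate (n : ℕ) : Gate n :=
  Unitary.linearIsometryEquiv
    ⟨Matrix.toEuclideanCLM (n := Cube n × ℤˣ) (𝕜 := ℂ) (hadamardMatrix n), by
      rw [Unitary.mem_iff, ← map_star, ← map_mul, ← map_mul, hadamardMatrix_star,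
        hadamardMatrix_mul_self, map_one]
      exact ⟨rfl, rfl⟩⟩

/-- The quantum implementation of an algorithm with classical queries and spectral-sample draws.
A classical query of `x` is a quantum query on `|x, 1⟩` followed by a measurement. A draw from the
spectral sample is a quantum query on `2^{-n/2} ∑_x |x⟩ ⊗ |-⟩`, followed by `H^{⊗n}` and a
measurement. -/
noncomputable def SampleAlg.toQuantum {n : ℕ} {α : Type} : SampleAlg n α → QueryAlg n α
  | ret a => .ret a
  | toss p next => .toss p fun b => (next b).toQuantum
  | query x next => .prepare (basisState (x, 1)) <| .query <| .measure fun z =>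
      (next z.2).toQuantum
  | draw next => .prepare (uniformMinus n) <| .query <| .gate (hadamardGate n) <|
      .measure fun z => (next (negSet z.1)).toQuantum

/-! ### The tolerant junta tester -/

/-- The adjustable parameters of the tester. -/
structure TesterParams where
  /-- Exponent `κ` in the sharp noise operator. -/
  κ : ℕ
  /-- Exponent `Δ` in the sharp noise operator. -/
  Δ : ℕ
  /-- Radius of the local mean estimator. -/
  r : ℕ
  /-- Coefficients of the polynomial `p(x) = ∑_{i=1}^r flat i * binom(x, i)` of the local mean
  estimator. -/
  flat : ℕ → ℝ
  /-- Number of sample points in one iteration of the main loop. -/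
  N : ℕ
  /-- Number of copies of each noisy point in a sample bundle (their values are averaged). -/
  copies : ℕ
  /-- Number of iterations of the main loop. -/
  loops : ℕ

namespace JuntaTester

/-- `⌈k^{1/3}⌉`, the number of spectral-sample draws in one iteration of the main loop. -/
noncomputable def rounds (k : ℕ) : ℕ := ⌈(k : ℝ) ^ ((1 : ℝ) / 3)⌉₊

/-- `ℓ = ⌈k^{2/3}⌉`. -/
noncomputable def ell (k : ℕ) : ℕ := ⌈(k : ℝ) ^ ((2 : ℝ) / 3)⌉₊

/-- `⌈(k'/ε)^4⌉` for `k' = n`, the number of spectral-sample draws used in the tests. -/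
noncomputable def testDraws (n : ℕ) (ε : ℝ) : ℕ := ⌈((n : ℝ) / ε) ^ 4⌉₊

/-- The noise rate `ρ = 1 - 1/(2ℓ)`. -/
noncomputable def rho (k : ℕ) : I :=
  ⟨1 - 1 / (2 * (ell k : ℝ)), by
    rcases Nat.eq_zero_or_pos (ell k) with h | h
    · simp [h]
    · have h1 : (1 : ℝ) ≤ ell k := by exact_mod_cast h
      have h2 : 1 / (2 * (ell k : ℝ)) ≤ 1 := by
        rw [div_le_one (by linarith)]
        linarith
      have h3 : 0 ≤ 1 / (2 * (ell k : ℝ)) := by positivity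
      exact ⟨by linarith, by linarith⟩⟩

/-- One noisy coordinate: equal to `b` with probability `ρ`, and uniform over `{±1}` with the
remaining probability `1 - ρ`. -/
noncomputable def noisyBit (ρ : I) (b : ℤˣ) : PMF ℤˣ :=
  PMF.ofFintype
    (fun c => ENNReal.ofReal ((ρ : ℝ) * (if c = b then 1 else 0) + (1 - (ρ : ℝ)) * (1 / 2))) (by
      have h0 := ρ.2.1
      have h1 := ρ.2.2
      rw [← ENNReal.ofReal_sum_of_nonneg]
      · rw [Finset.sum_add_distrib, ← Finset.mul_sum, Finset.sum_ite_eq' Finset.univ b,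
          if_pos (Finset.mem_univ b), Finset.sum_const, Finset.card_univ, Fintype.card_units_int,
          show (ρ : ℝ) * 1 + 2 • ((1 - (ρ : ℝ)) * (1 / 2)) = 1 by rw [nsmul_eq_mul]; push_cast; ring,
          ENNReal.ofReal_one]
      · intro c _
        split_ifs <;> linarith)

variable {n : ℕ}

/-- A draw from `N^V_ρ(y)`: every coordinate in `V` is made noisy independently, the others are
kept. -/
noncomputable def noisyPoint (ρ : I) (V : Finset (Fin n)) (y : Cube n) :
    SampleAlg n (Cube n) :=
  SampleAlg.seqAll fun i =>
    if i ∈ V then SampleAlg.toss (noisyBit ρ (y i)) SampleAlg.ret else SampleAlg.ret (y i)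

/-- The point `x^{⊕T}`. -/
def flip (x : Cube n) (T : Finset (Fin n)) : Cube n := fun i => if i ∈ T then -x i else x i

/-- The coefficient `α_j` in `SharpNoise = ∑_j α_j T_{ρ^j}`, i.e. the coefficient of `X^j` in
`(1 - (1 - X)^κ)^Δ`. -/
noncomputable def sharpNoiseCoeff (κ Δ j : ℕ) : ℝ :=
  ((1 - (1 - Polynomial.X) ^ κ) ^ Δ : Polynomial ℝ).coeff j

/-- The index of a value in the sample bundle of a point `x`: the set `T`, `|T| ≤ r`, stands for
the point `y = x^{⊕T}` of the ball `B(x, r)`, the second component for the noise rate `ρ^j`, the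
third for the copy. -/
abbrev BundleIndex (n : ℕ) (P : TesterParams) : Type :=
  {T : Finset (Fin n) // T.card ≤ P.r} × Fin (P.κ * P.Δ + 1) × Fin P.copies

/-- Draw a sample bundle for `x` and query `f` at all its points. The noise acts on the
coordinates outside `C`. -/
noncomputable def queryBundle (P : TesterParams) (k : ℕ) (C : Finset (Fin n)) (x : Cube n) :
    SampleAlg n (BundleIndex n P → ℤˣ) :=
  SampleAlg.seqAll fun b => do
    let z ← noisyPoint (rho k ^ (b.2.1 : ℕ)) Cᶜ (flip x b.1.1)
    SampleAlg.query z SampleAlg.ret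

/-- The estimate, from the values `v` of `f` on a sample bundle for `x`, of
`(SharpNoise f)(x^{⊕T})`, for `|T| ≤ r`. -/
noncomputable def sharpNoiseValue (P : TesterParams) (v : BundleIndex n P → ℤˣ)
    (T : Finset (Fin n)) : ℝ :=
  if hT : T.card ≤ P.r then
    ∑ j : Fin (P.κ * P.Δ + 1), sharpNoiseCoeff P.κ P.Δ j *
      ((∑ t : Fin P.copies, sgn (v (⟨T, hT⟩, j, t))) / P.copies)
  else 0

/-- The local estimator for the absolute value of the mean of a function of the coordinates in `V`:
`|h(x) - ∑_{i=1}^r a_i ∑_{S ⊆ V, |S| = i} 2^{-i} ∑_{T ⊆ S} (-1)^{|T|} h(x^{⊕T})|`, where `w T`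
stands for `h(x^{⊕T})`. -/
noncomputable def localEstimate (r : ℕ) (a : ℕ → ℝ) (V : Finset (Fin n))
    (w : Finset (Fin n) → ℝ) : ℝ :=
  |w ∅ - ∑ i ∈ Finset.Icc 1 r, a i * ∑ S ∈ V.powersetCard i,
    (1 / 2 ^ i) * ∑ T ∈ S.powerset, (-1) ^ T.card * w T|

/-- `Est_{C,U}`: the estimate of the correlation of `SharpNoise f` with the juntas on `U`, from
the values of `f` on the sample bundles. -/
noncomputable def corrEstimate (P : TesterParams) (U : Finset (Fin n))
    (B : Fin P.N → BundleIndex n P → ℤˣ) : ℝ :=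
  (∑ j, localEstimate P.r P.flat Uᶜ (sharpNoiseValue P (B j))) / P.N

/-- The sets `U` of size `k` with `C ⊆ U` such that `|{i : S_i ⊆ U and |S_i \ C| ≥ ℓ}|` is at most
an `ε²/10` fraction of the number of all test draws `S_i`. -/
noncomputable def admissible (k : ℕ) (ε : ℝ) (S : Fin (testDraws n ε) → Finset (Fin n))
    (C : Finset (Fin n)) : Finset (Finset (Fin n)) :=
  (Finset.univ.powersetCard k).filter fun U => C ⊆ U ∧
    ((Finset.univ.filter fun i => S i ⊆ U ∧ ell k ≤ (S i \ C).card).card : ℝ) ≤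
      ε ^ 2 / 10 * testDraws n ε

/-- One iteration of the main loop: it returns the maximum of `0` and of all `Est_{C,U}`. -/
noncomputable def iteration (P : TesterParams) (k : ℕ) (ε : ℝ)
    (S : Fin (testDraws n ε) → Finset (Fin n)) : SampleAlg n ℝ := do
  let A ← SampleAlg.seqAll fun _ : Fin (rounds k) => SampleAlg.draw SampleAlg.ret
  let C : Finset (Fin n) := Finset.univ.biUnion A
  let x ← SampleAlg.seqAll fun _ : Fin P.N =>
    SampleAlg.toss (PMF.uniformOfFintype (Cube n)) SampleAlg.ret
  let B ← SampleAlg.seqAll fun j : Fin P.N => queryBundle P k C (x j)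
  SampleAlg.ret ((admissible k ε S C).fold max 0 fun U => corrEstimate P U B)

/-- The tester. Its output `γ` is an estimate of the correlation of `f` with the `k`-juntas. -/
noncomputable def corrTester (P : TesterParams) (n k : ℕ) (ε : ℝ) : SampleAlg n ℝ := do
  let S ← SampleAlg.seqAll fun _ : Fin (testDraws n ε) => SampleAlg.draw SampleAlg.ret
  let γ ← SampleAlg.seqAll fun _ : Fin P.loops => iteration P k ε S
  SampleAlg.ret (Finset.univ.fold max 0 γ)

/-- The tester as an estimator of `dist(f, J_k)`: it outputs `(1 - γ)/2`. -/
noncomputable def distTester (P : TesterParams) (n k : ℕ) (ε : ℝ) : SampleAlg n ℝ := do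
  let γ ← corrTester P n k ε
  SampleAlg.ret ((1 - γ) / 2)

end JuntaTester

/-! The distance of `f` to the `k`-juntas is `(1 - max E|f_U|) / 2`, the maximum being over `|U| =
k`, where `f_U = juntaProj f U` keeps the Fourier coefficients inside `U`: the best junta on `U` is
the sign of `f_U` (`exists_juntaDist_eq`). It therefore suffices that no estimate exceeds the
maximum by more than `2ε` and that some estimate falls short of it by at most `2ε`.

The value `f_U(x)` is an average over all coordinates outside `U`, but it can be approximated from
flips of few coordinates. The local estimator multiplies `χ_S` by `1 - p(|S \ U|)`, where `p(m) = ∑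
a_i * binom(m, i)` (`localLinear_sum_chi`). Here `p(0) = 0`, and rescaled Chebyshev polynomials give
`p ≈ 1` on `1, …, m₀` with degree about `√m₀` up to logarithms (`exists_flat_coefficients`). Beyond
`m₀` the multiplier may be huge, so `f` is first passed through `SharpNoise`, whose multiplier is
close to `1` when `|S \ C| ≤ ℓ` and at most `2^{-Δ}` when `|S \ C| ≥ 2ℓκ`. As `ℓ ≈ k^{2/3}`, a
radius of `k^{1/3}` times logarithms suffices, and this determines the query count.

The price is that coefficients inside `U` with `|S \ C| ≥ ℓ` may be damped. By Parseval the bias is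
at most `√(farWeight + δ²)` (`abs_cubeMean_estimate_sub_le`). A useful `C` is found by luck: while
the far weight of the optimal `U` exceeds `c = 1/(1000 M)`, with `M` the number of test draws, a
spectral draw has probability above `c` of being a subset of `U` that adds at least `ℓ` elements to
`C`. Since `k ≤ rounds * ℓ`, the core is good after `rounds` draws with probability at least `c ^
rounds` (`prob_seqFin_goodCores_ge`); the main loop is repeated often enough to compensate.

The test draws reject, for all `C` and `U` at once, every far weight above `2ε²`
(`prob_tests_unsound_le`), while a far weight of at most `c` usually produces no hit. The tests are
shared by all iterations, so Markov's inequality is used to show that typical tests accept at least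
half of the good cores, by probability (`prob_tests_incomplete_le`). Two applications of Hoeffding's
inequality control the sampling. The bundles do not depend on `U`, so a union bound over `2^n` sets
handles all `U` simultaneously. Finally, each spectral draw or classical query is simulated exactly
by one quantum query (`SampleAlg.lawFrom_toQuantum`). -/

section

open Finset

/-! ### Flat polynomials -/

/-- The recurrence gives `T_{d+2} - T_{d+1} = (T_{d+1} - T_d) + 2t T_{d+1}` at `1 + t`, and `T_{d+1}
≥ 1` there. Hence the increments are at least `t(2d+1)` and sum to `t d²`. The induction carries the
bound on the increment along. -/
lemma chebyshev_eval_one_add_ge {t : ℝ} (ht : 0 ≤ t) (d : ℕ) :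
    1 + t * d ^ 2 ≤ (Polynomial.Chebyshev.T ℝ d).eval (1 + t) := by
  suffices h : 1 + t * d ^ 2 ≤ (Polynomial.Chebyshev.T ℝ d).eval (1 + t) ∧
      t * (2 * d + 1) ≤ (Polynomial.Chebyshev.T ℝ (d + 1 : ℕ)).eval (1 + t) -
        (Polynomial.Chebyshev.T ℝ d).eval (1 + t) from h.1
  induction d with
  | zero => simp
  | succ d ih =>
    obtain ⟨h1, h2⟩ := ih
    have h3 : 1 ≤ (Polynomial.Chebyshev.T ℝ (d + 1 : ℕ)).eval (1 + t) :=
      Polynomial.Chebyshev.one_le_eval_T_real _ (by linarith)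
    have h4 : (Polynomial.Chebyshev.T ℝ (d + 1 + 1 : ℕ)).eval (1 + t) =
        2 * (1 + t) * (Polynomial.Chebyshev.T ℝ (d + 1 : ℕ)).eval (1 + t) -
          (Polynomial.Chebyshev.T ℝ d).eval (1 + t) := by
      simp [add_assoc, one_add_one_eq_two]
    refine ⟨?_, ?_⟩
    · push_cast at *
      nlinarith
    · rw [h4]
      push_cast at *
      nlinarith

/-- A polynomial of degree `s * d` with value `1` at `0` and values at most `2^{-s}` on
`1, …, 2 d ^ 2 + 1`. -/
lemma exists_flat_polynomial (d s : ℕ) (hd : 1 ≤ d) :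
    ∃ q : Polynomial ℝ, q.natDegree ≤ s * d ∧ q.eval 0 = 1 ∧
      ∀ m : ℕ, 1 ≤ m → m ≤ 2 * d ^ 2 + 1 → |q.eval (m : ℝ)| ≤ (1 / 2) ^ s := by
  have hd' : (1 : ℝ) ≤ d := by exact_mod_cast hd
  set D : ℝ := (d : ℝ) ^ 2 with hD
  have hDpos : 0 < D := by positivity
  set v := (Polynomial.Chebyshev.T ℝ d).eval (1 + 1 / D) with hv
  have hv2 : 2 ≤ v := by
    have := chebyshev_eval_one_add_ge (t := 1 / D) (by positivity) d
    rw [← hD, one_div_mul_cancel hDpos.ne'] at this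
    linarith
  -- The affine map `m ↦ 1 + 1/D - m/D` sends `[1, 2D+1]` to `[-1, 1]`, where `T_d` is at most `1`,
  -- and sends `0` to `1 + 1/D`, where `T_d` equals `v ≥ 2`. Dividing by `v` gains a factor `1/2`;
  -- the power `s` amplifies it.
  refine ⟨(Polynomial.C (1 / v) * (Polynomial.Chebyshev.T ℝ d).comp
    (Polynomial.C (1 + 1 / D) - Polynomial.C (1 / D) * Polynomial.X)) ^ s, ?_, ?_, ?_⟩
  · refine Polynomial.natDegree_pow_le.trans (Nat.mul_le_mul_left _ ?_)
    refine (Polynomial.natDegree_C_mul_le _ _).trans (Polynomial.natDegree_comp_le.trans ?_)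
    have h1 : (Polynomial.Chebyshev.T ℝ d).natDegree ≤ d := by
      simp [Polynomial.Chebyshev.natDegree_T]
    have h2 : (Polynomial.C (1 + 1 / D) - Polynomial.C (1 / D) * Polynomial.X).natDegree ≤ 1 := by
      refine (Polynomial.natDegree_sub_le _ _).trans (max_le (by simp) ?_)
      exact (Polynomial.natDegree_C_mul_le _ _).trans (by simp)
    simpa using Nat.mul_le_mul h1 h2
  · simp only [Polynomial.eval_pow, Polynomial.eval_mul, Polynomial.eval_C, Polynomial.eval_comp,
      Polynomial.eval_sub, Polynomial.eval_X, mul_zero, sub_zero]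
    rw [← hv, one_div_mul_cancel (by linarith), one_pow]
  · intro m hm1 hm2
    simp only [Polynomial.eval_pow, Polynomial.eval_mul, Polynomial.eval_C, Polynomial.eval_comp,
      Polynomial.eval_sub, Polynomial.eval_X, abs_pow, abs_mul]
    refine pow_le_pow_left₀ (by positivity) ?_ s
    have hm1' : (1 : ℝ) ≤ m := by exact_mod_cast hm1
    have hm2' : (m : ℝ) ≤ 2 * D + 1 := by rw [hD]; exact_mod_cast hm2
    have h3 : |1 + 1 / D - 1 / D * m| ≤ 1 := by
      have e : 1 + 1 / D - 1 / D * m = 1 - (m - 1) / D := by field_simp; ring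
      have h5 : (m - 1) / D ≤ 2 := by rw [div_le_iff₀ hDpos]; linarith
      have h6 : 0 ≤ (m - 1) / D := div_nonneg (by linarith) hDpos.le
      rw [e, abs_le]
      constructor <;> linarith
    have h4 := Polynomial.Chebyshev.abs_eval_T_real_le_one d h3
    have h7 : |1 / v| ≤ 1 / 2 := by
      rw [abs_of_nonneg (by positivity)]
      exact one_div_le_one_div_of_le (by norm_num) hv2
    calc _ ≤ (1 / 2 : ℝ) * 1 := mul_le_mul h7 h4 (abs_nonneg _) (by norm_num)
      _ = 1 / 2 := mul_one _

/-- Newton's forward difference formula for a polynomial. -/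
lemma eval_natCast_eq_sum_choose (q : Polynomial ℝ) (r : ℕ) (hq : q.natDegree ≤ r) (m : ℕ) :
    q.eval (m : ℝ) = q.eval 0 +
      ∑ i ∈ Icc 1 r, ((fwdDiff (1 : ℝ))^[i] q.eval 0) * (m.choose i : ℝ) := by
  have h := shift_eq_sum_fwdDiff_iter (1 : ℝ) q.eval m 0
  -- The two cut-offs agree: terms with `i > m` vanish by the binomial coefficient, and terms with
  -- `i > r` because the `i`-th difference kills polynomials of degree below `i`.
  have h2 : ∑ i ∈ range (m + 1), m.choose i • (fwdDiff (1 : ℝ))^[i] q.eval 0 =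
      ∑ i ∈ range (r + 1), m.choose i • (fwdDiff (1 : ℝ))^[i] q.eval 0 := by
    rcases le_total m r with hmr | hmr
    · refine sum_subset (range_subset_range.mpr (by omega)) fun i _ hi => ?_
      rw [Nat.choose_eq_zero_of_lt (by simpa using hi), zero_smul]
    · refine (sum_subset (range_subset_range.mpr (by omega)) fun i _ hi => ?_).symm
      have : q.natDegree < i := by simp at hi; omega
      rw [Polynomial.fwdDiff_iter_eq_zero_of_degree_lt this]
      simp
  rw [h2, zero_add, nsmul_eq_mul, mul_one, sum_range_succ'] at h
  rw [h, add_comm, range_eq_Ico,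
    sum_Ico_add' (fun i => m.choose i • (fwdDiff (1 : ℝ))^[i] q.eval 0) 0 r 1]
  congr 1
  · simp
  · refine sum_congr (by ext; simp) fun i _ => ?_
    rw [nsmul_eq_mul, mul_comm]

/-- Coefficients in the binomial basis of a polynomial that vanishes at `0` and is `2^{-s}`-close
to `1` on `1, …, 2 d ^ 2 + 1`. -/
lemma exists_flat_coefficients (d s : ℕ) (hd : 1 ≤ d) (hs : s ≤ 2 * d) :
    ∃ a : ℕ → ℝ, (∀ i, i ≤ s * d → |a i| ≤ 2 ^ (s * d)) ∧
      ∀ m : ℕ, 1 ≤ m → m ≤ 2 * d ^ 2 + 1 →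
        |1 - ∑ i ∈ Icc 1 (s * d), a i * (m.choose i : ℝ)| ≤ (1 / 2) ^ s := by
  obtain ⟨q, hq, hq0, hqm⟩ := exists_flat_polynomial d s hd
  refine ⟨fun i => -(fwdDiff (1 : ℝ))^[i] q.eval 0, fun i hi => ?_, fun m hm1 hm2 => ?_⟩
  · rw [abs_neg, fwdDiff_iter_eq_sum_shift]
    -- Only the values `q(0), …, q(i)` enter, with `i ≤ s * d ≤ 2 * d ^ 2` by `hs`. They are all
    -- bounded by `1`, so the `i`-th difference is at most `∑ binom(i, j) = 2^i`.
    have hb : ∀ j ∈ range (i + 1), |((-1 : ℤ) ^ (i - j) * (i.choose j : ℤ)) •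
        q.eval (0 + j • (1 : ℝ))| ≤ (i.choose j : ℝ) := fun j hj => by
      have hj' : j ≤ s * d := by simp at hj; omega
      rw [zsmul_eq_mul, abs_mul]
      push_cast
      rw [abs_mul, abs_pow, abs_neg, abs_one, one_pow, one_mul, Nat.abs_cast]
      refine mul_le_of_le_one_right (Nat.cast_nonneg _) ?_
      rw [zero_add, nsmul_eq_mul, mul_one]
      rcases Nat.eq_zero_or_pos j with h0 | h0
      · subst h0; simp [hq0]
      · refine (hqm j h0 ?_).trans (pow_le_one₀ (by norm_num) (by norm_num))
        nlinarith
    refine (abs_sum_le_sum_abs _ _).trans ((sum_le_sum hb).trans ?_)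
    have := Nat.sum_range_choose i
    have h2 : (∑ j ∈ range (i + 1), (i.choose j : ℝ)) = 2 ^ i := by exact_mod_cast this
    rw [h2]
    exact pow_le_pow_right₀ (by norm_num) hi
  · have h := eval_natCast_eq_sum_choose q (s * d) hq m
    refine le_of_eq_of_le ?_ (hqm m hm1 hm2)
    congr 1
    rw [h, hq0]
    simp [neg_mul, sum_neg_distrib]

/-! ### The sharp noise multiplier -/

namespace JuntaTester

/-- The degree is at most `κ * Δ`, so the noise rates `ρ^j` queried by the tester account for the
entire polynomial. -/
lemma sum_sharpNoiseCoeff (κ Δ : ℕ) (x : ℝ) :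
    ∑ j : Fin (κ * Δ + 1), sharpNoiseCoeff κ Δ j * x ^ (j : ℕ) = (1 - (1 - x) ^ κ) ^ Δ := by
  have hdeg : ((1 - (1 - Polynomial.X) ^ κ) ^ Δ : Polynomial ℝ).natDegree < κ * Δ + 1 := by
    have h1 : ((1 - Polynomial.X) ^ κ : Polynomial ℝ).natDegree ≤ κ := by
      refine Polynomial.natDegree_pow_le.trans ?_
      have : (1 - Polynomial.X : Polynomial ℝ).natDegree ≤ 1 :=
        (Polynomial.natDegree_sub_le _ _).trans (by simp)
      nlinarith
    have h2 : (1 - (1 - Polynomial.X) ^ κ : Polynomial ℝ).natDegree ≤ κ :=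
      (Polynomial.natDegree_sub_le _ _).trans (by simpa using h1)
    refine Nat.lt_succ_of_le (Polynomial.natDegree_pow_le.trans ?_)
    rw [mul_comm]
    exact Nat.mul_le_mul_right _ h2
  have h := Polynomial.eval_eq_sum_range' hdeg x
  rw [← Fin.sum_univ_eq_sum_range
    (fun j => ((1 - (1 - Polynomial.X) ^ κ) ^ Δ : Polynomial ℝ).coeff j * x ^ j)] at h
  rw [show (∑ j : Fin (κ * Δ + 1), sharpNoiseCoeff κ Δ j * x ^ (j : ℕ)) = _ from h.symm]
  simp

end JuntaTester

/-- Coefficientwise domination of a real polynomial. -/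
def CoeffDominated (p q : Polynomial ℝ) : Prop := ∀ i, |p.coeff i| ≤ q.coeff i

namespace CoeffDominated

variable {p q p' q' : Polynomial ℝ}

lemma one : CoeffDominated 1 1 := fun i => by
  rw [Polynomial.coeff_one]; split_ifs <;> simp

lemma sub (h : CoeffDominated p q) (h' : CoeffDominated p' q') :
    CoeffDominated (p - p') (q + q') := fun i => by
  rw [Polynomial.coeff_sub, Polynomial.coeff_add]
  exact (abs_sub _ _).trans (add_le_add (h i) (h' i))

lemma mul (h : CoeffDominated p q) (h' : CoeffDominated p' q') :
    CoeffDominated (p * p') (q * q') := fun i => by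
  rw [Polynomial.coeff_mul, Polynomial.coeff_mul]
  refine (abs_sum_le_sum_abs _ _).trans (sum_le_sum fun x _ => ?_)
  rw [abs_mul]
  exact mul_le_mul (h _) (h' _) (abs_nonneg _) ((abs_nonneg _).trans (h _))

lemma pow (h : CoeffDominated p q) (m : ℕ) : CoeffDominated (p ^ m) (q ^ m) := by
  induction m with
  | zero => simpa using one
  | succ m ih => simpa [pow_succ] using ih.mul h

lemma X : CoeffDominated Polynomial.X Polynomial.X := fun i => by
  rw [Polynomial.coeff_X]; split_ifs <;> simp

lemma sum_le_eval_one (h : CoeffDominated p q) (m : ℕ) :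
    ∑ j : Fin m, |p.coeff j| ≤ q.eval 1 := by
  calc ∑ j : Fin m, |p.coeff j| ≤ ∑ j : Fin m, q.coeff j := sum_le_sum fun j _ => h j
    _ = ∑ j ∈ range m, q.coeff j := Fin.sum_univ_eq_sum_range q.coeff m
    -- Domination makes the coefficients of `q` nonnegative, so the range may be enlarged until it
    -- covers the degree.
    _ ≤ ∑ j ∈ range (max m (q.natDegree + 1)), q.coeff j :=
        sum_le_sum_of_subset_of_nonneg (range_subset_range.mpr (le_max_left _ _))
          fun j _ _ => (abs_nonneg _).trans (h j)
    _ = q.eval 1 := by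
        rw [Polynomial.eval_eq_sum_range' (lt_of_lt_of_le (Nat.lt_succ_self _) (le_max_right m _))]
        simp

end CoeffDominated

namespace JuntaTester

/-- Turning all minus signs into plus signs dominates the polynomial coefficientwise by `(1 + (1 +
X)^κ)^Δ`, whose value at `1` is `(1 + 2^κ)^Δ`. -/
lemma sum_abs_sharpNoiseCoeff_le (κ Δ : ℕ) :
    ∑ j : Fin (κ * Δ + 1), |sharpNoiseCoeff κ Δ j| ≤ 2 ^ ((κ + 1) * Δ) := by
  have h : CoeffDominated ((1 - (1 - Polynomial.X) ^ κ) ^ Δ) ((1 + (1 + Polynomial.X) ^ κ) ^ Δ) :=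
    (CoeffDominated.one.sub ((CoeffDominated.one.sub .X).pow κ)).pow Δ
  refine (h.sum_le_eval_one _).trans ?_
  simp only [Polynomial.eval_pow, Polynomial.eval_add, Polynomial.eval_one, Polynomial.eval_X]
  rw [pow_mul]
  refine pow_le_pow_left₀ (by positivity) ?_ _
  rw [pow_succ]
  have : (1 : ℝ) ≤ 2 ^ κ := one_le_pow₀ (by norm_num)
  norm_num
  linarith

/-- The multiplier of `SharpNoise` at a Fourier coefficient with `d` noisy coordinates. -/
noncomputable def sharpMultiplier (κ Δ k d : ℕ) : ℝ := (1 - (1 - (rho k : ℝ) ^ d) ^ κ) ^ Δ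

lemma rounds_pos {k : ℕ} (hk : 1 ≤ k) : 1 ≤ rounds k :=
  Nat.one_le_ceil_iff.mpr (by positivity)

lemma ell_pos {k : ℕ} (hk : 1 ≤ k) : 1 ≤ ell k :=
  Nat.one_le_ceil_iff.mpr (by positivity)

/-- `rounds k ^ 2` is an integer above `k^{2/3}`. This is what makes a Chebyshev degree proportional
to `rounds k` sufficient. -/
lemma ell_le_rounds_sq (k : ℕ) : ell k ≤ rounds k ^ 2 := by
  refine Nat.ceil_le.mpr ?_
  push_cast
  have h1 : (k : ℝ) ^ ((1 : ℝ) / 3) ≤ rounds k := Nat.le_ceil _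
  have h2 : (k : ℝ) ^ ((2 : ℝ) / 3) = ((k : ℝ) ^ ((1 : ℝ) / 3)) ^ 2 := by
    rw [← Real.rpow_natCast, ← Real.rpow_mul (Nat.cast_nonneg _)]
    norm_num
  rw [h2]
  exact pow_le_pow_left₀ (by positivity) h1 2

/-- This guarantees that `rounds k` additions of `ℓ` new elements each exhaust a set of size `k`. -/
lemma le_rounds_mul_ell {k : ℕ} (hk : 1 ≤ k) : k ≤ rounds k * ell k := by
  have h1 : (k : ℝ) ^ ((1 : ℝ) / 3) ≤ rounds k := Nat.le_ceil _
  have h2 : (k : ℝ) ^ ((2 : ℝ) / 3) ≤ ell k := Nat.le_ceil _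
  have h3 : (k : ℝ) = (k : ℝ) ^ ((1 : ℝ) / 3) * (k : ℝ) ^ ((2 : ℝ) / 3) := by
    rw [← Real.rpow_add (by positivity)]
    norm_num
  have : (k : ℝ) ≤ rounds k * ell k := by
    rw [h3]
    exact mul_le_mul h1 h2 (by positivity) (by positivity)
  exact_mod_cast this

lemma rounds_le {k : ℕ} (hk : 1 ≤ k) : rounds k ≤ k := by
  refine Nat.ceil_le.mpr ?_
  have h1 : (1 : ℝ) ≤ k := by exact_mod_cast hk
  calc (k : ℝ) ^ ((1 : ℝ) / 3) ≤ (k : ℝ) ^ (1 : ℝ) :=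
        Real.rpow_le_rpow_of_exponent_le h1 (by norm_num)
    _ = k := Real.rpow_one _

/-- By Bernoulli's inequality, `(1 - 1/(2ℓ))^ℓ ≥ 1 - 1/2`. -/
lemma rho_pow_ge {k : ℕ} (hk : 1 ≤ k) {d : ℕ} (hd : d ≤ ell k) :
    (1 : ℝ) / 2 ≤ (rho k : ℝ) ^ d := by
  have hl : (1 : ℝ) ≤ ell k := by exact_mod_cast ell_pos hk
  have hd' : (d : ℝ) ≤ ell k := by exact_mod_cast hd
  have hx : 1 / (2 * (ell k : ℝ)) ≤ 1 := by
    rw [div_le_one (by positivity)]; linarith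
  have h := one_add_mul_le_pow (a := -(1 / (2 * (ell k : ℝ)))) (by linarith) d
  have e : (rho k : ℝ) = 1 + -(1 / (2 * (ell k : ℝ))) := by simp [rho]; ring
  rw [e]
  refine le_trans ?_ h
  have : (d : ℝ) * (1 / (2 * (ell k : ℝ))) ≤ 1 / 2 := by
    rw [mul_one_div, div_le_div_iff₀ (by positivity) (by norm_num)]
    linarith
  linarith

/-- Each block of `2ℓ` factors contributes at most `e^{-1} ≤ 1/2`. -/
lemma rho_pow_le {k : ℕ} (hk : 1 ≤ k) {κ d : ℕ} (hd : 2 * ell k * κ ≤ d) :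
    (rho k : ℝ) ^ d ≤ (1 / 2) ^ κ := by
  have hl : (1 : ℝ) ≤ ell k := by exact_mod_cast ell_pos hk
  have h0 := (rho k).2.1
  have h1 := (rho k).2.2
  refine (pow_le_pow_of_le_one h0 h1 hd).trans ?_
  rw [pow_mul]
  refine pow_le_pow_left₀ (by positivity) ?_ _
  have e : (rho k : ℝ) ≤ Real.exp (-(1 / (2 * (ell k : ℝ)))) := by
    have := Real.add_one_le_exp (-(1 / (2 * (ell k : ℝ))))
    simp only [rho]
    linarith
  calc (rho k : ℝ) ^ (2 * ell k) ≤ Real.exp (-(1 / (2 * (ell k : ℝ)))) ^ (2 * ell k) :=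
        pow_le_pow_left₀ h0 e _
    _ = Real.exp (-1) := by
        rw [← Real.exp_nat_mul]
        congr 1
        push_cast
        field_simp
    _ ≤ 1 / 2 := by
        have := Real.exp_neg_one_lt_d9
        linarith

lemma sharpMultiplier_mem (κ Δ k d : ℕ) :
    0 ≤ sharpMultiplier κ Δ k d ∧ sharpMultiplier κ Δ k d ≤ 1 := by
  have h0 : 0 ≤ (rho k : ℝ) ^ d := pow_nonneg (rho k).2.1 _
  have h1 : (rho k : ℝ) ^ d ≤ 1 := pow_le_one₀ (rho k).2.1 (rho k).2.2
  have h2 : 0 ≤ (1 - (rho k : ℝ) ^ d) ^ κ := pow_nonneg (by linarith) _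
  have h3 : (1 - (rho k : ℝ) ^ d) ^ κ ≤ 1 := pow_le_one₀ (by linarith) (by linarith)
  exact ⟨pow_nonneg (by linarith) _, pow_le_one₀ (by linarith) (by linarith)⟩

/-- Below the threshold `ρ^d ≥ 1/2`, so the inner term is at most `2^{-κ}`; Bernoulli's inequality
bounds the loss from the outer power `Δ`. -/
lemma sharpMultiplier_ge (κ Δ : ℕ) {k d : ℕ} (hk : 1 ≤ k) (hd : d ≤ ell k) :
    1 - Δ * (1 / 2) ^ κ ≤ sharpMultiplier κ Δ k d := by
  have h1 : (rho k : ℝ) ^ d ≤ 1 := pow_le_one₀ (rho k).2.1 (rho k).2.2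
  have h2 := rho_pow_ge hk hd
  have h3 : (1 - (rho k : ℝ) ^ d) ^ κ ≤ (1 / 2) ^ κ :=
    pow_le_pow_left₀ (by linarith) (by linarith) _
  have h4 : (1 - (rho k : ℝ) ^ d) ^ κ ≤ 1 := pow_le_one₀ (by linarith) (by linarith)
  have h := one_add_mul_le_pow (a := -((1 - (rho k : ℝ) ^ d) ^ κ)) (by linarith) Δ
  rw [sharpMultiplier, sub_eq_add_neg]
  refine le_trans ?_ h
  have : (Δ : ℝ) * (1 - (rho k : ℝ) ^ d) ^ κ ≤ Δ * (1 / 2) ^ κ :=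
    mul_le_mul_of_nonneg_left h3 (Nat.cast_nonneg _)
  linarith

/-- Bernoulli's inequality bounds the base `1 - (1 - ρ^d)^κ` by `κ ρ^d ≤ κ 2^{-κ} ≤ 1/2`. -/
lemma sharpMultiplier_le (κ Δ : ℕ) {k d : ℕ} (hk : 1 ≤ k) (hκ : 1 ≤ κ)
    (hd : 2 * ell k * κ ≤ d) : sharpMultiplier κ Δ k d ≤ (1 / 2) ^ Δ := by
  have h0 : 0 ≤ (rho k : ℝ) ^ d := pow_nonneg (rho k).2.1 _
  have h1 : (rho k : ℝ) ^ d ≤ 1 := pow_le_one₀ (rho k).2.1 (rho k).2.2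
  have h2 := rho_pow_le hk hd
  have h := one_add_mul_le_pow (a := -(rho k : ℝ) ^ d) (by linarith) κ
  have h3 : (κ : ℝ) * (1 / 2) ^ κ ≤ 1 / 2 := by
    obtain ⟨m, rfl⟩ := Nat.exists_eq_add_of_le' hκ
    have h5 : (m + 1 : ℕ) ≤ 2 ^ m := Nat.lt_two_pow_self
    have h6 : ((m + 1 : ℕ) : ℝ) ≤ 2 ^ m := by exact_mod_cast h5
    rw [one_div_pow, pow_succ, mul_one_div, div_le_div_iff₀ (by positivity) (by norm_num)]
    linarith
  have h4 : (κ : ℝ) * (rho k : ℝ) ^ d ≤ κ * (1 / 2) ^ κ :=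
    mul_le_mul_of_nonneg_left h2 (Nat.cast_nonneg _)
  have h5 : (1 - (rho k : ℝ) ^ d) ^ κ ≤ 1 := pow_le_one₀ (by linarith) (by linarith)
  rw [sub_eq_add_neg] at h5
  refine pow_le_pow_left₀ ?_ ?_ Δ <;> rw [sub_eq_add_neg 1 (_ ^ d)] <;> linarith

end JuntaTester

/-! ### Fourier analysis on the cube -/

/-- The mean of a real function for the uniform distribution on the cube. -/
noncomputable def cubeMean {n : ℕ} (g : Cube n → ℝ) : ℝ := (1 / 2 ^ n) * ∑ x, g x

/-- The average of `f` over the coordinates outside `U`, i.e. `∑_{S ⊆ U} f̂(S) χ_S`. -/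
noncomputable def juntaProj {n : ℕ} (f : Cube n → ℤˣ) (U : Finset (Fin n)) (x : Cube n) : ℝ :=
  ∑ S ∈ U.powerset, cubeCoeff f S * chi S x

section Fourier

variable {n : ℕ}

lemma cubeMean_mono {g h : Cube n → ℝ} (H : ∀ x, g x ≤ h x) : cubeMean g ≤ cubeMean h :=
  mul_le_mul_of_nonneg_left (sum_le_sum fun x _ => H x) (by positivity)

lemma cubeMean_sub (g h : Cube n → ℝ) :
    cubeMean (fun x => g x - h x) = cubeMean g - cubeMean h := by
  simp [cubeMean, sum_sub_distrib, mul_sub]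

lemma cubeMean_const (c : ℝ) : cubeMean (fun _ : Cube n => c) = c := by
  rw [cubeMean, sum_const, card_univ, nsmul_eq_mul, card_cube]
  field_simp

lemma abs_sgn (b : ℤˣ) : |sgn b| = 1 := by
  rcases Int.units_eq_one_or b with h | h <;> subst h <;> simp [sgn]

lemma sgn_eq_sum_coeff_mul_chi (f : Cube n → ℤˣ) (x : Cube n) :
    sgn (f x) = ∑ S, cubeCoeff f S * chi S x := by
  simp_rw [cubeCoeff, mul_assoc, sum_mul, ← mul_sum]
  rw [sum_comm]
  simp_rw [mul_assoc, ← mul_sum, sum_chi_mul_dual]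
  simp
  field_simp

lemma cubeMean_sum_chi_sq (c : Finset (Fin n) → ℝ) :
    cubeMean (fun x => (∑ S, c S * chi S x) ^ 2) = ∑ S, c S ^ 2 := by
  have h : ∀ x : Cube n, (∑ S, c S * chi S x) ^ 2 =
      ∑ S, ∑ T, c S * c T * (chi S x * chi T x) := fun x => by
    rw [sq, sum_mul_sum]
    exact sum_congr rfl fun S _ => sum_congr rfl fun T _ => by ring
  simp_rw [cubeMean, h]
  rw [sum_comm]
  simp_rw [sum_comm (s := (univ : Finset (Cube n))), ← mul_sum, sum_chi_mul]
  simp only [mul_ite, mul_zero, sum_ite_eq, mem_univ, if_true]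
  rw [← sum_mul]
  field_simp

lemma cubeMean_abs_le_sqrt (g : Cube n → ℝ) :
    cubeMean (fun x => |g x|) ≤ Real.sqrt (cubeMean fun x => g x ^ 2) := by
  refine Real.le_sqrt_of_sq_le ?_
  have h := sq_sum_le_card_mul_sum_sq (s := (univ : Finset (Cube n))) (f := fun x => |g x|)
  rw [card_univ, card_cube] at h
  simp only [sq_abs] at h
  rw [cubeMean, cubeMean, mul_pow]
  calc (1 / 2 ^ n : ℝ) ^ 2 * (∑ x, |g x|) ^ 2 ≤ (1 / 2 ^ n) ^ 2 * (2 ^ n * ∑ x, g x ^ 2) := by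
        gcongr
    _ = _ := by field_simp

lemma cubeMean_abs_sum_chi_le (c : Finset (Fin n) → ℝ) :
    cubeMean (fun x => |∑ S, c S * chi S x|) ≤ Real.sqrt (∑ S, c S ^ 2) := by
  rw [← cubeMean_sum_chi_sq]
  exact cubeMean_abs_le_sqrt _

lemma cubeMean_abs_sub_le (g h : Cube n → ℝ) :
    |cubeMean (fun x => |g x|) - cubeMean (fun x => |h x|)| ≤ cubeMean (fun x => |g x - h x|) := by
  rw [← cubeMean_sub, cubeMean, abs_mul, abs_of_nonneg (by positivity : (0 : ℝ) ≤ 1 / 2 ^ n)]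
  refine mul_le_mul_of_nonneg_left ((abs_sum_le_sum_abs _ _).trans
    (sum_le_sum fun x _ => abs_abs_sub_abs_le_abs_sub _ _)) (by positivity)

/-! ### Flips -/

lemma chi_flip (S T : Finset (Fin n)) (x : Cube n) :
    chi S (JuntaTester.flip x T) = chi S x * ∏ i ∈ T, if i ∈ S then -1 else 1 := by
  have h : ∏ i ∈ T, (if i ∈ S then (-1 : ℝ) else 1) = ∏ i ∈ S, if i ∈ T then (-1 : ℝ) else 1 := by
    rw [prod_ite_mem, prod_ite_mem, inter_comm]
  rw [h, chi, chi, ← prod_mul_distrib]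
  refine prod_congr rfl fun i _ => ?_
  by_cases hi : i ∈ T <;> simp [JuntaTester.flip, hi, sgn]

/-- Flipping `T` multiplies `χ_Q` by a product over `T`, so the sum factors into `∏_{i ∈ S} (1 ±
1)`; an element of `S` outside `Q` contributes a zero factor. -/
lemma sum_powerset_neg_one_pow_mul_chi_flip (S Q : Finset (Fin n)) (x : Cube n) :
    ∑ T ∈ S.powerset, (-1) ^ T.card * chi Q (JuntaTester.flip x T) =
      if S ⊆ Q then 2 ^ S.card * chi Q x else 0 := by
  have h : ∀ T : Finset (Fin n), (-1) ^ T.card * chi Q (JuntaTester.flip x T) =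
      chi Q x * ∏ i ∈ T, (if i ∈ Q then (1 : ℝ) else -1) := fun T => by
    rw [chi_flip, mul_left_comm, ← prod_const, ← prod_mul_distrib]
    congr 1
    exact prod_congr rfl fun i _ => by split_ifs <;> simp
  simp_rw [h, ← mul_sum, ← prod_one_add]
  split_ifs with hS
  · rw [prod_congr rfl (g := fun _ => (2 : ℝ)) fun i hi => by rw [if_pos (hS hi)]; norm_num,
      prod_const, mul_comm]
  · obtain ⟨i, hi, hiQ⟩ := not_subset.mp hS
    rw [prod_eq_zero hi (by simp [hiQ]), mul_zero]

/-- This count puts the multiplier of the local estimator in the binomial basis. -/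
lemma card_powersetCard_subset (V Q : Finset (Fin n)) (i : ℕ) :
    ((V.powersetCard i).filter fun S => S ⊆ Q).card = (Q ∩ V).card.choose i := by
  rw [← card_powersetCard]
  congr 1
  ext S
  simp only [mem_filter, mem_powersetCard, subset_inter_iff]
  tauto

/-! ### Distance to juntas -/

/-- Flipping coordinate `i` permutes the cube, fixes `g` and changes the sign of `χ_S`. -/
lemma cubeMean_chi_mul_eq_zero {S : Finset (Fin n)} {i : Fin n} (hi : i ∈ S) (g : Cube n → ℝ)
    (hg : ∀ x, g (JuntaTester.flip x {i}) = g x) : cubeMean (fun x => chi S x * g x) = 0 := by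
  have hinv : Function.Involutive fun x : Cube n => JuntaTester.flip x {i} := fun x => by
    funext j
    by_cases hj : j ∈ ({i} : Finset (Fin n)) <;> simp [JuntaTester.flip, hj]
  have h := Equiv.sum_comp hinv.toPerm fun x => chi S x * g x
  simp only [Function.Involutive.coe_toPerm, hg, chi_flip, prod_singleton, if_pos hi, mul_neg,
    mul_one, neg_mul, sum_neg_distrib] at h
  rw [cubeMean]
  have : ∑ x, chi S x * g x = 0 := by linarith
  rw [this, mul_zero]

/-- A character not supported inside `U` involves a coordinate on which `g` does not depend, so it
is orthogonal to `g`. -/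
lemma cubeMean_mul_eq_juntaProj (f : Cube n → ℤˣ) (U : Finset (Fin n)) (g : Cube n → ℝ)
    (hg : ∀ x, ∀ i ∉ U, g (JuntaTester.flip x {i}) = g x) :
    cubeMean (fun x => sgn (f x) * g x) = cubeMean (fun x => juntaProj f U x * g x) := by
  rw [← sub_eq_zero, ← cubeMean_sub]
  have h : ∀ x, sgn (f x) * g x - juntaProj f U x * g x =
      ∑ S ∈ univ.filter (fun S => ¬ S ⊆ U), cubeCoeff f S * (chi S x * g x) := fun x => by
    have hs := sum_filter_add_sum_filter_not univ (fun S => S ⊆ U)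
      fun S => cubeCoeff f S * chi S x
    have e : univ.filter (fun S => S ⊆ U) = U.powerset := by ext; simp
    rw [e] at hs
    rw [sgn_eq_sum_coeff_mul_chi, ← hs, juntaProj, add_mul, add_sub_cancel_left, sum_mul]
    exact sum_congr rfl fun S _ => mul_assoc _ _ _
  simp_rw [h, cubeMean]
  rw [sum_comm, mul_sum]
  refine sum_eq_zero fun S hS => ?_
  obtain ⟨i, hi, hiU⟩ := not_subset.mp (mem_filter.mp hS).2
  have := cubeMean_chi_mul_eq_zero hi g fun x => hg x i hiU
  rw [cubeMean] at this
  rw [← mul_sum, mul_left_comm, this, mul_zero]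

lemma hammingDistance_eq (f g : Cube n → ℤˣ) :
    hammingDistance f g = (1 - cubeMean (fun x => sgn (f x) * sgn (g x))) / 2 := by
  have h : ∀ x, sgn (f x) * sgn (g x) = 1 - 2 * if f x ≠ g x then 1 else 0 := fun x => by
    rcases Int.units_eq_one_or (f x) with h | h <;> rcases Int.units_eq_one_or (g x) with h' | h' <;>
      simp [h, h', sgn] <;> norm_num
  simp_rw [h, cubeMean_sub, cubeMean_const, hammingDistance, cubeMean, ← mul_sum, sum_boole]
  field_simp
  ring

lemma juntaProj_congr (f : Cube n → ℤˣ) (U : Finset (Fin n)) {x y : Cube n}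
    (h : ∀ i ∈ U, x i = y i) : juntaProj f U x = juntaProj f U y := by
  refine sum_congr rfl fun S hS => ?_
  congr 1
  exact prod_congr rfl fun i hi => by rw [h i (mem_powerset.mp hS hi)]

lemma exists_junta_of_card_eq (f : Cube n → ℤˣ) {k : ℕ} {U : Finset (Fin n)} (hU : U.card = k) :
    ∃ g, IsJunta k g ∧
      hammingDistance f g = (1 - cubeMean fun x => |juntaProj f U x|) / 2 := by
  classical
  set g : Cube n → ℤˣ := fun x => if 0 ≤ juntaProj f U x then 1 else -1 with hg
  have hcongr : ∀ x y : Cube n, (∀ i ∈ U, x i = y i) → g x = g y := fun x y h => by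
    simp only [hg, juntaProj_congr f U h]
  -- A point of the `k`-dimensional cube is extended by `1` outside `U`; the filler is immaterial
  -- since `g` depends only on coordinates in `U`.
  refine ⟨g, ⟨U.orderEmbOfFin hU, fun z => g fun i =>
    if hi : ∃ j, U.orderEmbOfFin hU j = i then z hi.choose else 1,
      fun x => hcongr _ _ fun i hi => ?_⟩, ?_⟩
  · have hi' : ∃ j, U.orderEmbOfFin hU j = i := by
      have : i ∈ Set.range (U.orderEmbOfFin hU) := by rw [range_orderEmbOfFin]; exact hi
      exact this
    simp only [dif_pos hi']
    rw [hi'.choose_spec]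
  · rw [hammingDistance_eq, cubeMean_mul_eq_juntaProj f U]
    · congr 3
      funext x
      simp only [hg]
      split_ifs with h
      · rw [sgn_one, mul_one, abs_of_nonneg h]
      · rw [sgn_neg_one, mul_neg_one, abs_of_neg (lt_of_not_ge h)]
    · intro x i hi
      rw [hcongr (JuntaTester.flip x {i}) x fun j hj => ?_]
      have : j ≠ i := fun e => hi (e ▸ hj)
      simp [JuntaTester.flip, this]

/-- The correlation of `f` with a junta on `U` is that of `f_U`, which is at most `E|f_U|` because
the junta has absolute value `1`. -/
lemma exists_card_eq_of_isJunta (f : Cube n → ℤˣ) {k : ℕ} {g : Cube n → ℤˣ} (hg : IsJunta k g) :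
    ∃ U : Finset (Fin n), U.card = k ∧
      (1 - cubeMean fun x => |juntaProj f U x|) / 2 ≤ hammingDistance f g := by
  obtain ⟨i, h, hgh⟩ := hg
  refine ⟨univ.map i.toEmbedding, by simp, ?_⟩
  rw [hammingDistance_eq, cubeMean_mul_eq_juntaProj f (univ.map i.toEmbedding)]
  · have : cubeMean (fun x => juntaProj f (univ.map i.toEmbedding) x * sgn (g x)) ≤
        cubeMean fun x => |juntaProj f (univ.map i.toEmbedding) x| := cubeMean_mono fun x => by
      refine (le_abs_self _).trans ?_
      rw [abs_mul, abs_sgn, mul_one]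
    linarith
  · intro x j hj
    rw [hgh, hgh]
    congr 2
    funext l
    have : i l ≠ j := fun e => hj (by simp [← e])
    simp [JuntaTester.flip, this]

/-- The distance to the `k`-juntas is determined by the maximal correlation
`max_U E|f_U|`, `|U| = k`. -/
lemma exists_juntaDist_eq (f : Cube n → ℤˣ) {k : ℕ} (hkn : k ≤ n) :
    ∃ U : Finset (Fin n), U.card = k ∧
      juntaDist k f = (1 - cubeMean fun x => |juntaProj f U x|) / 2 ∧
      ∀ V : Finset (Fin n), V.card = k →
        cubeMean (fun x => |juntaProj f V x|) ≤ cubeMean fun x => |juntaProj f U x| := by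
  obtain ⟨U, hU, hmax⟩ := exists_max_image ((univ : Finset (Fin n)).powersetCard k)
    (fun U => cubeMean fun x => |juntaProj f U x|)
    (powersetCard_nonempty.mpr (by simpa using hkn))
  have hUk := (mem_powersetCard.mp hU).2
  have hmax' : ∀ V : Finset (Fin n), V.card = k →
      cubeMean (fun x => |juntaProj f V x|) ≤ cubeMean fun x => |juntaProj f U x| := fun V hV =>
    hmax V (mem_powersetCard.mpr ⟨subset_univ _, hV⟩)
  refine ⟨U, hUk, IsLeast.csInf_eq ⟨?_, ?_⟩, hmax'⟩
  · obtain ⟨g, hg, hd⟩ := exists_junta_of_card_eq f hUk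
    exact ⟨g, hg, hd.symm⟩
  · rintro _ ⟨g, hg, rfl⟩
    obtain ⟨V, hV, hle⟩ := exists_card_eq_of_isJunta f hg
    have := hmax' V hV
    linarith

/-- Cauchy–Schwarz and Parseval. Its purpose is to show that a large correlation forces substantial
spectral weight inside `U`. -/
lemma cubeMean_abs_juntaProj_le (f : Cube n → ℤˣ) (U : Finset (Fin n)) :
    cubeMean (fun x => |juntaProj f U x|) ≤ Real.sqrt (∑ S ∈ U.powerset, cubeCoeff f S ^ 2) := by
  have h := cubeMean_abs_sum_chi_le fun S => if S ∈ U.powerset then cubeCoeff f S else 0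
  simpa only [ite_mul, zero_mul, ite_pow, zero_pow two_ne_zero, sum_ite_mem, univ_inter,
    juntaProj] using h

end Fourier

/-! ### The local mean estimator -/

namespace JuntaTester

variable {n : ℕ}

/-- The local estimator before taking the absolute value. -/
noncomputable def localLinear (r : ℕ) (a : ℕ → ℝ) (V : Finset (Fin n))
    (w : Finset (Fin n) → ℝ) : ℝ :=
  w ∅ - ∑ i ∈ Icc 1 r, a i * ∑ S ∈ V.powersetCard i,
    (1 / 2 ^ i) * ∑ T ∈ S.powerset, (-1) ^ T.card * w T

lemma localLinear_sub (r : ℕ) (a : ℕ → ℝ) (V : Finset (Fin n)) (w w' : Finset (Fin n) → ℝ) :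
    localLinear r a V (fun T => w T - w' T) = localLinear r a V w - localLinear r a V w' := by
  simp only [localLinear, mul_sub, sum_sub_distrib]
  ring

/-- A bound for the sensitivity of the local estimator. -/
noncomputable def localBound (n r : ℕ) (a : ℕ → ℝ) : ℝ :=
  1 + ∑ i ∈ Icc 1 r, |a i| * (n.choose i : ℝ)

/-- The factor `2^{-i}` turns each alternating sum into a signed average, and there are at most
`binom(n, i)` sets `S`. Only `|T| ≤ r` is evaluated, which matches the default value `0` of
`sharpNoiseValue` beyond the radius. -/
lemma abs_localLinear_le (r : ℕ) (a : ℕ → ℝ) (V : Finset (Fin n)) (w : Finset (Fin n) → ℝ)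
    {b : ℝ} (hb : 0 ≤ b) (hw : ∀ T : Finset (Fin n), T.card ≤ r → |w T| ≤ b) :
    |localLinear r a V w| ≤ localBound n r a * b := by
  rw [localLinear, localBound, add_mul, one_mul, sum_mul]
  refine (abs_sub _ _).trans (add_le_add (hw _ (by simp))
    ((abs_sum_le_sum_abs _ _).trans (sum_le_sum fun i hi => ?_)))
  rw [abs_mul, mul_assoc]
  refine mul_le_mul_of_nonneg_left ?_ (abs_nonneg _)
  have h1 : ∀ S ∈ V.powersetCard i,
      |(1 / 2 ^ i) * ∑ T ∈ S.powerset, (-1) ^ T.card * w T| ≤ b := fun S hS => by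
    have hSi := (mem_powersetCard.mp hS).2
    rw [abs_mul, abs_of_nonneg (by positivity : (0 : ℝ) ≤ 1 / 2 ^ i)]
    have h2 : |∑ T ∈ S.powerset, (-1) ^ T.card * w T| ≤ 2 ^ i * b := by
      refine (abs_sum_le_sum_abs _ _).trans ((sum_le_card_nsmul _ _ b fun T hT => ?_).trans ?_)
      · rw [abs_mul, abs_pow, abs_neg, abs_one, one_pow, one_mul]
        refine hw T ((card_le_card (mem_powerset.mp hT)).trans ?_)
        rw [hSi]
        exact (mem_Icc.mp hi).2
      · rw [card_powerset, hSi, nsmul_eq_mul]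
        push_cast
        exact le_rfl
    calc (1 / 2 ^ i : ℝ) * |∑ T ∈ S.powerset, (-1) ^ T.card * w T| ≤ 1 / 2 ^ i * (2 ^ i * b) := by
          gcongr
      _ = b := by field_simp
  refine (abs_sum_le_sum_abs _ _).trans ((sum_le_card_nsmul _ _ b h1).trans ?_)
  rw [nsmul_eq_mul, card_powersetCard]
  refine mul_le_mul_of_nonneg_right ?_ hb
  exact_mod_cast Nat.choose_le_choose i ((card_le_univ V).trans (by simp))

/-- The noisy value of `f`, with noise rate `ρ` outside `C`. -/
noncomputable def noisyMean (f : Cube n → ℤˣ) (C : Finset (Fin n)) (ρ : ℝ) (y : Cube n) : ℝ :=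
  ∑ S, cubeCoeff f S * (ρ ^ (S \ C).card * chi S y)

/-- `SharpNoise f`. -/
noncomputable def sharpNoise (f : Cube n → ℤˣ) (κ Δ k : ℕ) (C : Finset (Fin n)) (y : Cube n) : ℝ :=
  ∑ S, cubeCoeff f S * (sharpMultiplier κ Δ k (S \ C).card * chi S y)

/-- Noise of rate `ρ^j` multiplies a coefficient with `d` noisy coordinates by `(ρ^d)^j`. The
combination therefore evaluates `(1 - (1 - X)^κ)^Δ` at `X = ρ^d`. -/
lemma sum_coeff_mul_noisyMean (f : Cube n → ℤˣ) (κ Δ k : ℕ) (C : Finset (Fin n)) (y : Cube n) :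
    ∑ j : Fin (κ * Δ + 1), sharpNoiseCoeff κ Δ j * noisyMean f C ((rho k : ℝ) ^ (j : ℕ)) y =
      sharpNoise f κ Δ k C y := by
  simp_rw [noisyMean, sharpNoise, mul_sum]
  rw [sum_comm]
  refine sum_congr rfl fun S _ => ?_
  rw [sharpMultiplier, ← sum_sharpNoiseCoeff, sum_mul, mul_sum]
  refine sum_congr rfl fun j _ => ?_
  rw [← pow_mul, ← pow_mul, mul_comm (j : ℕ)]
  ring

/-- The Fourier multiplier of the local estimator applied to `SharpNoise f`. -/
noncomputable def estMultiplier (P : TesterParams) (k : ℕ) (C U S : Finset (Fin n)) : ℝ :=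
  sharpMultiplier P.κ P.Δ k (S \ C).card *
    (1 - ∑ i ∈ Icc 1 P.r, P.flat i * ((S \ U).card.choose i : ℝ))

/-- The estimator is diagonal in the characters: the inner alternating sum detects `S ⊆ Q`, and the
number of `i`-subsets of `Q \ U` is a binomial coefficient. -/
lemma localLinear_sum_chi (r : ℕ) (a : ℕ → ℝ) (U : Finset (Fin n)) (c : Finset (Fin n) → ℝ)
    (x : Cube n) :
    localLinear r a Uᶜ (fun T => ∑ Q, c Q * chi Q (flip x T)) =
      ∑ Q, c Q * (1 - ∑ i ∈ Icc 1 r, a i * ((Q \ U).card.choose i : ℝ)) * chi Q x := by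
  have h0 : flip x ∅ = x := by funext i; simp [flip]
  have h1 : ∀ i, ∑ S ∈ Uᶜ.powersetCard i, (1 / 2 ^ i : ℝ) * ∑ T ∈ S.powerset,
      (-1) ^ T.card * ∑ Q, c Q * chi Q (flip x T) =
      ∑ Q, c Q * ((Q \ U).card.choose i : ℝ) * chi Q x := fun i => by
    have h2 : ∀ S ∈ Uᶜ.powersetCard i, (1 / 2 ^ i : ℝ) * ∑ T ∈ S.powerset,
        (-1) ^ T.card * ∑ Q, c Q * chi Q (flip x T) =
        ∑ Q, if S ⊆ Q then c Q * chi Q x else 0 := fun S hS => by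
      have hSi := (mem_powersetCard.mp hS).2
      simp_rw [mul_sum]
      rw [sum_comm]
      refine sum_congr rfl fun Q _ => ?_
      have h3 := sum_powerset_neg_one_pow_mul_chi_flip S Q x
      calc ∑ T ∈ S.powerset, 1 / 2 ^ i * ((-1) ^ T.card * (c Q * chi Q (flip x T))) =
          1 / 2 ^ i * c Q * ∑ T ∈ S.powerset, (-1) ^ T.card * chi Q (flip x T) := by
            rw [mul_sum]
            exact sum_congr rfl fun T _ => by ring
        _ = _ := by
            rw [h3, hSi]
            split_ifs
            · field_simp
            · ring
    rw [sum_congr rfl h2, sum_comm]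
    refine sum_congr rfl fun Q _ => ?_
    rw [← sum_filter, sum_const, card_powersetCard_subset, nsmul_eq_mul, ← sdiff_eq_inter_compl]
    ring
  rw [localLinear, h0]
  simp_rw [h1, mul_sum]
  rw [sum_comm, ← sum_sub_distrib]
  refine sum_congr rfl fun Q _ => ?_
  rw [mul_sub, mul_one, sub_mul, mul_sum, sum_mul]
  congr 1
  exact sum_congr rfl fun i _ => by ring

lemma localLinear_sharpNoise (f : Cube n → ℤˣ) (P : TesterParams) (k : ℕ) (C U : Finset (Fin n))
    (x : Cube n) :
    localLinear P.r P.flat Uᶜ (fun T => sharpNoise f P.κ P.Δ k C (flip x T)) =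
      ∑ S, estMultiplier P k C U S * cubeCoeff f S * chi S x := by
  simp_rw [sharpNoise, ← mul_assoc]
  rw [localLinear_sum_chi]
  exact sum_congr rfl fun S _ => by rw [estMultiplier]; ring

/-- The spectral weight that the noise does not see: `∑ f̂(S)²` over `S ⊆ U` with
`|S \ C| ≥ ℓ`. -/
noncomputable def farWeight (f : Cube n → ℤˣ) (k : ℕ) (C U : Finset (Fin n)) : ℝ :=
  ∑ S ∈ U.powerset.filter fun S => ell k ≤ (S \ C).card, cubeCoeff f S ^ 2

/-- What the parameters have to satisfy for the estimators to have small bias. -/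
structure SmallBias (P : TesterParams) (n k : ℕ) (δ : ℝ) : Prop where
  near : ∀ d, d ≤ ell k → 1 - δ ≤ sharpMultiplier P.κ P.Δ k d
  far : ∀ d j, 1 ≤ j → j ≤ d → d ≤ n →
    |sharpMultiplier P.κ P.Δ k d * (1 - ∑ i ∈ Icc 1 P.r, P.flat i * (j.choose i : ℝ))| ≤ δ

/-- Compare the multiplier with the indicator of `S ⊆ U` and apply Parseval. Inside `U` the
discrepancy is at most `δ`, except on far sets, where it is at most `1` and contributes `farWeight`.
Outside `U` it is at most `δ` by the `far` condition. -/
lemma abs_cubeMean_estimate_sub_le (f : Cube n → ℤˣ) {P : TesterParams} {k : ℕ} {δ : ℝ}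
    (hP : SmallBias P n k δ) (hδ : 0 ≤ δ) {C U : Finset (Fin n)} (hCU : C ⊆ U) :
    |cubeMean (fun x => |∑ S, estMultiplier P k C U S * cubeCoeff f S * chi S x|) -
      cubeMean (fun x => |juntaProj f U x|)| ≤ Real.sqrt (farWeight f k C U + δ ^ 2) := by
  refine (cubeMean_abs_sub_le _ _).trans ?_
  set c : Finset (Fin n) → ℝ := fun S =>
    (estMultiplier P k C U S - if S ∈ U.powerset then 1 else 0) * cubeCoeff f S with hc
  have h1 : ∀ x, ∑ S, estMultiplier P k C U S * cubeCoeff f S * chi S x - juntaProj f U x =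
      ∑ S, c S * chi S x := fun x => by
    simp only [hc, sub_mul, sum_sub_distrib, ite_mul, one_mul, zero_mul, sum_ite_mem, univ_inter,
      juntaProj]
  simp_rw [h1]
  refine (cubeMean_abs_sum_chi_le c).trans (Real.sqrt_le_sqrt ?_)
  have h2 : ∀ S, c S ^ 2 ≤ (if S ∈ U.powerset.filter fun S => ell k ≤ (S \ C).card then
      cubeCoeff f S ^ 2 else 0) + δ ^ 2 * cubeCoeff f S ^ 2 := fun S => by
    simp only [hc, mul_pow]
    by_cases hS : S ⊆ U
    · have e : estMultiplier P k C U S = sharpMultiplier P.κ P.Δ k (S \ C).card := by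
        rw [estMultiplier, sdiff_eq_empty_iff_subset.mpr hS, sum_eq_zero, sub_zero, mul_one]
        intro i hi
        rw [card_empty, Nat.choose_eq_zero_of_lt (mem_Icc.mp hi).1, Nat.cast_zero, mul_zero]
      have hm := sharpMultiplier_mem P.κ P.Δ k (S \ C).card
      rw [if_pos (mem_powerset.mpr hS), e]
      by_cases hl : ell k ≤ (S \ C).card
      · rw [if_pos (by simp [hS, hl])]
        have : (sharpMultiplier P.κ P.Δ k (S \ C).card - 1) ^ 2 ≤ 1 := by nlinarith
        nlinarith [sq_nonneg (cubeCoeff f S), sq_nonneg (δ * cubeCoeff f S)]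
      · rw [if_neg (by simp [hl]), zero_add]
        have := hP.near _ (lt_of_not_ge hl).le
        refine mul_le_mul_of_nonneg_right ?_ (sq_nonneg _)
        rw [sq_le_sq, abs_of_nonneg hδ, abs_le]
        constructor <;> linarith
    · rw [if_neg (by simpa using hS), if_neg (by simp [hS]), sub_zero, zero_add]
      refine mul_le_mul_of_nonneg_right ?_ (sq_nonneg _)
      rw [sq_le_sq, abs_of_nonneg hδ]
      -- Here `C ⊆ U` matters: the local degree `|S \ U|` is then at most the noise degree `|S \
      -- C|`.
      refine hP.far _ _ ?_ (card_le_card (sdiff_subset_sdiff le_rfl hCU))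
        ((card_le_univ _).trans (by simp))
      rw [Nat.one_le_iff_ne_zero, ne_eq, card_eq_zero, sdiff_eq_empty_iff_subset]
      exact hS
  refine (sum_le_sum fun S _ => h2 S).trans ?_
  rw [sum_add_distrib, ← mul_sum, parseval, mul_one, sum_ite_mem, univ_inter, farWeight]

end JuntaTester

/-! ### Expectations and probabilities for `PMF`s -/

/-- The expectation of a nonnegative function. -/
noncomputable def PMF.expect {α : Type*} (p : PMF α) (g : α → ℝ≥0∞) : ℝ≥0∞ := ∑' a, p a * g a

/-- The probability of an event. -/
noncomputable def PMF.prob {α : Type*} (p : PMF α) (s : Set α) : ℝ≥0∞ := p.expect (s.indicator 1)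

/-- The mean of a real function on a finite probability space. -/
noncomputable def PMF.mean {α : Type*} [Fintype α] (p : PMF α) (g : α → ℝ) : ℝ :=
  ∑ a, (p a).toReal * g a

namespace PMF

variable {α β : Type*}

lemma expect_pure (a : α) (g : α → ℝ≥0∞) : (PMF.pure a).expect g = g a := by
  rw [expect, tsum_eq_single a fun b hb => by simp [hb]]
  simp

lemma expect_bind (p : PMF α) (k : α → PMF β) (g : β → ℝ≥0∞) :
    (p.bind k).expect g = p.expect fun a => (k a).expect g := by
  simp_rw [expect, bind_apply, ← ENNReal.tsum_mul_right, ← ENNReal.tsum_mul_left]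
  rw [ENNReal.tsum_comm]
  simp_rw [mul_assoc]

lemma expect_mono (p : PMF α) {g h : α → ℝ≥0∞} (H : ∀ a, g a ≤ h a) : p.expect g ≤ p.expect h :=
  ENNReal.tsum_le_tsum fun a => mul_le_mul_right (H a) _

lemma expect_const (p : PMF α) (c : ℝ≥0∞) : (p.expect fun _ => c) = c := by
  rw [expect, ENNReal.tsum_mul_right, p.tsum_coe, one_mul]

lemma expect_const_mul (p : PMF α) (c : ℝ≥0∞) (g : α → ℝ≥0∞) :
    (p.expect fun a => c * g a) = c * p.expect g := by
  simp_rw [expect, ← ENNReal.tsum_mul_left, mul_left_comm]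

lemma expect_add (p : PMF α) (g h : α → ℝ≥0∞) :
    (p.expect fun a => g a + h a) = p.expect g + p.expect h := by
  simp_rw [expect, mul_add, ENNReal.tsum_add]

lemma expect_le_of_le (p : PMF α) {g : α → ℝ≥0∞} {c : ℝ≥0∞} (H : ∀ a, g a ≤ c) :
    p.expect g ≤ c := (p.expect_mono H).trans (p.expect_const c).le

lemma toOuterMeasure_eq_prob (p : PMF α) (s : Set α) : p.toOuterMeasure s = p.prob s := by
  rw [toOuterMeasure_apply, prob, expect]
  refine tsum_congr fun a => ?_
  by_cases h : a ∈ s <;> simp [h]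

lemma prob_mono (p : PMF α) {s t : Set α} (h : s ⊆ t) : p.prob s ≤ p.prob t :=
  p.expect_mono fun a => Set.indicator_le_indicator_of_subset h (fun _ => zero_le) a

lemma prob_le_one (p : PMF α) (s : Set α) : p.prob s ≤ 1 :=
  p.expect_le_of_le fun a => Set.indicator_le' (fun _ _ => le_rfl) (fun _ _ => zero_le) a

lemma prob_union_le (p : PMF α) (s t : Set α) : p.prob (s ∪ t) ≤ p.prob s + p.prob t := by
  rw [prob, prob, prob, ← expect_add]
  refine p.expect_mono fun a => ?_
  by_cases h : a ∈ s <;> by_cases h' : a ∈ t <;> simp [h, h']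

lemma prob_add_compl (p : PMF α) (s : Set α) : p.prob s + p.prob sᶜ = 1 := by
  rw [prob, prob, ← expect_add]
  refine (congrArg p.expect (funext fun a => ?_)).trans (p.expect_const 1)
  by_cases h : a ∈ s <;> simp [h]

lemma prob_biUnion_le {ι : Type*} (p : PMF α) (J : Finset ι) (s : ι → Set α) :
    p.prob (⋃ i ∈ J, s i) ≤ ∑ i ∈ J, p.prob (s i) := by
  classical
  induction J using Finset.induction_on with
  | empty => simp [prob, expect]
  | insert i J hi ih =>
    rw [sum_insert hi, set_biUnion_insert]
    exact (prob_union_le _ _ _).trans (add_le_add_right ih _)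

lemma prob_biUnion_le_card_mul {ι : Type*} (p : PMF α) (J : Finset ι) (s : ι → Set α) {c : ℝ≥0∞}
    (h : ∀ i ∈ J, p.prob (s i) ≤ c) : p.prob (⋃ i ∈ J, s i) ≤ J.card * c :=
  (p.prob_biUnion_le J s).trans ((sum_le_card_nsmul _ _ _ h).trans (by rw [nsmul_eq_mul]))

lemma prob_bind (p : PMF α) (k : α → PMF β) (s : Set β) :
    (p.bind k).prob s = p.expect fun a => (k a).prob s := expect_bind _ _ _

lemma prob_bind_pure (p : PMF α) (g : α → β) (s : Set β) :
    (p.bind fun a => PMF.pure (g a)).prob s = p.prob (g ⁻¹' s) := by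
  rw [prob_bind, prob]
  congr 1
  funext a
  rw [prob, expect_pure]
  rfl

/-- Restricting a second-stage probability to an event of the first stage. -/
lemma prob_bind_le_add (p : PMF α) (k : α → PMF β) (s : Set β) (t : Set α) {c : ℝ≥0∞}
    (h : ∀ a ∉ t, (k a).prob s ≤ c) : (p.bind k).prob s ≤ p.prob t + c := by
  rw [prob_bind]
  refine (p.expect_mono (h := fun a => t.indicator 1 a + c) fun a => ?_).trans ?_
  · by_cases ha : a ∈ t
    · simpa [ha] using ((k a).prob_le_one s).trans le_self_add
    · simpa [ha] using h a ha
  · rw [expect_add, expect_const, prob]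

/-- Markov's inequality, stated without division. -/
lemma mul_prob_le_expect (p : PMF α) (g : α → ℝ≥0∞) (c : ℝ≥0∞) :
    c * p.prob {a | c ≤ g a} ≤ p.expect g := by
  rw [prob, ← expect_const_mul]
  refine p.expect_mono fun a => ?_
  by_cases h : c ≤ g a <;> simp [h]

lemma apply_eq_prob (p : PMF α) (a : α) : p a = p.prob {a} := by
  rw [prob, expect, tsum_eq_single a fun b hb => by simp [hb]]
  simp

section Fintype

variable [Fintype α]

lemma sum_toReal (p : PMF α) : ∑ a, (p a).toReal = 1 := by
  rw [← ENNReal.toReal_sum fun a _ => p.apply_ne_top a, ← tsum_fintype (L := .unconditional α), p.tsum_coe,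
    ENNReal.toReal_one]

lemma expect_ofReal (p : PMF α) {g : α → ℝ} (hg : ∀ a, 0 ≤ g a) :
    (p.expect fun a => ENNReal.ofReal (g a)) = ENNReal.ofReal (p.mean g) := by
  rw [expect, tsum_fintype, mean, ENNReal.ofReal_sum_of_nonneg fun a _ =>
    mul_nonneg ENNReal.toReal_nonneg (hg a)]
  refine sum_congr rfl fun a _ => ?_
  rw [ENNReal.ofReal_mul ENNReal.toReal_nonneg, ENNReal.ofReal_toReal (p.apply_ne_top a)]

lemma prob_eq_ofReal_sum (p : PMF α) (s : Finset α) :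
    p.prob {a | a ∈ s} = ENNReal.ofReal (∑ a ∈ s, (p a).toReal) := by
  classical
  have h := p.expect_ofReal (g := fun a => if a ∈ s then 1 else 0)
    fun a => by split_ifs <;> norm_num
  rw [mean] at h
  simp only [mul_ite, mul_one, mul_zero, sum_ite_mem, univ_inter] at h
  rw [← h, prob]
  congr 1
  funext a
  by_cases ha : a ∈ s <;> simp [ha]

lemma mean_sub (p : PMF α) (g h : α → ℝ) :
    (p.mean fun a => g a - h a) = p.mean g - p.mean h := by
  simp [mean, mul_sub, sum_sub_distrib]

lemma mean_const (p : PMF α) (c : ℝ) : (p.mean fun _ => c) = c := by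
  rw [mean, ← sum_mul, sum_toReal, one_mul]

lemma mean_neg (p : PMF α) (g : α → ℝ) : (p.mean fun a => -g a) = -p.mean g := by
  simp [mean, sum_neg_distrib]

/-- Hoeffding's bound for the moment generating function. -/
lemma expect_exp_le (p : PMF α) {X : α → ℝ} {B : ℝ} (hB : 0 < B) (hX : ∀ a, |X a| ≤ B)
    (h0 : p.mean X = 0) (θ : ℝ) :
    (p.expect fun a => ENNReal.ofReal (Real.exp (θ * X a))) ≤
      ENNReal.ofReal (Real.exp (θ ^ 2 * B ^ 2 / 2)) := by
  rw [expect_ofReal p fun a => (Real.exp_pos _).le]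
  refine ENNReal.ofReal_le_ofReal ?_
  -- By convexity, `exp` lies below its chord on `[-θB, θB]`. The term linear in `X` then disappears
  -- in the mean.
  have h1 : ∀ a, Real.exp (θ * X a) ≤ Real.cosh (θ * B) + X a / B * Real.sinh (θ * B) := fun a => by
    obtain ⟨h2, h3⟩ := abs_le.mp (hX a)
    have hl : -1 ≤ X a / B := by rw [le_div_iff₀ hB]; linarith
    have hu : X a / B ≤ 1 := by rw [div_le_iff₀ hB]; linarith
    have := convexOn_exp.2 (Set.mem_univ (θ * B)) (Set.mem_univ (-(θ * B)))
      (show 0 ≤ (1 + X a / B) / 2 by linarith) (show 0 ≤ (1 - X a / B) / 2 by linarith) (by ring)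
    simp only [smul_eq_mul] at this
    rw [Real.cosh_eq, Real.sinh_eq]
    calc Real.exp (θ * X a) =
        Real.exp ((1 + X a / B) / 2 * (θ * B) + (1 - X a / B) / 2 * -(θ * B)) := by
          congr 1; field_simp; ring
      _ ≤ _ := this
      _ = _ := by ring
  calc p.mean (fun a => Real.exp (θ * X a)) ≤
      ∑ a, (p a).toReal * (Real.cosh (θ * B) + X a / B * Real.sinh (θ * B)) :=
        sum_le_sum fun a _ => mul_le_mul_of_nonneg_left (h1 a) ENNReal.toReal_nonneg
    _ = Real.cosh (θ * B) + p.mean X / B * Real.sinh (θ * B) := by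
        simp_rw [mul_add, sum_add_distrib, ← sum_mul, sum_toReal, mean, one_mul, sum_div, sum_mul]
        congr 1
        exact sum_congr rfl fun a _ => by ring
    _ = Real.cosh (θ * B) := by rw [h0]; ring
    _ ≤ _ := by
        refine (Real.cosh_le_exp_half_sq _).trans (le_of_eq ?_)
        congr 1; ring

end Fintype

end PMF

/-! ### The output distribution of composed algorithms -/

namespace SampleAlg

variable {n : ℕ} {α β : Type} (f : Cube n → ℤˣ)

lemma law_bind' (a : SampleAlg n α) (k : α → SampleAlg n β) :
    (a.bind k).law f = (a.law f).bind fun b => (k b).law f := by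
  induction a with
  | ret a => simp [bind, law]
  | toss p next ih => simp [bind, law, ih, PMF.bind_bind]
  | query x next ih => simp [bind, law, ih]
  | draw next ih => simp [bind, law, ih, PMF.bind_bind]

lemma law_bind (a : SampleAlg n α) (k : α → SampleAlg n β) :
    (a >>= k).law f = (a.law f).bind fun b => (k b).law f := law_bind' f a k

lemma law_seqFin_succ {m : ℕ} (a : Fin (m + 1) → SampleAlg n α) :
    (seqFin a).law f = ((a 0).law f).bind fun b =>
      ((seqFin fun i => a i.succ).law f).bind fun bs => PMF.pure (Fin.cons b bs) := by
  rw [seqFin, law_bind]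
  congr 1
  funext b
  rw [law_bind]
  rfl

/-- Independence of the runs, in the form that yields both joint probabilities and exponential
moments. -/
lemma expect_seqFin_prod {m : ℕ} (a : Fin m → SampleAlg n α) (g : Fin m → α → ℝ≥0∞) :
    ((seqFin a).law f).expect (fun v => ∏ i, g i (v i)) = ∏ i, ((a i).law f).expect (g i) := by
  induction m with
  | zero => simp [seqFin, law, PMF.expect_pure]
  | succ m ih =>
    rw [law_seqFin_succ, PMF.expect_bind, Fin.prod_univ_succ, ← ih fun i => a i.succ, mul_comm,
      ← PMF.expect_const_mul]
    congr 1
    funext b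
    rw [PMF.expect_bind, mul_comm, ← PMF.expect_const_mul]
    congr 1
    funext bs
    rw [PMF.expect_pure, Fin.prod_univ_succ]
    simp

variable {ι : Type} [Fintype ι]

lemma law_seqAll (a : ι → SampleAlg n α) :
    (seqAll a).law f = ((seqFin fun j => a ((Fintype.equivFin ι).symm j)).law f).bind fun bs =>
      PMF.pure fun i => bs (Fintype.equivFin ι i) := by
  rw [seqAll, law_bind]
  rfl

lemma expect_seqAll_prod (a : ι → SampleAlg n α) (g : ι → α → ℝ≥0∞) :
    ((seqAll a).law f).expect (fun v => ∏ i, g i (v i)) = ∏ i, ((a i).law f).expect (g i) := by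
  rw [law_seqAll, PMF.expect_bind]
  simp_rw [PMF.expect_pure]
  rw [← (Fintype.equivFin ι).symm.prod_comp, ← expect_seqFin_prod]
  congr 1
  funext v
  rw [← (Fintype.equivFin ι).symm.prod_comp]
  simp

lemma prob_seqAll_forall (a : ι → SampleAlg n α) (s : ι → Set α) :
    ((seqAll a).law f).prob {v | ∀ i, v i ∈ s i} = ∏ i, ((a i).law f).prob (s i) := by
  classical
  simp_rw [PMF.prob]
  rw [← expect_seqAll_prod]
  congr 1
  funext v
  simp only [Set.indicator_apply, Pi.one_apply, Set.mem_ofPred_eq]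
  rw [prod_ite_zero]
  simp

lemma prob_seqAll_apply (a : ι → SampleAlg n α) (i : ι) (s : Set α) :
    ((seqAll a).law f).prob {v | v i ∈ s} = ((a i).law f).prob s := by
  classical
  have h := prob_seqAll_forall f a fun j => if j = i then s else Set.univ
  have e : {v : ι → α | ∀ j, v j ∈ if j = i then s else Set.univ} = {v | v i ∈ s} := by
    ext v
    refine ⟨fun H => by simpa using H i, fun H j => ?_⟩
    by_cases hj : j = i
    · subst hj; simpa using H
    · simp [hj]
  rw [e] at h
  rw [h, prod_eq_single i fun j _ hj => ?_]
  · simp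
  · simp
  · rw [if_neg hj, PMF.prob, Set.indicator_univ]
    exact PMF.expect_const _ 1

lemma prob_seqAll_exists_le (a : ι → SampleAlg n α) (s : ι → Set α) {c : ℝ≥0∞}
    (h : ∀ i, ((a i).law f).prob (s i) ≤ c) :
    ((seqAll a).law f).prob {v | ∃ i, v i ∈ s i} ≤ Fintype.card ι * c := by
  have e : {v : ι → α | ∃ i, v i ∈ s i} = ⋃ i ∈ (univ : Finset ι), {v | v i ∈ s i} := by
    ext v; simp
  rw [e]
  exact PMF.prob_biUnion_le_card_mul _ _ _ fun i _ => (prob_seqAll_apply f a i (s i)).trans_le (h i)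

lemma law_seqAll_apply (a : ι → SampleAlg n α) (z : ι → α) :
    (seqAll a).law f z = ∏ i, (a i).law f (z i) := by
  simp_rw [PMF.apply_eq_prob]
  rw [← prob_seqAll_forall]
  congr 1
  ext v
  simp [funext_iff]

/-- Exponential Markov inequality for a partial sum of independent outputs. -/
lemma prob_seqAll_sum_ge_le_exp (a : ι → SampleAlg n α) (J : Finset ι) (X : ι → α → ℝ) (v τ : ℝ)
    (hX : ∀ i ∈ J, ((a i).law f).expect (fun x => ENNReal.ofReal (Real.exp (X i x))) ≤
      ENNReal.ofReal (Real.exp v)) :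
    ((seqAll a).law f).prob {x | τ ≤ ∑ i ∈ J, X i (x i)} ≤
      ENNReal.ofReal (Real.exp (J.card * v - τ)) := by
  classical
  -- Coordinates outside `J` receive the factor `1`, so only the partial sum is exponentiated.
  have h1 := expect_seqAll_prod f a fun i x =>
    if i ∈ J then ENNReal.ofReal (Real.exp (X i x)) else 1
  have h2 : ∀ x : ι → α, ∏ i, (if i ∈ J then ENNReal.ofReal (Real.exp (X i (x i))) else 1) =
      ENNReal.ofReal (Real.exp (∑ i ∈ J, X i (x i))) := fun x => by
    rw [prod_ite_mem, univ_inter, Real.exp_sum,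
      ENNReal.ofReal_prod_of_nonneg fun i _ => (Real.exp_pos _).le]
  simp_rw [h2] at h1
  have h3 : ∏ i, ((a i).law f).expect
      (fun x => if i ∈ J then ENNReal.ofReal (Real.exp (X i x)) else 1) ≤
      ENNReal.ofReal (Real.exp (J.card * v)) := by
    calc _ ≤ ∏ i, if i ∈ J then ENNReal.ofReal (Real.exp v) else 1 := by
          refine prod_le_prod' fun i _ => ?_
          split_ifs with hi
          · exact hX i hi
          · exact (PMF.expect_const _ 1).le
      _ = _ := by
          rw [prod_ite_mem, univ_inter, prod_const, ← ENNReal.ofReal_pow (Real.exp_pos _).le,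
            ← Real.exp_nat_mul]
  have h4 : {x : ι → α | τ ≤ ∑ i ∈ J, X i (x i)} ⊆ {x | ENNReal.ofReal (Real.exp τ) ≤
      ENNReal.ofReal (Real.exp (∑ i ∈ J, X i (x i)))} := fun x hx =>
    ENNReal.ofReal_le_ofReal (Real.exp_le_exp.mpr hx)
  have h5 := (mul_le_mul_right (PMF.prob_mono ((seqAll a).law f) h4) _).trans
    ((PMF.mul_prob_le_expect _ _ (ENNReal.ofReal (Real.exp τ))).trans (h1.trans_le h3))
  have hpos : ENNReal.ofReal (Real.exp τ) ≠ 0 := by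
    rw [ne_eq, ENNReal.ofReal_eq_zero, not_le]; exact Real.exp_pos _
  rw [Real.exp_sub, ENNReal.ofReal_div_of_pos (Real.exp_pos _),
    ENNReal.le_div_iff_mul_le (Or.inl hpos) (Or.inl ENNReal.ofReal_ne_top), mul_comm]
  exact h5

/-- Hoeffding's inequality for a partial sum of independent outputs. -/
lemma hoeffding [Fintype α] (a : ι → SampleAlg n α) (J : Finset ι) (X : ι → α → ℝ) {B τ : ℝ}
    (hB : 0 < B) (hJ : 0 < J.card) (hτ : 0 < τ) (hX : ∀ i ∈ J, ∀ x, |X i x| ≤ B)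
    (h0 : ∀ i ∈ J, ((a i).law f).mean (X i) = 0) :
    ((seqAll a).law f).prob {x | τ ≤ ∑ i ∈ J, X i (x i)} ≤
      ENNReal.ofReal (Real.exp (-(τ ^ 2 / (2 * J.card * B ^ 2)))) := by
  have hJ' : (0 : ℝ) < J.card := by exact_mod_cast hJ
  -- The minimiser of the exponent `|J| θ² B² / 2 - θ τ`.
  set θ := τ / (J.card * B ^ 2) with hθ
  have h := prob_seqAll_sum_ge_le_exp f a J (fun i x => θ * X i x) (θ ^ 2 * B ^ 2 / 2) (θ * τ)
    fun i hi => PMF.expect_exp_le _ hB (hX i hi) (h0 i hi) θ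
  have hθpos : 0 < θ := by positivity
  simp_rw [← mul_sum, mul_le_mul_iff_right₀ hθpos] at h
  refine h.trans (le_of_eq ?_)
  congr 2
  rw [hθ]
  field_simp
  ring

/-- Two-sided Hoeffding inequality for an average of independent outputs. -/
lemma hoeffding_abs [Fintype α] (a : ι → SampleAlg n α) (J : Finset ι) (X : ι → α → ℝ) {B η : ℝ}
    (hB : 0 < B) (hJ : 0 < J.card) (hη : 0 < η) (hX : ∀ i ∈ J, ∀ x, |X i x| ≤ B)
    (h0 : ∀ i ∈ J, ((a i).law f).mean (X i) = 0) :
    ((seqAll a).law f).prob {x | J.card * η ≤ |∑ i ∈ J, X i (x i)|} ≤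
      2 * ENNReal.ofReal (Real.exp (-(J.card * η ^ 2 / (2 * B ^ 2)))) := by
  have hJ' : (0 : ℝ) < J.card := by exact_mod_cast hJ
  have e : ((J.card : ℝ) * η) ^ 2 / (2 * J.card * B ^ 2) = J.card * η ^ 2 / (2 * B ^ 2) := by
    field_simp
  have h1 := hoeffding f a J X (τ := J.card * η) hB hJ (by positivity) hX h0
  have h2 := hoeffding f a J (fun i x => -X i x) (τ := J.card * η) hB hJ (by positivity)
    (fun i hi x => by rw [abs_neg]; exact hX i hi x)
    (fun i hi => by rw [PMF.mean_neg, h0 i hi, neg_zero])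
  rw [e] at h1 h2
  rw [two_mul]
  refine le_trans ?_ (add_le_add h1 h2)
  refine (PMF.prob_mono _ fun x hx => ?_).trans (PMF.prob_union_le _ _ _)
  simp only [Set.mem_ofPred_eq, Set.mem_union, sum_neg_distrib] at hx ⊢
  exact le_abs.mp hx

/-! ### Costs -/

lemma cost_bind_le (a : SampleAlg n α) (k : α → SampleAlg n β) {c : ℕ∞}
    (h : ∀ b, (k b).cost ≤ c) : (a >>= k).cost ≤ a.cost + c := by
  change (a.bind k).cost ≤ _
  induction a with
  | ret a => simpa [bind, cost] using h a
  | toss p next ih =>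
    rw [bind, cost, cost]
    exact iSup_le fun b => (ih b).trans (add_le_add_left (le_iSup (fun b => (next b).cost) b) _)
  | query x next ih =>
    rw [bind, cost, cost, add_assoc]
    exact add_le_add_right (iSup_le fun b =>
      (ih b).trans (add_le_add_left (le_iSup (fun b => (next b).cost) b) _)) _
  | draw next ih =>
    rw [bind, cost, cost, add_assoc]
    exact add_le_add_right (iSup_le fun b =>
      (ih b).trans (add_le_add_left (le_iSup (fun b => (next b).cost) b) _)) _

lemma cost_seqFin_le {m : ℕ} (a : Fin m → SampleAlg n α) {c : ℕ∞} (h : ∀ i, (a i).cost ≤ c) :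
    (seqFin a).cost ≤ m * c := by
  induction m with
  | zero => simp [seqFin, cost]
  | succ m ih =>
    rw [seqFin]
    refine (cost_bind_le _ _ (c := m * c) fun b => ?_).trans ?_
    · refine (cost_bind_le _ _ (c := 0) fun bs => le_rfl).trans ?_
      rw [add_zero]
      exact ih _ fun i => h _
    · push_cast
      rw [add_mul, one_mul, add_comm]
      exact add_le_add_right (h 0) _

lemma cost_seqAll_le (a : ι → SampleAlg n α) {c : ℕ∞} (h : ∀ i, (a i).cost ≤ c) :
    (seqAll a).cost ≤ Fintype.card ι * c := by
  rw [seqAll]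
  refine (cost_bind_le _ _ (c := 0) fun bs => le_rfl).trans ?_
  rw [add_zero]
  exact cost_seqFin_le _ fun j => h _

end SampleAlg

/-! ### The quantum implementation -/

section Quantum

variable {n : ℕ} (f : Cube n → ℤˣ)

lemma oracleGate_app_apply (ψ : QState n) (z : Cube n × ℤˣ) :
    ((oracleGate f).app ψ).1 z = ψ.1 (z.1, z.2 * f z.1) := by
  change (LinearIsometryEquiv.piLpCongrLeft 2 ℂ ℂ (oraclePerm f) ψ.1) z = _
  rw [LinearIsometryEquiv.piLpCongrLeft_apply]
  rfl

lemma oracleGate_app_basisState (z : Cube n × ℤˣ) :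
    (oracleGate f).app (basisState z) = basisState (z.1, z.2 * f z.1) := by
  refine Subtype.ext ?_
  change LinearIsometryEquiv.piLpCongrLeft 2 ℂ ℂ (oraclePerm f) (EuclideanSpace.single z 1) = _
  rw [EuclideanSpace.piLpCongrLeft_single]
  rfl

lemma born_basisState (z : Cube n × ℤˣ) : born (basisState z) = PMF.pure z := by
  ext y
  by_cases h : y = z
  · subst h
    simp [born, basisState]
  · simp [born, basisState, h]

lemma hadamardGate_app_apply (ψ : QState n) (z : Cube n × ℤˣ) :
    ((hadamardGate n).app ψ).1 z =
      ∑ x : Cube n, ((chi (negSet z.1) x / Real.sqrt (2 ^ n) : ℝ) : ℂ) * ψ.1 (x, z.2) := by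
  change (Matrix.toEuclideanCLM (n := Cube n × ℤˣ) (𝕜 := ℂ) (hadamardMatrix n) ψ.1) z = _
  rw [Matrix.ofLp_toEuclideanCLM, Matrix.mulVec, dotProduct, Fintype.sum_prod_type]
  refine sum_congr rfl fun x _ => ?_
  simp only [hadamardMatrix, Matrix.of_apply, ite_mul, zero_mul]
  rw [sum_ite_eq, if_pos (mem_univ _)]

/-- The answer qubit turns the oracle into the phase `f(x)`, and the Hadamard transform collects
these phases into the amplitude `± f̂ / √2`. Each of the two values of the answer qubit carries half
of the probability. -/
lemma born_draw_apply (z : Cube n × ℤˣ) :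
    born ((hadamardGate n).app ((oracleGate f).app (uniformMinus n))) z =
      ENNReal.ofReal (cubeCoeff f (negSet z.1) ^ 2 / 2) := by
  rw [born, PMF.ofFintype_apply, hadamardGate_app_apply]
  simp_rw [oracleGate_app_apply]
  have h : ∑ x : Cube n, ((chi (negSet z.1) x / Real.sqrt (2 ^ n) : ℝ) : ℂ) *
      (uniformMinus n).1 (x, z.2 * f x) =
      ((sgn z.2 * (2 ^ n * cubeCoeff f (negSet z.1)) /
        (Real.sqrt (2 ^ n) * Real.sqrt (2 ^ (n + 1))) : ℝ) : ℂ) := by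
    have h1 : ∀ x : Cube n, ((chi (negSet z.1) x / Real.sqrt (2 ^ n) : ℝ) : ℂ) *
        (uniformMinus n).1 (x, z.2 * f x) =
        ((chi (negSet z.1) x / Real.sqrt (2 ^ n) *
          (sgn (z.2 * f x) / Real.sqrt (2 ^ (n + 1))) : ℝ) : ℂ) := fun x => by
      rw [Complex.ofReal_mul]
      rfl
    simp_rw [h1]
    rw [← Complex.ofReal_sum]
    congr 1
    have h2 : (2 : ℝ) ^ n * cubeCoeff f (negSet z.1) = ∑ x, sgn (f x) * chi (negSet z.1) x := by
      rw [cubeCoeff, ← mul_assoc, mul_one_div_cancel (by positivity), one_mul]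
    rw [h2, mul_sum, sum_div]
    refine sum_congr rfl fun x _ => ?_
    rw [sgn_mul]
    ring
  rw [h, Complex.norm_real, Real.norm_eq_abs, sq_abs, div_pow, mul_pow, mul_pow, mul_pow,
    Real.sq_sqrt (by positivity), Real.sq_sqrt (by positivity), sq (sgn z.2), sgn_mul_self]
  congr 1
  field_simp
  ring

/-- Forgetting the answer qubit adds the two halves, and `negSet` is a bijection from outcomes to
subsets. -/
lemma born_draw_bind {β : Type} (k : Finset (Fin n) → PMF β) :
    (born ((hadamardGate n).app ((oracleGate f).app (uniformMinus n)))).bind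
      (fun z => k (negSet z.1)) = (spectralSample f).bind k := by
  ext b
  rw [PMF.bind_apply, PMF.bind_apply, tsum_fintype, tsum_fintype, Fintype.sum_prod_type,
    ← negSet_bijective.sum_comp]
  refine sum_congr rfl fun x _ => ?_
  simp_rw [born_draw_apply]
  rw [sum_const, card_univ, Fintype.card_units_int, nsmul_eq_mul, spectralSample,
    PMF.ofFintype_apply, ← mul_assoc]
  congr 1
  rw [← ENNReal.ofReal_natCast, ← ENNReal.ofReal_mul (Nat.cast_nonneg _)]
  congr 1
  push_cast
  ring

/-- The start state is arbitrary because every simulated oracle call prepares the register afresh;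
this lets the induction ignore the state left by a measurement. -/
lemma SampleAlg.lawFrom_toQuantum {α : Type} (a : SampleAlg n α) (ψ : QState n) :
    a.toQuantum.lawFrom f ψ = a.law f := by
  induction a generalizing ψ with
  | ret a => rfl
  | toss p next ih => simp only [toQuantum, QueryAlg.lawFrom, law, ih]
  | query x next ih =>
    simp only [toQuantum, QueryAlg.lawFrom, law, ih, oracleGate_app_basisState, born_basisState,
      PMF.pure_bind, one_mul]
  | draw next ih =>
    simp only [toQuantum, QueryAlg.lawFrom, law, ih]
    exact born_draw_bind f fun S => (next S).law f

/-- The quantum implementation has the same output distribution. -/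
lemma SampleAlg.law_toQuantum {α : Type} (a : SampleAlg n α) : a.toQuantum.law f = a.law f :=
  a.lawFrom_toQuantum f _

/-- The quantum implementation makes at most one quantum query per oracle call. -/
lemma SampleAlg.queries_toQuantum_le {α : Type} (a : SampleAlg n α) :
    a.toQuantum.queries ≤ a.cost := by
  induction a with
  | ret a => exact le_rfl
  | toss p next ih => exact iSup_mono ih
  | query x next ih =>
    exact add_le_add_right (iSup_le fun z : Cube n × ℤˣ =>
      (ih z.2).trans (le_iSup (fun b => (next b).cost) _)) _
  | draw next ih =>
    exact add_le_add_right (iSup_le fun z : Cube n × ℤˣ => (ih _).trans (le_iSup (fun b => (next b).cost) _)) _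

end Quantum

/-! ### Sample bundles -/

namespace JuntaTester

variable {n : ℕ} (f : Cube n → ℤˣ)

lemma noisyBit_toReal (ρ : I) (b c : ℤˣ) : (noisyBit ρ b c).toReal =
    (ρ : ℝ) * (if c = b then 1 else 0) + (1 - (ρ : ℝ)) * (1 / 2) := by
  have h0 := ρ.2.1
  have h1 := ρ.2.2
  rw [noisyBit, PMF.ofFintype_apply, ENNReal.toReal_ofReal]
  split_ifs <;> linarith

lemma mean_noisyBit_sgn (ρ : I) (b : ℤˣ) : (noisyBit ρ b).mean sgn = ρ * sgn b := by
  rw [PMF.mean, sum_units, noisyBit_toReal, noisyBit_toReal]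
  rcases Int.units_eq_one_or b with h | h <;> subst h
  · rw [if_pos rfl, if_neg (by decide), sgn_one, sgn_neg_one]; ring
  · rw [if_neg (by decide), if_pos rfl, sgn_one, sgn_neg_one]; ring

lemma mean_pure {α : Type*} [Fintype α] (a : α) (g : α → ℝ) : (PMF.pure a).mean g = g a := by
  classical
  simp [PMF.mean, PMF.pure_apply, apply_ite]

lemma law_noisyBit_alg (ρ : I) (b : ℤˣ) :
    (SampleAlg.toss (noisyBit ρ b) SampleAlg.ret : SampleAlg n ℤˣ).law f = noisyBit ρ b := by
  simp only [SampleAlg.law]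
  exact PMF.bind_pure _

/-- By independence the mean is a product over coordinates; those of `S` outside `C` contribute the
additional factor `ρ`. -/
lemma mean_noisyPoint_chi (ρ : I) (C S : Finset (Fin n)) (y : Cube n) :
    ((noisyPoint ρ Cᶜ y).law f).mean (chi S) = (ρ : ℝ) ^ (S \ C).card * chi S y := by
  rw [PMF.mean]
  simp_rw [noisyPoint, SampleAlg.law_seqAll_apply, chi_eq, ENNReal.toReal_prod, ← prod_mul_distrib]
  rw [← Fintype.prod_sum fun (i : Fin n) (b : ℤˣ) =>
    (((if i ∈ Cᶜ then SampleAlg.toss (noisyBit ρ (y i)) SampleAlg.ret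
      else SampleAlg.ret (y i) : SampleAlg n ℤˣ).law f) b).toReal * if i ∈ S then sgn b else 1]
  have h : ∀ i, ∑ b, (((if i ∈ Cᶜ then SampleAlg.toss (noisyBit ρ (y i)) SampleAlg.ret
      else SampleAlg.ret (y i) : SampleAlg n ℤˣ).law f) b).toReal *
        (if i ∈ S then sgn b else 1) =
      (if i ∈ S \ C then (ρ : ℝ) else 1) * if i ∈ S then sgn (y i) else 1 := fun i => by
    by_cases hS : i ∈ S
    · by_cases hC : i ∈ C
      · simp only [mem_compl, hC, hS, mem_sdiff, not_true, if_true, if_false, and_false, one_mul]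
        exact mean_pure _ _
      · simp only [mem_compl, hC, hS, mem_sdiff, not_false_eq_true, if_true, and_true]
        rw [law_noisyBit_alg]
        exact mean_noisyBit_sgn _ _
    · simp only [hS, mem_sdiff, false_and, if_false, mul_one]
      exact PMF.sum_toReal _
  rw [prod_congr rfl fun i _ => h i, prod_mul_distrib]
  congr 1
  rw [prod_ite_mem, univ_inter, prod_const]

lemma law_query_noisyPoint (ρ : I) (V : Finset (Fin n)) (y : Cube n) :
    ((noisyPoint ρ V y >>= fun z => SampleAlg.query z SampleAlg.ret : SampleAlg n ℤˣ)).law f =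
      ((noisyPoint ρ V y).law f).bind fun z => PMF.pure (f z) := by
  rw [SampleAlg.law_bind]
  rfl

lemma mean_bind_pure {α β : Type*} [Fintype α] [Fintype β] (p : PMF α) (h : α → β) (g : β → ℝ) :
    (p.bind fun a => PMF.pure (h a)).mean g = p.mean fun a => g (h a) := by
  classical
  simp_rw [PMF.mean, PMF.bind_apply, tsum_fintype]
  have h1 : ∀ b, (∑ a, p a * PMF.pure (h a) b).toReal =
      ∑ a, (p a).toReal * if b = h a then 1 else 0 := fun b => by
    rw [ENNReal.toReal_sum fun a _ => ENNReal.mul_ne_top (p.apply_ne_top a) (PMF.apply_ne_top _ _)]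
    refine sum_congr rfl fun a _ => ?_
    rw [ENNReal.toReal_mul, PMF.pure_apply]
    split_ifs <;> simp
  simp_rw [h1, sum_mul]
  rw [sum_comm]
  refine sum_congr rfl fun a _ => ?_
  simp

lemma mean_query_noisyPoint (ρ : I) (C : Finset (Fin n)) (y : Cube n) :
    ((noisyPoint ρ Cᶜ y >>= fun z => SampleAlg.query z SampleAlg.ret : SampleAlg n ℤˣ).law f).mean
      sgn = noisyMean f C ρ y := by
  rw [law_query_noisyPoint, mean_bind_pure, noisyMean]
  simp_rw [sgn_eq_sum_coeff_mul_chi, PMF.mean, mul_sum]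
  rw [sum_comm]
  refine sum_congr rfl fun S _ => ?_
  rw [← mean_noisyPoint_chi f, PMF.mean, mul_sum]
  exact sum_congr rfl fun z _ => by ring

end JuntaTester

/-! ### Accuracy of the estimates -/

namespace JuntaTester

variable {n : ℕ} (f : Cube n → ℤˣ)

lemma law_uniform_alg :
    (SampleAlg.toss (PMF.uniformOfFintype (Cube n)) SampleAlg.ret : SampleAlg n (Cube n)).law f =
      PMF.uniformOfFintype (Cube n) := by
  simp only [SampleAlg.law]
  exact PMF.bind_pure _

lemma mean_uniformOfFintype (g : Cube n → ℝ) :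
    (PMF.uniformOfFintype (Cube n)).mean g = cubeMean g := by
  rw [PMF.mean, cubeMean, mul_sum]
  refine sum_congr rfl fun x _ => ?_
  rw [PMF.uniformOfFintype_apply, ENNReal.toReal_inv, ENNReal.toReal_natCast, card_cube, one_div]

/-- The average of the answers to the queries at the copies of a noisy point. -/
noncomputable def copiesAverage (P : TesterParams) (v : BundleIndex n P → ℤˣ)
    (T : {T : Finset (Fin n) // T.card ≤ P.r}) (j : Fin (P.κ * P.Δ + 1)) : ℝ :=
  (∑ t : Fin P.copies, sgn (v (T, j, t))) / P.copies

/-- Invisible in the Fourier definition, but the noisy value is the mean of a sign. -/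
lemma abs_noisyMean_le (C : Finset (Fin n)) (ρ : I) (y : Cube n) : |noisyMean f C ρ y| ≤ 1 := by
  rw [← mean_query_noisyPoint, PMF.mean]
  refine (abs_sum_le_sum_abs _ _).trans (le_of_eq ?_)
  simp_rw [abs_mul, abs_sgn, mul_one, abs_of_nonneg ENNReal.toReal_nonneg]
  exact PMF.sum_toReal _

lemma prob_copiesAverage_le (P : TesterParams) (k : ℕ) (C : Finset (Fin n)) (x : Cube n)
    {η : ℝ} (hη : 0 < η) (hP : 0 < P.copies)
    (T : {T : Finset (Fin n) // T.card ≤ P.r}) (j : Fin (P.κ * P.Δ + 1)) :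
    ((queryBundle P k C x).law f).prob
      {v | η ≤ |copiesAverage P v T j - noisyMean f C ((rho k : ℝ) ^ (j : ℕ)) (flip x T.1)|} ≤
      2 * ENNReal.ofReal (Real.exp (-(P.copies * η ^ 2 / 8))) := by
  have hinj : Function.Injective fun t : Fin P.copies => ((T, j, t) : BundleIndex n P) :=
    fun t t' h => (Prod.mk.inj (Prod.mk.inj h).2).2
  -- A bundle contains all `T` and `j`; the copies for one pair form a subfamily, which is why
  -- Hoeffding's inequality is needed for partial sums.
  set J : Finset (BundleIndex n P) := univ.map ⟨_, hinj⟩ with hJ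
  have hJc : J.card = P.copies := by simp [hJ]
  have hP' : (0 : ℝ) < P.copies := by exact_mod_cast hP
  set X : BundleIndex n P → ℤˣ → ℝ := fun b c =>
    sgn c - noisyMean f C ((rho k ^ (b.2.1 : ℕ) : I) : ℝ) (flip x b.1.1) with hX
  -- A sign minus its mean is at most `2` in absolute value, and `2 * 2 ^ 2` is the `8` in the
  -- exponent.
  have h := SampleAlg.hoeffding_abs f (fun b : BundleIndex n P =>
    noisyPoint (rho k ^ (b.2.1 : ℕ)) Cᶜ (flip x b.1.1) >>= fun z =>
      SampleAlg.query z SampleAlg.ret) J X (B := 2) (η := η) (by norm_num) (by omega) hη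
    (fun b _ c => by
      refine (abs_sub _ _).trans ?_
      have := abs_noisyMean_le f C (rho k ^ (b.2.1 : ℕ)) (flip x b.1.1)
      rw [abs_sgn]
      linarith)
    (fun b _ => by rw [hX, PMF.mean_sub, PMF.mean_const, mean_query_noisyPoint, sub_self])
  rw [hJc, show (2 : ℝ) * 2 ^ 2 = 8 by norm_num] at h
  refine le_trans (PMF.prob_mono _ fun v hv => ?_) h
  simp only [Set.mem_ofPred_eq, hJ, sum_map, Function.Embedding.coeFn_mk, hX, sum_sub_distrib,
    sum_const, card_univ, Fintype.card_fin, nsmul_eq_mul, Set.Icc.coe_pow] at hv ⊢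
  have e : ∑ t : Fin P.copies, sgn (v (T, j, t)) -
      P.copies * noisyMean f C ((rho k : ℝ) ^ (j : ℕ)) (flip x T.1) = P.copies *
      (copiesAverage P v T j - noisyMean f C ((rho k : ℝ) ^ (j : ℕ)) (flip x T.1)) := by
    rw [copiesAverage]
    field_simp
  rw [e, abs_mul, Nat.abs_cast]
  exact mul_le_mul_of_nonneg_left hv hP'.le

/-- The sum of the absolute values of the coefficients of the sharp noise operator. -/
noncomputable def coeffNorm (P : TesterParams) : ℝ :=
  ∑ j : Fin (P.κ * P.Δ + 1), |sharpNoiseCoeff P.κ P.Δ j|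

lemma coeffNorm_nonneg (P : TesterParams) : 0 ≤ coeffNorm P := sum_nonneg fun _ _ => abs_nonneg _

/-- All averages of a sample bundle for `x` are close to their means. -/
def GoodBundle (P : TesterParams) (k : ℕ) (C : Finset (Fin n)) (x : Cube n) (η : ℝ)
    (v : BundleIndex n P → ℤˣ) : Prop :=
  ∀ T j, |copiesAverage P v T j - noisyMean f C ((rho k : ℝ) ^ (j : ℕ)) (flip x T.1)| < η

lemma prob_not_goodBundle_le (P : TesterParams) (k : ℕ) (C : Finset (Fin n)) (x : Cube n)
    {η : ℝ} (hη : 0 < η) (hP : 0 < P.copies) :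
    ((queryBundle P k C x).law f).prob {v | ¬ GoodBundle f P k C x η v} ≤
      (Fintype.card {T : Finset (Fin n) // T.card ≤ P.r} * (P.κ * P.Δ + 1) : ℕ) *
        (2 * ENNReal.ofReal (Real.exp (-(P.copies * η ^ 2 / 8)))) := by
  have h := PMF.prob_biUnion_le_card_mul ((queryBundle P k C x).law f)
    (univ : Finset ({T : Finset (Fin n) // T.card ≤ P.r} × Fin (P.κ * P.Δ + 1)))
    (fun q => {v | η ≤ |copiesAverage P v q.1 q.2 -
      noisyMean f C ((rho k : ℝ) ^ (q.2 : ℕ)) (flip x q.1.1)|})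
    fun q _ => prob_copiesAverage_le f P k C x hη hP q.1 q.2
  rw [card_univ, Fintype.card_prod, Fintype.card_fin] at h
  refine (PMF.prob_mono _ fun v hv => ?_).trans h
  simp only [GoodBundle, not_forall, not_lt, Set.mem_ofPred_eq] at hv
  obtain ⟨T, j, hTj⟩ := hv
  simp only [Set.mem_iUnion]
  exact ⟨(T, j), mem_univ _, hTj⟩

lemma GoodBundle.abs_sharpNoiseValue_sub_le {f : Cube n → ℤˣ} {P : TesterParams} {k : ℕ}
    {C : Finset (Fin n)} {x : Cube n} {η : ℝ} {v : BundleIndex n P → ℤˣ}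
    (h : GoodBundle f P k C x η v) {T : Finset (Fin n)} (hT : T.card ≤ P.r) :
    |sharpNoiseValue P v T - sharpNoise f P.κ P.Δ k C (flip x T)| ≤ coeffNorm P * η := by
  rw [sharpNoiseValue, dif_pos hT, ← sum_coeff_mul_noisyMean, ← sum_sub_distrib, coeffNorm, sum_mul]
  refine (abs_sum_le_sum_abs _ _).trans (sum_le_sum fun j _ => ?_)
  rw [← mul_sub, abs_mul]
  exact mul_le_mul_of_nonneg_left (h ⟨T, hT⟩ j).le (abs_nonneg _)

lemma abs_sharpNoise_le (P : TesterParams) (k : ℕ) (C : Finset (Fin n)) (y : Cube n) :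
    |sharpNoise f P.κ P.Δ k C y| ≤ coeffNorm P := by
  rw [← sum_coeff_mul_noisyMean, coeffNorm]
  refine (abs_sum_le_sum_abs _ _).trans (sum_le_sum fun j _ => ?_)
  rw [abs_mul]
  refine mul_le_of_le_one_right (abs_nonneg _) ?_
  have := abs_noisyMean_le f C (rho k ^ (j : ℕ)) y
  rwa [Set.Icc.coe_pow] at this

/-- The absolute value of the local estimator applied to `SharpNoise f`. -/
noncomputable def idealEstimate (P : TesterParams) (k : ℕ) (C U : Finset (Fin n)) (x : Cube n) : ℝ :=
  |∑ S, estMultiplier P k C U S * cubeCoeff f S * chi S x|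

lemma idealEstimate_le (P : TesterParams) (k : ℕ) (C U : Finset (Fin n)) (x : Cube n) :
    idealEstimate f P k C U x ≤ localBound n P.r P.flat * coeffNorm P := by
  rw [idealEstimate, ← localLinear_sharpNoise]
  exact abs_localLinear_le _ _ _ _ (coeffNorm_nonneg P) fun T _ => abs_sharpNoise_le f P k C _

lemma localBound_pos (r : ℕ) (a : ℕ → ℝ) : 0 < localBound n r a :=
  add_pos_of_pos_of_nonneg one_pos
    (sum_nonneg fun _ _ => mul_nonneg (abs_nonneg _) (Nat.cast_nonneg _))

lemma GoodBundle.abs_localEstimate_sub_le {f : Cube n → ℤˣ} {P : TesterParams} {k : ℕ}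
    {C : Finset (Fin n)} {x : Cube n} {η : ℝ} {v : BundleIndex n P → ℤˣ}
    (h : GoodBundle f P k C x η v) (hη : 0 ≤ η) (U : Finset (Fin n)) :
    |localEstimate P.r P.flat Uᶜ (sharpNoiseValue P v) - idealEstimate f P k C U x| ≤
      localBound n P.r P.flat * (coeffNorm P * η) := by
  rw [idealEstimate, ← localLinear_sharpNoise]
  refine (abs_abs_sub_abs_le_abs_sub _ _).trans ?_
  change |localLinear P.r P.flat Uᶜ (sharpNoiseValue P v) - _| ≤ _
  rw [← localLinear_sub]
  exact abs_localLinear_le _ _ _ _ (mul_nonneg (coeffNorm_nonneg P) hη)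
    fun T hT => h.abs_sharpNoiseValue_sub_le hT

/-- The sample points and bundles of one iteration of the main loop. -/
noncomputable def samples (P : TesterParams) (k : ℕ) (C : Finset (Fin n)) :
    SampleAlg n (Fin P.N → BundleIndex n P → ℤˣ) := do
  let x ← SampleAlg.seqAll fun _ : Fin P.N =>
    SampleAlg.toss (PMF.uniformOfFintype (Cube n)) SampleAlg.ret
  SampleAlg.seqAll fun j : Fin P.N => queryBundle P k C (x j)

/-- The probability bound for inaccurate estimates. -/
noncomputable def samplingError (P : TesterParams) (n : ℕ) (η θ : ℝ) : ℝ≥0∞ :=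
  2 ^ n * (2 * ENNReal.ofReal (Real.exp
    (-(P.N * θ ^ 2 / (2 * (localBound n P.r P.flat * coeffNorm P) ^ 2))))) +
  P.N * ((Fintype.card {T : Finset (Fin n) // T.card ≤ P.r} * (P.κ * P.Δ + 1) : ℕ) *
    (2 * ENNReal.ofReal (Real.exp (-(P.copies * η ^ 2 / 8)))))

/-- There are two independent sources of error. The average of the ideal estimate over the `N`
points must concentrate, for each of the `2^n` sets `U`. Given the points, every bundle must be
accurate; this event does not mention `U`, so no further union over `U` is needed. -/
lemma prob_samples_bad_le (P : TesterParams) (k : ℕ) (C : Finset (Fin n)) {η θ : ℝ}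
    (hη : 0 < η) (hθ : 0 < θ) (hN : 0 < P.N) (hcopies : 0 < P.copies) (hnorm : 0 < coeffNorm P) :
    ((samples P k C).law f).prob {B | ∃ U, θ + localBound n P.r P.flat * (coeffNorm P * η) <
      |corrEstimate P U B - cubeMean (idealEstimate f P k C U)|} ≤ samplingError P n η θ := by
  set Bd := localBound n P.r P.flat * coeffNorm P with hBd
  have hBdpos : 0 < Bd := mul_pos (localBound_pos _ _) hnorm
  have hN' : (0 : ℝ) < P.N := by exact_mod_cast hN
  set bad : Set (Fin P.N → Cube n) := ⋃ U ∈ (univ : Finset (Finset (Fin n))),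
    {x | P.N * θ ≤ |∑ j, (idealEstimate f P k C U (x j) - cubeMean (idealEstimate f P k C U))|}
    with hbad
  rw [samples, SampleAlg.law_bind]
  refine (PMF.prob_bind_le_add _ _ _ bad (c := P.N * ((Fintype.card
    {T : Finset (Fin n) // T.card ≤ P.r} * (P.κ * P.Δ + 1) : ℕ) *
      (2 * ENNReal.ofReal (Real.exp (-(P.copies * η ^ 2 / 8)))))) ?_).trans
    (add_le_add_left ?_ _)
  · intro x hx
    have h1 := SampleAlg.prob_seqAll_exists_le f (fun j : Fin P.N => queryBundle P k C (x j))
      (fun j => {v | ¬ GoodBundle f P k C (x j) η v})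
      fun j => prob_not_goodBundle_le f P k C (x j) hη hcopies
    rw [Fintype.card_fin] at h1
    refine (PMF.prob_mono _ fun B hB => ?_).trans h1
    by_contra hc
    simp only [Set.mem_ofPred_eq, not_exists, not_not] at hc
    obtain ⟨U, hU⟩ := hB
    refine hU.not_ge ?_
    have hxU : |∑ j, (idealEstimate f P k C U (x j) - cubeMean (idealEstimate f P k C U))| <
        P.N * θ := by
      by_contra hge
      exact hx (Set.mem_iUnion₂.mpr ⟨U, mem_univ _, not_lt.mp hge⟩)
    have e : corrEstimate P U B - cubeMean (idealEstimate f P k C U) =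
        ((∑ j, (localEstimate P.r P.flat Uᶜ (sharpNoiseValue P (B j)) -
            idealEstimate f P k C U (x j))) +
          ∑ j, (idealEstimate f P k C U (x j) - cubeMean (idealEstimate f P k C U))) / P.N := by
      rw [corrEstimate, ← sum_add_distrib]
      simp only [sub_add_sub_cancel]
      rw [sum_sub_distrib, sum_const, card_univ, Fintype.card_fin, nsmul_eq_mul]
      field_simp
    rw [e, abs_div, Nat.abs_cast, div_le_iff₀ hN']
    refine (abs_add_le _ _).trans ?_
    have h2 : |∑ j, (localEstimate P.r P.flat Uᶜ (sharpNoiseValue P (B j)) -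
        idealEstimate f P k C U (x j))| ≤ P.N * (localBound n P.r P.flat * (coeffNorm P * η)) := by
      refine (abs_sum_le_sum_abs _ _).trans ((sum_le_card_nsmul _ _ _ fun j _ =>
        (hc j).abs_localEstimate_sub_le hη.le U).trans ?_)
      rw [card_univ, Fintype.card_fin, nsmul_eq_mul]
    linarith
  · have h1 := PMF.prob_biUnion_le_card_mul ((SampleAlg.seqAll fun _ : Fin P.N =>
      SampleAlg.toss (PMF.uniformOfFintype (Cube n)) SampleAlg.ret).law f)
      (univ : Finset (Finset (Fin n)))
      (fun U => {x | P.N * θ ≤ |∑ j, (idealEstimate f P k C U (x j) -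
        cubeMean (idealEstimate f P k C U))|})
      (c := 2 * ENNReal.ofReal (Real.exp (-(P.N * θ ^ 2 / (2 * Bd ^ 2))))) fun U _ => by
        -- The ideal estimate and its mean both lie in `[0, Bd]`, so they differ by at most `Bd`.
        have := SampleAlg.hoeffding_abs f (fun _ : Fin P.N =>
          SampleAlg.toss (PMF.uniformOfFintype (Cube n)) SampleAlg.ret) univ
          (fun _ x => idealEstimate f P k C U x - cubeMean (idealEstimate f P k C U))
          (B := Bd) (η := θ) hBdpos (by simpa using hN) hθ
          (fun _ _ x => by
            have h0 : ∀ y, 0 ≤ idealEstimate f P k C U y := fun y => abs_nonneg _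
            have h2 : cubeMean (idealEstimate f P k C U) ≤ Bd :=
              (cubeMean_mono (idealEstimate_le f P k C U)).trans (cubeMean_const Bd).le
            have h3 : 0 ≤ cubeMean (idealEstimate f P k C U) :=
              (cubeMean_const (n := n) 0).symm.le.trans (cubeMean_mono h0)
            rw [abs_le]
            constructor <;> linarith [h0 x, idealEstimate_le f P k C U x])
          (fun _ _ => by
            rw [PMF.mean_sub, PMF.mean_const, law_uniform_alg, mean_uniformOfFintype, sub_self])
        rw [card_univ, Fintype.card_fin] at this
        exact this
    rw [card_univ, Fintype.card_finset, Fintype.card_fin] at h1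
    push_cast at h1
    exact h1

/-- The set `C` of one iteration of the main loop. -/
noncomputable def coreSet (n k : ℕ) : SampleAlg n (Finset (Fin n)) := do
  let A ← SampleAlg.seqAll fun _ : Fin (rounds k) => SampleAlg.draw SampleAlg.ret
  SampleAlg.ret (univ.biUnion A)

lemma law_iteration (P : TesterParams) (k : ℕ) (ε : ℝ) (S : Fin (testDraws n ε) → Finset (Fin n)) :
    (iteration P k ε S).law f = ((coreSet n k).law f).bind fun C =>
      ((samples P k C).law f).bind fun B =>
        PMF.pure ((admissible k ε S C).fold max 0 fun U => corrEstimate P U B) := by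
  simp only [iteration, coreSet, samples, SampleAlg.law_bind, PMF.bind_bind, SampleAlg.law,
    PMF.pure_bind]

/-- The estimates exceed the optimum with small probability. -/
lemma prob_iteration_gt_le (P : TesterParams) (k : ℕ) (ε : ℝ)
    (S : Fin (testDraws n ε) → Finset (Fin n)) {η θ γ : ℝ}
    (hη : 0 < η) (hθ : 0 < θ) (hN : 0 < P.N) (hcopies : 0 < P.copies) (hnorm : 0 < coeffNorm P)
    (hγ : 0 ≤ γ) (hadm : ∀ C U, U ∈ admissible k ε S C →
      cubeMean (idealEstimate f P k C U) + (θ + localBound n P.r P.flat * (coeffNorm P * η)) ≤ γ) :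
    ((iteration P k ε S).law f).prob {x | γ < x} ≤ samplingError P n η θ := by
  rw [law_iteration, PMF.prob_bind]
  refine PMF.expect_le_of_le _ fun C => ?_
  rw [PMF.prob_bind_pure]
  refine (PMF.prob_mono _ fun B hB => ?_).trans
    (prob_samples_bad_le f P k C hη hθ hN hcopies hnorm)
  simp only [Set.mem_preimage, Set.mem_ofPred_eq, lt_fold_max] at hB
  obtain hB | ⟨U, hU, hB⟩ := hB
  -- The maximum starts from the value `0`, which cannot exceed `γ ≥ 0`.
  · exact absurd hB hγ.not_gt
  · refine ⟨U, ?_⟩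
    have := hadm C U hU
    refine lt_of_lt_of_le ?_ (le_abs_self _)
    linarith

/-- The optimum is missed only if it is not admissible, up to the sampling error. -/
lemma prob_iteration_lt_le (P : TesterParams) (k : ℕ) (ε : ℝ)
    (S : Fin (testDraws n ε) → Finset (Fin n)) {η θ γ : ℝ}
    (hη : 0 < η) (hθ : 0 < θ) (hN : 0 < P.N) (hcopies : 0 < P.copies) (hnorm : 0 < coeffNorm P)
    (U : Finset (Fin n)) (good : Set (Finset (Fin n))) (hgood : ∀ C ∈ good,
      U ∈ admissible k ε S C ∧
      γ ≤ cubeMean (idealEstimate f P k C U) - (θ + localBound n P.r P.flat * (coeffNorm P * η))) :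
    ((iteration P k ε S).law f).prob {x | x < γ} ≤
      ((coreSet n k).law f).prob goodᶜ + samplingError P n η θ := by
  rw [law_iteration]
  refine PMF.prob_bind_le_add _ _ _ _ fun C hC => ?_
  rw [PMF.prob_bind_pure]
  refine (PMF.prob_mono _ fun B hB => ?_).trans
    (prob_samples_bad_le f P k C hη hθ hN hcopies hnorm)
  obtain ⟨hU, hγ⟩ := hgood C (by simpa using hC)
  simp only [Set.mem_preimage, Set.mem_ofPred_eq, fold_max_lt] at hB
  have h1 := hB.2 U hU
  refine ⟨U, ?_⟩
  rw [abs_sub_comm]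
  refine lt_of_lt_of_le ?_ (le_abs_self _)
  linarith

end JuntaTester

/-! ### The test draws -/

namespace JuntaTester

variable {n : ℕ} (f : Cube n → ℤˣ)

lemma law_draw_ret :
    (SampleAlg.draw SampleAlg.ret : SampleAlg n (Finset (Fin n))).law f = spectralSample f := by
  simp only [SampleAlg.law]
  exact PMF.bind_pure _

lemma spectralSample_toReal (S : Finset (Fin n)) :
    (spectralSample f S).toReal = cubeCoeff f S ^ 2 := by
  rw [spectralSample, PMF.ofFintype_apply, ENNReal.toReal_ofReal (sq_nonneg _)]

lemma prob_spectralSample (s : Finset (Finset (Fin n))) :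
    (spectralSample f).prob {S | S ∈ s} = ENNReal.ofReal (∑ S ∈ s, cubeCoeff f S ^ 2) := by
  rw [PMF.prob_eq_ofReal_sum]
  simp_rw [spectralSample_toReal]

/-- The sets `S ⊆ U` with `|S \ C| ≥ ℓ`. -/
noncomputable def farSets (k : ℕ) (C U : Finset (Fin n)) : Finset (Finset (Fin n)) :=
  U.powerset.filter fun S => ell k ≤ (S \ C).card

lemma mem_farSets {k : ℕ} {C U S : Finset (Fin n)} :
    S ∈ farSets k C U ↔ S ⊆ U ∧ ell k ≤ (S \ C).card := by
  simp [farSets]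

lemma farWeight_anti (k : ℕ) {C D : Finset (Fin n)} (h : C ⊆ D) (U : Finset (Fin n)) :
    farWeight f k D U ≤ farWeight f k C U := by
  refine sum_le_sum_of_subset_of_nonneg (fun S hS => ?_) fun _ _ _ => sq_nonneg _
  simp only [mem_filter, mem_powerset] at hS ⊢
  exact ⟨hS.1, hS.2.trans (card_le_card (sdiff_subset_sdiff le_rfl h))⟩

/-- The test draws. -/
noncomputable def tests (n : ℕ) (ε : ℝ) : SampleAlg n (Fin (testDraws n ε) → Finset (Fin n)) :=
  SampleAlg.seqAll fun _ => SampleAlg.draw SampleAlg.ret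

lemma mem_admissible {k : ℕ} {ε : ℝ} {S : Fin (testDraws n ε) → Finset (Fin n)}
    {C U : Finset (Fin n)} : U ∈ admissible k ε S C ↔ U.card = k ∧ C ⊆ U ∧
      ((univ.filter fun i => S i ∈ farSets k C U).card : ℝ) ≤ ε ^ 2 / 10 * testDraws n ε := by
  simp only [admissible, mem_filter, mem_powersetCard, subset_univ, true_and, mem_farSets]

lemma le_testDraws (n : ℕ) (ε : ℝ) : ((n : ℝ) / ε) ^ 4 ≤ testDraws n ε := Nat.le_ceil _

/-- A Chernoff lower-tail bound: the expected number of hits exceeds `2ε²M`, against an allowed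
`ε²M/10`. Each hit is weighted by `e^{-2}`. -/
lemma prob_admissible_of_farWeight_gt_le {k : ℕ} {ε : ℝ} (hn : 1 ≤ n) (hε : 0 < ε)
    (hε2 : ε ≤ 1 / 2) {C U : Finset (Fin n)} (hw : 2 * ε ^ 2 < farWeight f k C U) :
    ((tests n ε).law f).prob {S | U ∈ admissible k ε S C} ≤ ENNReal.ofReal (Real.exp (-(6 * n))) := by
  set p := farWeight f k C U with hp
  set M := testDraws n ε with hM
  have hexp : Real.exp (-2) ≤ 0.14 := by
    have h1 := Real.exp_neg_one_lt_d9
    have h2 : Real.exp (-2) = Real.exp (-1) * Real.exp (-1) := by rw [← Real.exp_add]; norm_num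
    rw [h2]
    nlinarith [Real.exp_pos (-1)]
  have hmean : (spectralSample f).mean
      (fun S => Real.exp (if S ∈ farSets k C U then -2 else 0)) = 1 - p * (1 - Real.exp (-2)) := by
    have e : ∀ S, Real.exp (if S ∈ farSets k C U then -2 else 0) =
        1 - if S ∈ farSets k C U then 1 - Real.exp (-2) else 0 := fun S => by
      split_ifs <;> simp
    simp_rw [e]
    rw [PMF.mean_sub, PMF.mean_const, PMF.mean]
    simp_rw [spectralSample_toReal, mul_ite, mul_zero]
    rw [sum_ite_mem, univ_inter, ← sum_mul]
    rfl
  have h := SampleAlg.prob_seqAll_sum_ge_le_exp f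
    (fun _ : Fin M => SampleAlg.draw SampleAlg.ret) univ
    (fun _ S => if S ∈ farSets k C U then -2 else 0) (-(p * (1 - Real.exp (-2))))
    (-(2 * (ε ^ 2 / 10 * M))) fun _ _ => by
      rw [law_draw_ret, PMF.expect_ofReal _ fun _ => (Real.exp_pos _).le, hmean]
      refine ENNReal.ofReal_le_ofReal ?_
      have := Real.add_one_le_exp (-(p * (1 - Real.exp (-2))))
      linarith
  refine ((PMF.prob_mono _ fun S hS => ?_).trans h).trans
    (ENNReal.ofReal_le_ofReal (Real.exp_le_exp.mpr ?_))
  · have := (mem_admissible.mp (show U ∈ admissible k ε S C from hS)).2.2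
    simp only [Set.mem_ofPred_eq]
    rw [← sum_filter, sum_const, nsmul_eq_mul]
    linarith
  · rw [card_univ, Fintype.card_fin]
    have hMn := le_testDraws n ε
    rw [← hM] at hMn
    have hn' : (1 : ℝ) ≤ n := by exact_mod_cast hn
    -- The exponent is at most `-(1.72 - 0.2) ε² M`, so `ε² M ≥ 4n` suffices to reach `-6n`.
    have h1 : 4 * (n : ℝ) ≤ ε ^ 2 * M := by
      have h2 : 2 ≤ (n : ℝ) / ε := by rw [le_div_iff₀ hε]; linarith
      have h3 : ε ^ 2 * ((n : ℝ) / ε) ^ 4 = n ^ 2 * ((n : ℝ) / ε) ^ 2 := by field_simp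
      have h4 : ε ^ 2 * ((n : ℝ) / ε) ^ 4 ≤ ε ^ 2 * M := by gcongr
      have h5 : (4 : ℝ) ≤ ((n : ℝ) / ε) ^ 2 := by nlinarith
      nlinarith
    have hM0 : (0 : ℝ) ≤ M := Nat.cast_nonneg _
    have h6 : 1.72 * ε ^ 2 ≤ p * (1 - Real.exp (-2)) := by nlinarith
    have h7 : 1.72 * ε ^ 2 * M ≤ p * (1 - Real.exp (-2)) * M := by gcongr
    nlinarith

/-- With high probability no set `U` with large far weight passes the test. -/
lemma prob_tests_unsound_le {k : ℕ} {ε : ℝ} (hn : 1 ≤ n) (hε : 0 < ε) (hε2 : ε ≤ 1 / 2) :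
    ((tests n ε).law f).prob
      {S | ∃ C U, U ∈ admissible k ε S C ∧ 2 * ε ^ 2 < farWeight f k C U} ≤
      ENNReal.ofReal (1 / 100) := by
  classical
  have h := PMF.prob_biUnion_le_card_mul ((tests n ε).law f)
    (univ.filter fun q : Finset (Fin n) × Finset (Fin n) => 2 * ε ^ 2 < farWeight f k q.1 q.2)
    (fun q => {S | q.2 ∈ admissible k ε S q.1})
    fun q hq => prob_admissible_of_farWeight_gt_le f hn hε hε2 (mem_filter.mp hq).2
  refine (PMF.prob_mono _ fun S hS => ?_).trans (h.trans ?_)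
  · obtain ⟨C, U, h1, h2⟩ := hS
    exact Set.mem_iUnion₂.mpr ⟨(C, U), mem_filter.mpr ⟨mem_univ _, h2⟩, h1⟩
  · rw [← ENNReal.ofReal_natCast, ← ENNReal.ofReal_mul (Nat.cast_nonneg _)]
    refine ENNReal.ofReal_le_ofReal ?_
    -- Union bound over at most `4^n` pairs `(C, U)`; `e^{-6} ≤ 1/400` leaves `(1/100)^n`.
    have h1 : ((univ.filter fun q : Finset (Fin n) × Finset (Fin n) =>
        2 * ε ^ 2 < farWeight f k q.1 q.2).card : ℝ) ≤ 4 ^ n := by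
      have h2 : (univ.filter fun q : Finset (Fin n) × Finset (Fin n) =>
          2 * ε ^ 2 < farWeight f k q.1 q.2).card ≤ 4 ^ n := by
        refine (card_le_univ _).trans (le_of_eq ?_)
        rw [Fintype.card_prod, Fintype.card_finset, Fintype.card_fin, ← mul_pow]
        norm_num
      exact_mod_cast h2
    have h3 : Real.exp (-(6 * (n : ℝ))) = Real.exp (-6) ^ n := by
      rw [← Real.exp_nat_mul]; congr 1; ring
    have h4 : Real.exp (-6) ≤ 1 / 400 := by
      have h5 := Real.exp_neg_one_lt_d9
      have h6 : Real.exp (-6) = Real.exp (-1) ^ 6 := by rw [← Real.exp_nat_mul]; norm_num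
      rw [h6]
      calc Real.exp (-1) ^ 6 ≤ 0.3678794412 ^ 6 := by gcongr
        _ ≤ _ := by norm_num
    calc _ ≤ (4 : ℝ) ^ n * (1 / 400) ^ n := by
          rw [h3]; gcongr
      _ = (1 / 100) ^ n := by rw [← mul_pow]; norm_num
      _ ≤ (1 / 100) ^ 1 := pow_le_pow_of_le_one (by norm_num) (by norm_num) hn
      _ = 1 / 100 := pow_one _

/-- A set with tiny far weight passes the test with high probability. -/
lemma prob_tests_not_admissible_le {k : ℕ} {ε c : ℝ} {C U : Finset (Fin n)} (hU : U.card = k)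
    (hCU : C ⊆ U) (hw : farWeight f k C U ≤ c) :
    ((tests n ε).law f).prob {S | U ∉ admissible k ε S C} ≤
      testDraws n ε * ENNReal.ofReal c := by
  have h := SampleAlg.prob_seqAll_exists_le f
    (fun _ : Fin (testDraws n ε) => (SampleAlg.draw SampleAlg.ret : SampleAlg n (Finset (Fin n))))
    (fun _ => {S | S ∈ farSets k C U}) (c := ENNReal.ofReal c) fun _ => by
      rw [law_draw_ret, prob_spectralSample]
      exact ENNReal.ofReal_le_ofReal hw
  rw [Fintype.card_fin] at h
  refine (PMF.prob_mono _ fun S hS => ?_).trans h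
  by_contra hc
  simp only [Set.mem_ofPred_eq, not_exists] at hc
  refine hS (mem_admissible.mpr ⟨hU, hCU, ?_⟩)
  -- If no test draw is far, the count is zero and lies below any threshold.
  rw [filter_false_of_mem fun i _ => hc i, card_empty, Nat.cast_zero]
  positivity

/-! ### The core set -/

/-- The sets `C ⊆ U` for which almost all of the spectral weight of `f` on subsets of `U` is
visible. -/
def goodCores (k : ℕ) (U : Finset (Fin n)) (c : ℝ) : Set (Finset (Fin n)) :=
  {C | C ⊆ U ∧ farWeight f k C U ≤ c}

/-- The invariant says that either the core already is good, or `m` further additions of `ℓ`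
elements would fill `U`. In the second case the far sets themselves have weight above `c`, and
drawing one enlarges the core by at least `ℓ`. In the first case any draw inside `U` keeps the core
good, since far weight decreases in `C`. Each round thus succeeds with probability at least `c`. -/
lemma prob_seqFin_goodCores_ge {k : ℕ} (hk : 1 ≤ k) {U : Finset (Fin n)} (hU : U.card = k) {c : ℝ}
    (hc0 : 0 ≤ c) (hc : c ≤ ∑ S ∈ U.powerset, cubeCoeff f S ^ 2) (m : ℕ) (C : Finset (Fin n))
    (hCU : C ⊆ U) (hC : farWeight f k C U ≤ c ∨ k ≤ C.card + m * ell k) :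
    ENNReal.ofReal c ^ m ≤ ((SampleAlg.seqFin fun _ : Fin m =>
      (SampleAlg.draw SampleAlg.ret : SampleAlg n (Finset (Fin n)))).law f).prob
        {A | C ∪ univ.biUnion A ∈ goodCores f k U c} := by
  induction m generalizing C with
  | zero =>
    have hgood : C ∈ goodCores f k U c := by
      refine ⟨hCU, hC.elim id fun h => ?_⟩
      -- With no rounds left the core is all of `U`, so no far set remains because `ℓ ≥ 1`.
      have e : C = U := eq_of_subset_of_card_le hCU (by omega)
      subst e
      rw [farWeight, filter_false_of_mem, sum_empty]
      · exact hc0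
      · intro S hS
        rw [sdiff_eq_empty_iff_subset.mpr (mem_powerset.mp hS), card_empty]
        have := ell_pos hk
        omega
    rw [SampleAlg.seqFin, SampleAlg.law, PMF.prob, PMF.expect_pure]
    simp [hgood]
  | succ m ih =>
    set s : Finset (Finset (Fin n)) :=
      U.powerset.filter fun S => farWeight f k (C ∪ S) U ≤ c ∨ k ≤ (C ∪ S).card + m * ell k with hs
    have hsc : c ≤ ∑ S ∈ s, cubeCoeff f S ^ 2 := by
      by_cases hfar : farWeight f k C U ≤ c
      · rw [hs, filter_true_of_mem fun S _ =>
          Or.inl ((farWeight_anti f k subset_union_left U).trans hfar)]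
        exact hc
      · refine (lt_of_not_ge hfar).le.trans
          (sum_le_sum_of_subset_of_nonneg (fun S hS => ?_) fun _ _ _ => sq_nonneg _)
        simp only [hs, mem_filter, mem_powerset] at hS ⊢
        refine ⟨hS.1, Or.inr ?_⟩
        have h1 := hC.resolve_left hfar
        have h2 : (C ∪ S).card = C.card + (S \ C).card := by
          rw [← card_union_of_disjoint disjoint_sdiff, union_sdiff_self_eq_union]
        rw [h2]
        rw [add_mul, one_mul] at h1
        have := hS.2
        omega
    rw [SampleAlg.law_seqFin_succ, law_draw_ret, PMF.prob_bind, pow_succ]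
    calc ENNReal.ofReal c ^ m * ENNReal.ofReal c ≤
        ENNReal.ofReal c ^ m * (spectralSample f).prob {S | S ∈ s} := by
          rw [prob_spectralSample]
          exact mul_le_mul_right (ENNReal.ofReal_le_ofReal hsc) _
      _ ≤ _ := by
          rw [PMF.prob, ← PMF.expect_const_mul]
          refine PMF.expect_mono _ fun S => ?_
          by_cases hS : S ∈ s
          · have hS' := mem_filter.mp hS
            rw [Set.indicator_of_mem (by exact hS), Pi.one_apply, mul_one, PMF.prob_bind_pure]
            refine (ih (C ∪ S) (union_subset hCU (mem_powerset.mp hS'.1)) hS'.2).trans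
              (PMF.prob_mono _ fun A hA => ?_)
            have e : (univ : Finset (Fin (m + 1))).biUnion
                (Fin.cons S A : Fin (m + 1) → Finset (Fin n)) = S ∪ univ.biUnion A := by
              ext i
              simp [Fin.exists_fin_succ]
            simp only [Set.mem_preimage, Set.mem_ofPred_eq, e, ← union_assoc]
            exact hA
          · rw [Set.indicator_of_notMem (by exact hS), mul_zero]
            exact zero_le

lemma prob_coreSet_ge {k : ℕ} (hk : 1 ≤ k) {U : Finset (Fin n)} (hU : U.card = k) {c : ℝ}
    (hc0 : 0 ≤ c) (hc : c ≤ ∑ S ∈ U.powerset, cubeCoeff f S ^ 2) :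
    ENNReal.ofReal c ^ rounds k ≤ ((coreSet n k).law f).prob (goodCores f k U c) := by
  refine (prob_seqFin_goodCores_ge f hk hU hc0 hc (rounds k) ∅ (empty_subset _)
    (Or.inr (by simpa using le_rounds_mul_ell hk))).trans (le_of_eq ?_)
  rw [coreSet, SampleAlg.law_bind]
  simp only [SampleAlg.law]
  rw [PMF.prob_bind_pure, SampleAlg.law_seqAll, PMF.prob_bind_pure]
  have e : ∀ A : Fin (Fintype.card (Fin (rounds k))) → Finset (Fin n),
      univ.biUnion (fun i => A (Fintype.equivFin (Fin (rounds k)) i)) = univ.biUnion A := fun A => by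
    ext i
    simp only [mem_biUnion, mem_univ, true_and]
    exact (Fintype.equivFin (Fin (rounds k))).exists_congr_left.trans (by simp)
  -- `seqAll` indexes its runs by the cardinality of `Fin (rounds k)`, which is equal to `rounds k`
  -- only propositionally.
  have e2 : ∀ m, m = rounds k → ((SampleAlg.seqFin fun _ : Fin (rounds k) =>
      (SampleAlg.draw SampleAlg.ret : SampleAlg n (Finset (Fin n)))).law f).prob
        {A | ∅ ∪ univ.biUnion A ∈ goodCores f k U c} = ((SampleAlg.seqFin fun _ : Fin m =>
      (SampleAlg.draw SampleAlg.ret : SampleAlg n (Finset (Fin n)))).law f).prob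
        {A | univ.biUnion A ∈ goodCores f k U c} := fun m hm => by
    subst hm; simp
  rw [e2 _ (Fintype.card_fin _)]
  congr 1
  ext A
  simp only [Set.mem_preimage, Set.mem_ofPred_eq, e]

/-- Markov's inequality over the test draws: with high probability, the optimal set is found with
at least half of the probability that a good core set is drawn. -/
lemma prob_tests_incomplete_le {k : ℕ} {ε c : ℝ} {U : Finset (Fin n)} (hU : U.card = k)
    (hc : (testDraws n ε : ℝ) * c ≤ 1 / 1000)
    (hq : ((coreSet n k).law f).prob (goodCores f k U c) ≠ 0) :
    ((tests n ε).law f).prob {S | ((coreSet n k).law f).prob (goodCores f k U c) / 2 ≤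
      ((coreSet n k).law f).prob {C | C ∈ goodCores f k U c ∧ U ∉ admissible k ε S C}} ≤
      ENNReal.ofReal (1 / 500) := by
  set p := (coreSet n k).law f with hp
  set q := p.prob (goodCores f k U c) with hqdef
  have hqtop : q ≠ ⊤ := ((PMF.prob_le_one _ _).trans_lt ENNReal.one_lt_top).ne
  have h1 := PMF.mul_prob_le_expect ((tests n ε).law f)
    (fun S => p.prob {C | C ∈ goodCores f k U c ∧ U ∉ admissible k ε S C}) (q / 2)
  have h2 : ((tests n ε).law f).expect
      (fun S => p.prob {C | C ∈ goodCores f k U c ∧ U ∉ admissible k ε S C}) ≤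
      ENNReal.ofReal (1 / 1000) * q := by
    -- The core set is independent of the test draws, so the two expectations may be exchanged and
    -- the tests handled for each fixed `C`.
    have e : ((tests n ε).law f).expect
        (fun S => p.prob {C | C ∈ goodCores f k U c ∧ U ∉ admissible k ε S C}) =
        p.expect fun C => ((tests n ε).law f).prob
          {S | C ∈ goodCores f k U c ∧ U ∉ admissible k ε S C} := by
      simp_rw [PMF.prob, PMF.expect, ← ENNReal.tsum_mul_left]
      rw [ENNReal.tsum_comm]
      refine tsum_congr fun C => tsum_congr fun S => ?_
      rw [mul_left_comm]
      rfl
    rw [e, hqdef, PMF.prob, ← PMF.expect_const_mul]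
    refine PMF.expect_mono _ fun C => ?_
    by_cases hC : C ∈ goodCores f k U c
    · rw [Set.indicator_of_mem hC, Pi.one_apply, mul_one]
      refine (PMF.prob_mono _ fun S hS => hS.2).trans
        ((prob_tests_not_admissible_le f hU hC.1 hC.2).trans ?_)
      rw [← ENNReal.ofReal_natCast, ← ENNReal.ofReal_mul (Nat.cast_nonneg _)]
      exact ENNReal.ofReal_le_ofReal hc
    · simp [hC, PMF.prob, PMF.expect]
  have h3 := h1.trans h2
  -- Writing the bound as `(q/2) * (1/500)` allows `q/2` to be cancelled; this requires `q` to be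
  -- nonzero and finite.
  have e : ENNReal.ofReal (1 / 1000) * q = q / 2 * ENNReal.ofReal (1 / 500) := by
    have h4 : (ENNReal.ofReal (1 / 2)) = 2⁻¹ := by
      rw [one_div, ENNReal.ofReal_inv_of_pos (by norm_num), ENNReal.ofReal_ofNat]
    rw [show (1 / 1000 : ℝ) = 1 / 2 * (1 / 500) by norm_num,
      ENNReal.ofReal_mul (by norm_num), h4, mul_comm, ← mul_assoc, ← div_eq_mul_inv]
  rw [e] at h3
  exact (ENNReal.mul_le_mul_iff_right (by simpa using hq)
    (ENNReal.div_ne_top hqtop (by norm_num))).mp h3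

end JuntaTester

/-! ### Correctness of the tester -/

namespace JuntaTester

variable {n : ℕ} (f : Cube n → ℤˣ)

/-- Parameters for which the tester is correct. -/
structure Suitable (P : TesterParams) (n k : ℕ) (ε η θ : ℝ) : Prop where
  bias : SmallBias P n k (ε / 8)
  eta_pos : 0 < η
  theta_pos : 0 < θ
  accuracy : θ + localBound n P.r P.flat * (coeffNorm P * η) ≤ ε / 4
  N_pos : 0 < P.N
  copies_pos : 0 < P.copies
  coeffNorm_pos : 0 < coeffNorm P
  sampling : samplingError P n η θ ≤ ENNReal.ofReal (1 / (200 * P.loops))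
  loops : 16 ≤ P.loops * (1 / (1000 * (testDraws n ε : ℝ))) ^ rounds k

lemma Suitable.loops_pos {P : TesterParams} {n k : ℕ} {ε η θ : ℝ} (h : Suitable P n k ε η θ) :
    0 < P.loops := by
  by_contra hc
  have := h.loops
  rw [Nat.eq_zero_of_not_pos hc] at this
  norm_num at this

lemma law_distTester (P : TesterParams) (k : ℕ) (ε : ℝ) :
    (distTester P n k ε).law f = ((tests n ε).law f).bind fun S =>
      ((SampleAlg.seqAll fun _ : Fin P.loops => iteration P k ε S).law f).bind fun γ =>
        PMF.pure ((1 - univ.fold max 0 γ) / 2) := by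
  simp only [distTester, corrTester, tests, SampleAlg.law_bind, PMF.bind_bind, SampleAlg.law,
    PMF.pure_bind]

/-- With `δ = ε/8` the bias is at most `√(2 + 1/64) ε ≤ 1.5 ε`. The sampling error adds at most
`ε/4`, which stays below `2ε`. -/
lemma Suitable.abs_cubeMean_idealEstimate_sub_le {P : TesterParams} {n k : ℕ} {ε η θ : ℝ}
    (h : Suitable P n k ε η θ) (f : Cube n → ℤˣ) (hε : 0 < ε) {C U : Finset (Fin n)} (hCU : C ⊆ U)
    (hw : farWeight f k C U ≤ 2 * ε ^ 2) :
    |cubeMean (idealEstimate f P k C U) - cubeMean (fun x => |juntaProj f U x|)| ≤ 1.5 * ε := by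
  refine (abs_cubeMean_estimate_sub_le f h.bias (by positivity) hCU).trans ?_
  refine Real.sqrt_le_iff.mpr ⟨by positivity, ?_⟩
  nlinarith

/-- Given the test draws, the final estimate is accurate with high probability. -/
lemma prob_final_le {P : TesterParams} {k : ℕ} {ε η θ : ℝ} (h : Suitable P n k ε η θ)
    (hk : 1 ≤ k) (hn : 1 ≤ n) (hε : 0 < ε) (hε2 : ε ≤ 1 / 2) {U : Finset (Fin n)}
    (hU : U.card = k) (hmax : ∀ V : Finset (Fin n), V.card = k →
        cubeMean (fun x => |juntaProj f V x|) ≤ cubeMean fun x => |juntaProj f U x|)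
    (hdist : juntaDist k f = (1 - cubeMean fun x => |juntaProj f U x|) / 2) :
    ((distTester P n k ε).law f).prob {d : ℝ | |d - juntaDist k f| ≤ ε}ᶜ ≤
      ENNReal.ofReal (3 / 100) := by
  set γs := cubeMean fun x => |juntaProj f U x| with hγs
  have hγ0 : 0 ≤ γs := (cubeMean_const (n := n) 0).symm.le.trans (cubeMean_mono fun _ => abs_nonneg _)
  set M := testDraws n ε with hM
  have hR : (0 : ℝ) < P.loops := by exact_mod_cast h.loops_pos
  have hMn : ((n : ℝ) / ε) ^ 4 ≤ M := le_testDraws n ε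
  have hne : 2 ≤ (n : ℝ) / ε := by
    have : (1 : ℝ) ≤ n := by exact_mod_cast hn
    rw [le_div_iff₀ hε]; linarith
  have hεM : 1 ≤ ε ^ 2 * M := by
    have h3 : ε ^ 2 * ((n : ℝ) / ε) ^ 4 = n ^ 2 * ((n : ℝ) / ε) ^ 2 := by field_simp
    have h4 : ε ^ 2 * ((n : ℝ) / ε) ^ 4 ≤ ε ^ 2 * M := by gcongr
    have h5 : (1 : ℝ) ≤ n := by exact_mod_cast hn
    have h6 : 1 ≤ (n : ℝ) ^ 2 * ((n : ℝ) / ε) ^ 2 :=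
      one_le_mul_of_one_le_of_one_le (one_le_pow₀ h5) (one_le_pow₀ (by linarith))
    linarith
  have hMpos : (0 : ℝ) < M := by
    have : 0 < ((n : ℝ) / ε) ^ 4 := by positivity
    linarith
  -- Chosen so that `M` test draws hit a family of weight at most `c` with probability at most
  -- `1/1000`.
  set c : ℝ := 1 / (1000 * (M : ℝ)) with hc
  have hcpos : 0 < c := by positivity
  have hcε : c ≤ ε ^ 2 := by
    rw [hc, div_le_iff₀ (by positivity)]
    nlinarith
  set unsound : Set (Fin M → Finset (Fin n)) :=
    {S | ∃ C V, V ∈ admissible k ε S C ∧ 2 * ε ^ 2 < farWeight f k C V} with hunsound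
  set q := ((coreSet n k).law f).prob (goodCores f k U c) with hq
  set incomplete : Set (Fin M → Finset (Fin n)) := {S | q / 2 ≤
      ((coreSet n k).law f).prob {C | C ∈ goodCores f k U c ∧ U ∉ admissible k ε S C}} with hinc
  set s := samplingError P n η θ with hs
  have hqtop : q ≠ ⊤ := ((PMF.prob_le_one _ _).trans_lt ENNReal.one_lt_top).ne
  have haccγ := h.accuracy
  -- the estimates are never too large
  have hupper : ∀ S ∉ unsound, ((SampleAlg.seqAll fun _ : Fin P.loops => iteration P k ε S).law f).prob
      {γ | ∃ i, γs + 2 * ε < γ i} ≤ ENNReal.ofReal (5 / 1000) := fun S hS => by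
    have h1 := SampleAlg.prob_seqAll_exists_le f (fun _ : Fin P.loops => iteration P k ε S)
      (fun _ => {x | γs + 2 * ε < x}) fun _ => prob_iteration_gt_le f P k ε S h.eta_pos
        h.theta_pos h.N_pos h.copies_pos h.coeffNorm_pos (by positivity) fun C V hV => by
          have hw : farWeight f k C V ≤ 2 * ε ^ 2 := by
            by_contra hgt
            exact hS ⟨C, V, hV, not_le.mp hgt⟩
          have hV' := mem_admissible.mp hV
          have h2 := (abs_le.mp (h.abs_cubeMean_idealEstimate_sub_le f hε hV'.2.1 hw)).2
          have h3 := hmax V hV'.1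
          linarith
    -- The union over `R` iterations costs `R * 1/(200 R) = 5/1000`.
    refine h1.trans ((mul_le_mul_right h.sampling _).trans (le_of_eq ?_))
    rw [Fintype.card_fin, ← ENNReal.ofReal_natCast, ← ENNReal.ofReal_mul (Nat.cast_nonneg _)]
    congr 1
    field_simp
    norm_num
  -- some estimate is large enough
  have hlower : 2 * ε < γs → q ≠ 0 ∧ ∀ S ∉ incomplete,
      ((SampleAlg.seqAll fun _ : Fin P.loops => iteration P k ε S).law f).prob
        {γ | ∀ i, γ i < γs - 2 * ε} ≤ ENNReal.ofReal (1 / 1000) := fun hlarge => by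
    -- From `2ε < E|f_U| ≤ √W`, the weight `W` inside `U` exceeds `4ε² ≥ c`. This is the only reason
    -- to restrict to large correlation.
    have hW : c ≤ ∑ S ∈ U.powerset, cubeCoeff f S ^ 2 := by
      have h1 := cubeMean_abs_juntaProj_le f U
      rw [← hγs, Real.le_sqrt hγ0 (sum_nonneg fun _ _ => sq_nonneg _)] at h1
      nlinarith
    have hqge := prob_coreSet_ge f hk hU hcpos.le hW
    rw [← hq, ← ENNReal.ofReal_pow hcpos.le] at hqge
    have hq0 : q ≠ 0 := by
      refine (lt_of_lt_of_le ?_ hqge).ne'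
      rw [ENNReal.ofReal_pos]
      positivity
    refine ⟨hq0, fun S hS => ?_⟩
    have hiter : ((iteration P k ε S).law f).prob {x | x < γs - 2 * ε} ≤
        ((coreSet n k).law f).prob
          {C | C ∈ goodCores f k U c ∧ U ∈ admissible k ε S C}ᶜ + s :=
      prob_iteration_lt_le f P k ε S h.eta_pos h.theta_pos h.N_pos h.copies_pos h.coeffNorm_pos U
        _ fun C hC => ⟨hC.2, by
          have h2 := (abs_le.mp (h.abs_cubeMean_idealEstimate_sub_le f hε hC.1.1
            (by have := hC.1.2; nlinarith))).1
          linarith⟩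
    set a := ((coreSet n k).law f).prob {C | C ∈ goodCores f k U c ∧ U ∈ admissible k ε S C} with ha
    have hatop : a ≠ ⊤ := ((PMF.prob_le_one _ _).trans_lt ENNReal.one_lt_top).ne
    -- Since the tests are not `incomplete`, less than half of the good-core probability is lost to
    -- inadmissibility.
    have hqa : q / 2 ≤ a := by
      have h1 : q ≤ a + ((coreSet n k).law f).prob
          {C | C ∈ goodCores f k U c ∧ U ∉ admissible k ε S C} := by
        refine (PMF.prob_mono _ fun C hC => ?_).trans (PMF.prob_union_le _ _ _)
        by_cases hadm : U ∈ admissible k ε S C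
        · exact Or.inl ⟨hC, hadm⟩
        · exact Or.inr ⟨hC, hadm⟩
      have h2 : ((coreSet n k).law f).prob
          {C | C ∈ goodCores f k U c ∧ U ∉ admissible k ε S C} < q / 2 :=
        not_le.mp fun hle => hS hle
      have h3 := h1.trans (add_le_add_right h2.le a)
      nth_rewrite 1 [← ENNReal.add_halves q] at h3
      exact (ENNReal.add_le_add_iff_right (ENNReal.div_ne_top hqtop (by norm_num))).mp h3
    have hcompl := PMF.prob_add_compl ((coreSet n k).law f)
      {C | C ∈ goodCores f k U c ∧ U ∈ admissible k ε S C}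
    rw [← ha] at hcompl
    set a' := ((coreSet n k).law f).prob
      {C | C ∈ goodCores f k U c ∧ U ∈ admissible k ε S C}ᶜ with ha'
    have ha'top : a' ≠ ⊤ := ((PMF.prob_le_one _ _).trans_lt ENNReal.one_lt_top).ne
    have hareal : c ^ rounds k / 2 ≤ a.toReal := by
      have h1 := ENNReal.toReal_mono hatop hqa
      rw [ENNReal.toReal_div, ENNReal.toReal_ofNat] at h1
      have h2 := (ENNReal.ofReal_le_iff_le_toReal hqtop).mp hqge
      linarith
    have hsum : a.toReal + a'.toReal = 1 := by
      rw [← ENNReal.toReal_add hatop ha'top, hcompl, ENNReal.toReal_one]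
    have hfail : a' + s ≤ ENNReal.ofReal
        (Real.exp (-(c ^ rounds k / 2) + 1 / (200 * P.loops))) := by
      calc a' + s ≤ ENNReal.ofReal a'.toReal + ENNReal.ofReal (1 / (200 * P.loops)) := by
            rw [ENNReal.ofReal_toReal ha'top]
            exact add_le_add_right h.sampling _
        _ = ENNReal.ofReal (a'.toReal + 1 / (200 * P.loops)) :=
            (ENNReal.ofReal_add ENNReal.toReal_nonneg (by positivity)).symm
        _ ≤ _ := by
            refine ENNReal.ofReal_le_ofReal ?_
            have := Real.add_one_le_exp (-(c ^ rounds k / 2) + 1 / (200 * P.loops))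
            linarith
    have hall := SampleAlg.prob_seqAll_forall f (fun _ : Fin P.loops => iteration P k ε S)
      fun _ => {x | x < γs - 2 * ε}
    refine hall.trans_le ?_
    rw [prod_const, card_univ, Fintype.card_fin]
    refine (pow_le_pow_left₀ zero_le (hiter.trans hfail) _).trans ?_
    rw [← ENNReal.ofReal_pow (Real.exp_pos _).le, ← Real.exp_nat_mul]
    refine ENNReal.ofReal_le_ofReal ?_
    have hl := h.loops
    rw [← hM, ← hc] at hl
    -- An iteration fails with probability at most `exp(-c^rounds/2 + 1/(200R))`. Since `R c^rounds
    -- ≥ 16`, all `R` fail with probability at most `exp(-8 + 1/200) ≤ e^{-7} ≤ 1/1000`.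
    have h1 : (P.loops : ℝ) * (-(c ^ rounds k / 2) + 1 / (200 * P.loops)) ≤ -7 := by
      have : (P.loops : ℝ) * (1 / (200 * P.loops)) = 1 / 200 := by field_simp
      rw [mul_add, this]
      linarith
    refine (Real.exp_le_exp.mpr h1).trans ?_
    have h6 : Real.exp (-7) = Real.exp (-1) ^ 7 := by rw [← Real.exp_nat_mul]; norm_num
    rw [h6]
    calc Real.exp (-1) ^ 7 ≤ 0.3678794412 ^ 7 := by
          have := Real.exp_neg_one_lt_d9
          gcongr
      _ ≤ _ := by norm_num
  -- combination
  have hsplit : ∀ γ : Fin P.loops → ℝ,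
      |(1 - univ.fold max 0 γ) / 2 - juntaDist k f| ≤ ε ∨ (∃ i, γs + 2 * ε < γ i) ∨
        (2 * ε < γs ∧ ∀ i, γ i < γs - 2 * ε) := fun γ => by
    by_contra hcon
    push Not at hcon
    obtain ⟨h1, h2, h3⟩ := hcon
    have hle : univ.fold max 0 γ ≤ γs + 2 * ε := by
      rw [fold_max_le]
      exact ⟨by positivity, fun i _ => h2 i⟩
    have hge : γs - 2 * ε ≤ univ.fold max 0 γ := by
      rw [le_fold_max]
      by_cases hl : 2 * ε < γs
      · obtain ⟨i, hi⟩ := h3 hl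
        exact Or.inr ⟨i, mem_univ _, hi⟩
      -- For correlation at most `2ε` the initial value `0` of the maximum already is close enough.
      · exact Or.inl (by linarith)
    refine h1.not_ge (abs_le.mpr ?_)
    rw [hdist]
    constructor <;> linarith
  set bad : Set (Fin M → Finset (Fin n)) := unsound ∪ {S | 2 * ε < γs ∧ S ∈ incomplete} with hbad
  have hbadle : ((tests n ε).law f).prob bad ≤ ENNReal.ofReal (1 / 100) + ENNReal.ofReal (1 / 500) := by
    refine (PMF.prob_union_le _ _ _).trans
      (add_le_add (prob_tests_unsound_le f hn hε hε2) ?_)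
    by_cases hl : 2 * ε < γs
    · refine (PMF.prob_mono _ fun S hS => hS.2).trans
        (prob_tests_incomplete_le f hU (le_of_eq ?_) (hlower hl).1)
      change (M : ℝ) * c = _
      rw [hc]
      field_simp
    · simp [hl, PMF.prob, PMF.expect]
  rw [law_distTester]
  refine (PMF.prob_bind_le_add _ _ _ bad
    (c := ENNReal.ofReal (5 / 1000) + ENNReal.ofReal (1 / 1000)) fun S hS => ?_).trans
    ((add_le_add_left hbadle _).trans ?_)
  · simp only [hbad, Set.mem_union, not_or] at hS
    rw [PMF.prob_bind_pure]
    refine (PMF.prob_mono _ (t := {γ | ∃ i, γs + 2 * ε < γ i} ∪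
      {γ | 2 * ε < γs ∧ ∀ i, γ i < γs - 2 * ε}) fun γ hγ => ?_).trans
      ((PMF.prob_union_le _ _ _).trans (add_le_add (hupper S hS.1) ?_))
    · exact (hsplit γ).resolve_left hγ
    · by_cases hl : 2 * ε < γs
      · exact (PMF.prob_mono _ fun γ hγ => hγ.2).trans ((hlower hl).2 S fun hi => hS.2 ⟨hl, hi⟩)
      · simp [hl, PMF.prob, PMF.expect]
  -- The failure probabilities `1/100 + 1/500 + 5/1000 + 1/1000` sum to `0.018`.
  · rw [← ENNReal.ofReal_add (by norm_num) (by norm_num),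
      ← ENNReal.ofReal_add (by norm_num) (by norm_num),
      ← ENNReal.ofReal_add (by norm_num) (by norm_num)]
    exact ENNReal.ofReal_le_ofReal (by norm_num)

/-- With suitable parameters the tester is correct. -/
lemma Suitable.le_prob {P : TesterParams} {n k : ℕ} {ε η θ : ℝ} (h : Suitable P n k ε η θ)
    (f : Cube n → ℤˣ) (hk : 1 ≤ k) (hkn : k ≤ n) (hε : 0 < ε) (hε2 : ε ≤ 1 / 2) :
    97 / 100 ≤ ((distTester P n k ε).law f).toOuterMeasure {d : ℝ | |d - juntaDist k f| ≤ ε} := by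
  obtain ⟨U, hU, hdist, hmax⟩ := exists_juntaDist_eq f hkn
  have h1 := prob_final_le f h hk (hk.trans hkn) hε hε2 hU hmax hdist
  rw [PMF.toOuterMeasure_eq_prob]
  have h2 := PMF.prob_add_compl ((distTester P n k ε).law f) {d : ℝ | |d - juntaDist k f| ≤ ε}
  have h3 : (97 / 100 : ℝ≥0∞) = 1 - ENNReal.ofReal (3 / 100) := by
    rw [← ENNReal.ofReal_one, ← ENNReal.ofReal_sub _ (by norm_num),
      show (1 - 3 / 100 : ℝ) = 97 / 100 by norm_num, ENNReal.ofReal_div_of_pos (by norm_num)]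
    norm_num
  rw [h3, tsub_le_iff_right, ← h2]
  exact add_le_add_right h1 _

end JuntaTester

/-! ### The choice of the parameters -/

namespace JuntaTester

lemma sum_range_pow_le (n r : ℕ) : ∑ i ∈ range (r + 1), n ^ i ≤ (n + 1) ^ r := by
  induction r with
  | zero => simp
  | succ r ih =>
    rw [sum_range_succ, pow_succ (n + 1), mul_add, mul_one, pow_succ n, add_comm]
    exact add_le_add (Nat.mul_le_mul_right _ (Nat.pow_le_pow_left (Nat.le_succ n) r)) ih

lemma sum_choose_le (n r : ℕ) : ∑ i ∈ range (r + 1), n.choose i ≤ (n + 1) ^ r :=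
  (sum_le_sum fun i _ => Nat.choose_le_pow n i).trans (sum_range_pow_le n r)

lemma card_ball_le (n r : ℕ) : Fintype.card {T : Finset (Fin n) // T.card ≤ r} ≤ (n + 1) ^ r := by
  rw [Fintype.card_subtype]
  have h : (univ.filter fun T : Finset (Fin n) => T.card ≤ r) ⊆
      (range (r + 1)).biUnion fun i => univ.powersetCard i := fun T hT => by
    simp only [mem_filter, mem_univ, true_and] at hT
    simp only [mem_biUnion, mem_range, mem_powersetCard, subset_univ, true_and]
    exact ⟨_, Nat.lt_succ_of_le hT, rfl⟩
  refine (card_le_card h).trans (card_biUnion_le.trans (le_trans (le_of_eq ?_) (sum_choose_le n r)))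
  simp

lemma localBound_le {n r : ℕ} {a : ℕ → ℝ} (ha : ∀ i, i ≤ r → |a i| ≤ 2 ^ r) :
    localBound n r a ≤ 2 ^ r * (n + 1) ^ r := by
  have h1 : ((∑ i ∈ range (r + 1), n.choose i : ℕ) : ℝ) ≤ (n + 1) ^ r := by
    exact_mod_cast sum_choose_le n r
  rw [sum_range_succ', range_eq_Ico, sum_Ico_add' (fun i => n.choose i) 0 r 1] at h1
  have e : Ico (0 + 1) (r + 1) = Icc 1 r := by ext; simp
  rw [e] at h1
  push_cast [Nat.choose_zero_right] at h1
  calc localBound n r a ≤ 2 ^ r + ∑ i ∈ Icc 1 r, 2 ^ r * (n.choose i : ℝ) := by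
        refine add_le_add (one_le_pow₀ (by norm_num)) (sum_le_sum fun i hi => ?_)
        exact mul_le_mul_of_nonneg_right (ha i (mem_Icc.mp hi).2) (Nat.cast_nonneg _)
    _ = 2 ^ r * (∑ i ∈ Icc 1 r, (n.choose i : ℝ) + 1) := by rw [← mul_sum]; ring
    _ ≤ _ := by gcongr

/-- The coefficients provided by `exists_flat_coefficients`. -/
noncomputable def flatCoeff (d s : ℕ) : ℕ → ℝ :=
  if h : 1 ≤ d ∧ s ≤ 2 * d then (exists_flat_coefficients d s h.1 h.2).choose else 0

lemma flatCoeff_spec {d s : ℕ} (hd : 1 ≤ d) (hs : s ≤ 2 * d) :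
    (∀ i, i ≤ s * d → |flatCoeff d s i| ≤ 2 ^ (s * d)) ∧
      ∀ m : ℕ, 1 ≤ m → m ≤ 2 * d ^ 2 + 1 →
        |1 - ∑ i ∈ Icc 1 (s * d), flatCoeff d s i * (m.choose i : ℝ)| ≤ (1 / 2) ^ s := by
  rw [flatCoeff, dif_pos ⟨hd, hs⟩]
  exact (exists_flat_coefficients d s hd hs).choose_spec

/-- The degree of the Chebyshev polynomial behind the flat polynomial. -/
def chebDegree (l b : ℕ) : ℕ := 2 * b * (8 * (l + 4))

/-- The radius of the local estimator. -/
def estRadius (l b : ℕ) : ℕ := (l + 4) * chebDegree l b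

/-- The exponent `Δ` of the sharp noise operator. -/
def noiseExponent (l b : ℕ) : ℕ := (1 + l) * estRadius l b + (l + 4)

/-- `2^{-w}` is the accuracy needed for the averages over the copies of a noisy point. -/
def precisionBits (l b : ℕ) : ℕ := (8 * (l + 4) + 2) * noiseExponent l b + (l + 4)

/-- The binary logarithm of the number of iterations. -/
def loopBits (l b : ℕ) : ℕ := (4 * l + 14) * b

/-- The binary logarithm of the number of sample points. -/
def pointBits (l b : ℕ) : ℕ := 2 * precisionBits l b + 1 + (l + (loopBits l b + 11))

/-- `2^{-unionBits}` bounds the failure probability of a single average over copies, as needed for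
the union bound over all averages and all iterations. -/
def unionBits (l b : ℕ) : ℕ :=
  pointBits l b + l * estRadius l b + 8 * (l + 4) * noiseExponent l b + 10 + loopBits l b

/-- The binary logarithm of the number of copies of a noisy point. -/
def copyBits (l b : ℕ) : ℕ := 2 * precisionBits l b + 3 + unionBits l b

/-- The parameters in terms of `l = ⌈log₂(n/ε)⌉` and `b = ⌈k^{1/3}⌉`. -/
noncomputable def params (l b : ℕ) : TesterParams where
  κ := 8 * (l + 4)
  Δ := noiseExponent l b
  r := estRadius l b
  flat := flatCoeff (chebDegree l b) (l + 4)
  N := 2 ^ pointBits l b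
  copies := 2 ^ copyBits l b
  loops := 2 ^ loopBits l b

/-- This is `Δ 2^{-κ} ≤ 2^{-(l+4)}`. There is no circularity although `Δ` depends on `κ`: with `X =
2^{l+4}`, `Δ` is at most `32 X^4`, while `2^κ = X^8`. -/
lemma noiseExponent_mul_le {l b : ℕ} (hl : 1 ≤ l) (hb : b ≤ 2 ^ l) :
    noiseExponent l b * 2 ^ (l + 4) ≤ 2 ^ (8 * (l + 4)) := by
  set u := l + 4 with hu
  have hlu : 1 + l ≤ u := by omega
  have hbu : b ≤ 2 ^ u := hb.trans (Nat.pow_le_pow_right (by norm_num) (by omega))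
  have hu2 : u ≤ 2 ^ u := Nat.lt_two_pow_self.le
  have h32 : 32 ≤ 2 ^ u := by
    calc 32 = 2 ^ 5 := by norm_num
      _ ≤ 2 ^ u := Nat.pow_le_pow_right (by norm_num) (by omega)
  set X := 2 ^ u with hX
  have h1 : noiseExponent l b ≤ 32 * X ^ 4 := by
    calc noiseExponent l b = (1 + l) * (u * (2 * b * (8 * u))) + u := rfl
      _ ≤ X * (X * (2 * X * (8 * X))) + X := by
          have := hlu.trans hu2
          gcongr
      _ ≤ 32 * X ^ 4 := by
          have : X ≤ X ^ 4 := Nat.le_self_pow (by norm_num) X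
          nlinarith
  calc noiseExponent l b * X ≤ 32 * X ^ 4 * X := Nat.mul_le_mul_right _ h1
    _ ≤ X * X ^ 4 * X := by gcongr
    _ = X ^ 6 := by ring
    _ ≤ X ^ 8 := Nat.pow_le_pow_right (by omega) (by norm_num)
    _ = 2 ^ (8 * u) := by rw [hX, ← pow_mul, mul_comm]

lemma half_pow_le {l : ℕ} {ε : ℝ} (hl : 1 / ε ≤ 2 ^ l) (hε : 0 < ε) :
    (1 / 2 : ℝ) ^ (l + 4) ≤ ε / 16 := by
  rw [one_div, inv_pow, pow_add]
  rw [div_le_iff₀ hε] at hl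
  rw [inv_le_comm₀ (by positivity) (by positivity), inv_div, div_le_iff₀ hε]
  linarith

lemma localBound_params_le {n l b : ℕ} (hn : n + 1 ≤ 2 ^ l) (hb1 : 1 ≤ b) :
    localBound n (params l b).r (params l b).flat ≤ 2 ^ ((1 + l) * estRadius l b) := by
  have hd : 1 ≤ chebDegree l b := by unfold chebDegree; nlinarith
  have hs : l + 4 ≤ 2 * chebDegree l b := by unfold chebDegree; nlinarith
  refine (localBound_le (flatCoeff_spec hd hs).1).trans ?_
  change (2 : ℝ) ^ estRadius l b * (n + 1) ^ estRadius l b ≤ _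
  rw [← mul_pow, pow_mul, pow_add, pow_one]
  have : (n : ℝ) + 1 ≤ 2 ^ l := by exact_mod_cast hn
  gcongr

/-- The two regimes meet at `d = 2ℓκ`. From there on the noise factor `2^{-Δ}` beats the growth
`2^{(1+l)r}` of the local factor, by the definition of `noiseExponent`. Below, `|S \ U|` lies in the
range where the Chebyshev polynomial is flat. -/
lemma smallBias_params {n k l : ℕ} {ε : ℝ} (hk : 1 ≤ k) (hkn : k ≤ n) (hε : 0 < ε) (hl1 : 1 ≤ l)
    (hn : n + 1 ≤ 2 ^ l) (hl : 1 / ε ≤ 2 ^ l) :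
    SmallBias (params l (rounds k)) n k (ε / 8) := by
  set b := rounds k with hb
  have hb1 : 1 ≤ b := rounds_pos hk
  have hbl : b ≤ 2 ^ l := (rounds_le hk).trans (by omega)
  have hd : 1 ≤ chebDegree l b := by unfold chebDegree; nlinarith
  have hs : l + 4 ≤ 2 * chebDegree l b := by unfold chebDegree; nlinarith
  have hδ : (1 / 2 : ℝ) ^ (l + 4) ≤ ε / 8 := (half_pow_le hl hε).trans (by linarith)
  constructor
  · intro d hd
    refine le_trans ?_ (sharpMultiplier_ge _ _ hk hd)
    change 1 - ε / 8 ≤ 1 - (noiseExponent l b : ℝ) * (1 / 2) ^ (8 * (l + 4))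
    have h1 : (noiseExponent l b : ℝ) * 2 ^ (l + 4) ≤ 2 ^ (8 * (l + 4)) := by
      exact_mod_cast noiseExponent_mul_le hl1 hbl
    have h2 : (noiseExponent l b : ℝ) * (1 / 2) ^ (8 * (l + 4)) ≤ (1 / 2) ^ (l + 4) := by
      rw [one_div_pow, one_div_pow, mul_one_div, div_le_div_iff₀ (by positivity) (by positivity),
        one_mul]
      exact h1
    linarith
  · intro d j hj1 hjd hdn
    rw [abs_mul]
    obtain ⟨hm0, hm1⟩ := sharpMultiplier_mem (params l b).κ (params l b).Δ k d
    rw [abs_of_nonneg hm0]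
    refine le_trans ?_ hδ
    rcases le_or_gt (2 * ell k * (8 * (l + 4))) d with hfar | hnear
    · have h1 : sharpMultiplier (params l b).κ (params l b).Δ k d ≤ (1 / 2) ^ noiseExponent l b :=
        sharpMultiplier_le _ _ hk (show 1 ≤ 8 * (l + 4) by omega) hfar
      have h2 : |1 - ∑ i ∈ Icc 1 (params l b).r, (params l b).flat i * (j.choose i : ℝ)| ≤
          2 ^ ((1 + l) * estRadius l b) := by
        refine le_trans ?_ (localBound_params_le hn hb1)
        refine (abs_sub _ _).trans (add_le_add (by simp)
          ((abs_sum_le_sum_abs _ _).trans (sum_le_sum fun i _ => ?_)))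
        rw [abs_mul, Nat.abs_cast]
        refine mul_le_mul_of_nonneg_left ?_ (abs_nonneg _)
        exact_mod_cast Nat.choose_le_choose i (hjd.trans hdn)
      calc _ ≤ (1 / 2 : ℝ) ^ noiseExponent l b * 2 ^ ((1 + l) * estRadius l b) :=
            mul_le_mul h1 h2 (abs_nonneg _) (by positivity)
        _ = (1 / 2) ^ (l + 4) := by
            rw [noiseExponent, pow_add, mul_right_comm, ← mul_pow]
            norm_num
    · have h1 : j ≤ 2 * chebDegree l b ^ 2 + 1 := by
        have h2 := ell_le_rounds_sq k
        rw [← hb] at h2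
        have h3 : j ≤ 2 * b ^ 2 * (8 * (l + 4)) :=
          (hjd.trans hnear.le).trans (by gcongr)
        -- The Chebyshev degree is `2bκ`, so its flat range `2 (2bκ)² + 1` covers `2b²κ ≥ 2ℓκ`.
        refine h3.trans ?_
        unfold chebDegree
        have h4 : 8 * (l + 4) ≤ (8 * (l + 4)) ^ 2 := Nat.le_self_pow (by norm_num) _
        calc 2 * b ^ 2 * (8 * (l + 4)) ≤ 2 * b ^ 2 * (8 * (l + 4)) ^ 2 := by gcongr
          _ ≤ 2 * (2 * b * (8 * (l + 4))) ^ 2 + 1 := by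
              have : 2 * (2 * b * (8 * (l + 4))) ^ 2 = 4 * (2 * b ^ 2 * (8 * (l + 4)) ^ 2) := by ring
              omega
      calc _ ≤ 1 * (1 / 2 : ℝ) ^ (l + 4) :=
            mul_le_mul hm1 ((flatCoeff_spec hd hs).2 j hj1 h1) (abs_nonneg _) zero_le_one
        _ = _ := one_mul _

lemma exp_neg_natCast_le (m : ℕ) : Real.exp (-(m : ℝ)) ≤ (1 / 2) ^ m := by
  have h : Real.exp (-(m : ℝ)) = Real.exp (-1) ^ m := by rw [← Real.exp_nat_mul]; ring_nf
  rw [h]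
  have := Real.exp_neg_one_lt_d9
  exact pow_le_pow_left₀ (Real.exp_pos _).le (by linarith) m

/-- The polynomial has value `1` at `X = 1` because `κ > 0`, so its coefficients sum to `1`. -/
lemma coeffNorm_params_pos (l b : ℕ) : 0 < coeffNorm (params l b) := by
  have h := sum_sharpNoiseCoeff (params l b).κ (params l b).Δ 1
  have h0 : (1 - (1 - 1 : ℝ) ^ (params l b).κ) ^ (params l b).Δ = 1 := by
    change (1 - (1 - 1 : ℝ) ^ (8 * (l + 4))) ^ _ = 1
    rw [sub_self, zero_pow (by omega), sub_zero, one_pow]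
  rw [h0] at h
  simp only [one_pow, mul_one] at h
  have h2 := abs_sum_le_sum_abs (fun j : Fin ((params l b).κ * (params l b).Δ + 1) =>
    sharpNoiseCoeff (params l b).κ (params l b).Δ j) univ
  rw [h, abs_one] at h2
  exact lt_of_lt_of_le one_pos h2

/-- This explains `precisionBits`: one `Δ` covers the local estimator, `(κ + 1) Δ` covers the noise
coefficients, and `l + 4` bits remain as accuracy. -/
lemma localBound_mul_coeffNorm_le {n l b : ℕ} (hn : n + 1 ≤ 2 ^ l) (hb1 : 1 ≤ b) :
    localBound n (params l b).r (params l b).flat * coeffNorm (params l b) * 2 ^ (l + 4) ≤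
      2 ^ precisionBits l b := by
  have h1 := localBound_params_le hn hb1
  have h2 : coeffNorm (params l b) ≤ 2 ^ ((8 * (l + 4) + 1) * noiseExponent l b) :=
    sum_abs_sharpNoiseCoeff_le _ _
  have h3 : (2 : ℝ) ^ ((1 + l) * estRadius l b) ≤ 2 ^ noiseExponent l b :=
    pow_le_pow_right₀ (by norm_num) (by unfold noiseExponent; omega)
  calc _ ≤ (2 : ℝ) ^ noiseExponent l b * 2 ^ ((8 * (l + 4) + 1) * noiseExponent l b) *
        2 ^ (l + 4) := by
        gcongr
        · exact coeffNorm_nonneg _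
        · exact h1.trans h3
    _ = 2 ^ precisionBits l b := by
        rw [← pow_add, ← pow_add, precisionBits]
        congr 1
        ring

lemma card_ball_le_two_pow {n l : ℕ} (hn : n + 1 ≤ 2 ^ l) (r : ℕ) :
    Fintype.card {T : Finset (Fin n) // T.card ≤ r} ≤ 2 ^ (l * r) := by
  refine (card_ball_le n r).trans ?_
  rw [pow_mul]
  exact Nat.pow_le_pow_left hn r

lemma two_mul_ofReal {x : ℝ} : 2 * ENNReal.ofReal x = ENNReal.ofReal (2 * x) := by
  rw [ENNReal.ofReal_mul (by norm_num), ENNReal.ofReal_ofNat]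

/-- The `2w + 1` bits cancel the variance term and the remaining ones make the exponent at least
`2^l * 2^(m+11) ≥ n + m + 10`, enough to absorb the `2^n` sets `U` and leave `2^{-m}/512`. -/
lemma two_pow_mul_exp_neg_le {n l m u w : ℕ} {B : ℝ} (hn : n + 1 ≤ 2 ^ l) (hB0 : 0 < B)
    (hB : B * 2 ^ u ≤ 2 ^ w) :
    (2 : ℝ) ^ n * (2 * Real.exp (-(2 ^ (2 * w + 1 + (l + (m + 11))) * ((1 / 2) ^ u) ^ 2 /
      (2 * B ^ 2)))) ≤ 1 / (512 * 2 ^ m) := by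
  have h1 : ((n + m + 10 : ℕ) : ℝ) ≤
      2 ^ (2 * w + 1 + (l + (m + 11))) * ((1 / 2) ^ u) ^ 2 / (2 * B ^ 2) := by
    have h3 : m + 11 ≤ 2 ^ (m + 11) := Nat.lt_two_pow_self.le
    have h4 : n + m + 10 ≤ 2 ^ l * 2 ^ (m + 11) := by
      have h5 : m + 11 ≤ 2 ^ l * (m + 11) := Nat.le_mul_of_pos_left _ (by positivity)
      have h6 : 2 ^ l * 1 + (m + 10) ≤ 2 ^ l * (m + 11) := by
        rw [← add_assoc m 10 1, mul_add]
        have : m + 10 ≤ 2 ^ l * (m + 10) := Nat.le_mul_of_pos_left _ (by positivity)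
        omega
      have h7 : 2 ^ l * (m + 11) ≤ 2 ^ l * 2 ^ (m + 11) := Nat.mul_le_mul_left _ h3
      omega
    have h4' : ((n + m + 10 : ℕ) : ℝ) ≤ 2 ^ l * 2 ^ (m + 11) := by exact_mod_cast h4
    have h5 : B ^ 2 * (2 ^ u) ^ 2 ≤ (2 ^ w) ^ 2 := by
      rw [← mul_pow]
      exact pow_le_pow_left₀ (by positivity) hB 2
    rw [le_div_iff₀ (by positivity), one_div, inv_pow, inv_pow, ← div_eq_mul_inv,
      le_div_iff₀ (by positivity)]
    calc ((n + m + 10 : ℕ) : ℝ) * (2 * B ^ 2) * (2 ^ u) ^ 2 =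
        2 * (B ^ 2 * (2 ^ u) ^ 2) * ((n + m + 10 : ℕ) : ℝ) := by ring
      _ ≤ 2 * (2 ^ w) ^ 2 * (2 ^ l * 2 ^ (m + 11)) :=
          mul_le_mul (by linarith) h4' (Nat.cast_nonneg _) (by positivity)
      _ = 2 ^ (2 * w + 1 + (l + (m + 11))) := by ring
  have h2 := (Real.exp_le_exp.mpr (neg_le_neg h1)).trans (exp_neg_natCast_le (n + m + 10))
  refine (mul_le_mul_of_nonneg_left (mul_le_mul_of_nonneg_left h2 (by norm_num))
    (by positivity)).trans (le_of_eq ?_)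
  rw [one_div_pow, pow_add, pow_add]
  field_simp
  norm_num

/-- The `2w` bits cancel `η²`, three bits cancel the `8`, and the remaining `2^m` exceeds `m`. -/
lemma exp_neg_copies_le (w m : ℕ) :
    Real.exp (-(2 ^ (2 * w + 3 + m) * ((1 / 2) ^ w) ^ 2 / 8)) ≤ (1 / 2) ^ m := by
  have h1 : (m : ℝ) ≤ 2 ^ (2 * w + 3 + m) * ((1 / 2) ^ w) ^ 2 / 8 := by
    have hm2 : (m : ℝ) ≤ 2 ^ m := by exact_mod_cast Nat.lt_two_pow_self.le
    refine hm2.trans (le_of_eq ?_)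
    rw [one_div, inv_pow, pow_add, pow_add, pow_mul']
    field_simp
    norm_num
  exact (Real.exp_le_exp.mpr (neg_le_neg h1)).trans (exp_neg_natCast_le m)

lemma two_pow_union_eq (N A D R : ℕ) :
    (2 : ℝ) ^ N * (2 ^ A * 2 ^ D * (2 * (1 / 2) ^ (N + A + D + 10 + R))) = 1 / (512 * 2 ^ R) := by
  rw [one_div_pow, pow_add, pow_add, pow_add, pow_add]
  field_simp
  norm_num

lemma samplingError_params_le {n l b : ℕ} (hn : n + 1 ≤ 2 ^ l) (hb1 : 1 ≤ b) :
    samplingError (params l b) n ((1 / 2) ^ precisionBits l b) ((1 / 2) ^ (l + 4)) ≤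
      ENNReal.ofReal (1 / (200 * ((params l b).loops : ℝ))) := by
  have hR : ((params l b).loops : ℝ) = 2 ^ loopBits l b := Nat.cast_pow 2 _
  have hN : ((params l b).N : ℝ) = 2 ^ pointBits l b := Nat.cast_pow 2 _
  have hC : ((params l b).copies : ℝ) = 2 ^ copyBits l b := Nat.cast_pow 2 _
  -- The allowance is split evenly between sample points and copies; each part is in fact at most
  -- `1/(512 R)`.
  have e400 : (1 : ℝ) / (200 * 2 ^ loopBits l b) =
      1 / (400 * 2 ^ loopBits l b) + 1 / (400 * 2 ^ loopBits l b) := by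
    field_simp
    norm_num
  have h512 : (1 : ℝ) / (512 * 2 ^ loopBits l b) ≤ 1 / (400 * 2 ^ loopBits l b) :=
    one_div_le_one_div_of_le (by positivity)
      (mul_le_mul_of_nonneg_right (by norm_num) (by positivity))
  rw [hR, e400, ENNReal.ofReal_add (by positivity) (by positivity), samplingError]
  refine add_le_add ?_ ?_
  · have h := two_pow_mul_exp_neg_le (m := loopBits l b) hn
      (mul_pos (localBound_pos _ _) (coeffNorm_params_pos l b)) (localBound_mul_coeffNorm_le hn hb1)
    have e2 : (2 : ℝ≥0∞) ^ n = ENNReal.ofReal (2 ^ n) := by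
      rw [ENNReal.ofReal_pow (by norm_num), ENNReal.ofReal_ofNat]
    rw [two_mul_ofReal, e2, ← ENNReal.ofReal_mul (by positivity), hN, pointBits]
    exact ENNReal.ofReal_le_ofReal (h.trans h512)
  · rw [two_mul_ofReal, ← ENNReal.ofReal_natCast, ← ENNReal.ofReal_natCast,
      ← ENNReal.ofReal_mul (Nat.cast_nonneg _), ← ENNReal.ofReal_mul (Nat.cast_nonneg _)]
    refine ENNReal.ofReal_le_ofReal (le_trans ?_ h512)
    have h3 : ((Fintype.card {T : Finset (Fin n) // T.card ≤ (params l b).r} *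
        ((params l b).κ * (params l b).Δ + 1) : ℕ) : ℝ) ≤
        2 ^ (l * estRadius l b) * 2 ^ (8 * (l + 4) * noiseExponent l b) := by
      have h4 := Nat.mul_le_mul (card_ball_le_two_pow hn (params l b).r)
        (Nat.succ_le_of_lt (Nat.lt_two_pow_self (n := (params l b).κ * (params l b).Δ)))
      exact_mod_cast h4
    have h2 := exp_neg_copies_le (precisionBits l b) (unionBits l b)
    rw [hN, hC, copyBits]
    refine le_trans ?_ (two_pow_union_eq (pointBits l b) (l * estRadius l b)
      (8 * (l + 4) * noiseExponent l b) (loopBits l b)).le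
    exact mul_le_mul_of_nonneg_left (mul_le_mul h3 (mul_le_mul_of_nonneg_left h2 (by norm_num))
      (by positivity) (by positivity)) (by positivity)

lemma testDraws_le {n l : ℕ} {ε : ℝ} (hε : 0 < ε) (hl : (n : ℝ) / ε ≤ 2 ^ l) :
    testDraws n ε ≤ 2 ^ (4 * l) := by
  refine Nat.ceil_le.mpr ?_
  push_cast
  rw [pow_mul']
  exact pow_le_pow_left₀ (by positivity) hl 4

lemma suitable_params {n k l : ℕ} {ε : ℝ} (hk : 1 ≤ k) (hkn : k ≤ n) (hε : 0 < ε)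
    (hε2 : ε ≤ 1 / 2) (hl : (n : ℝ) / ε ≤ 2 ^ l) :
    Suitable (params l (rounds k)) n k ε ((1 / 2) ^ precisionBits l (rounds k))
      ((1 / 2) ^ (l + 4)) := by
  set b := rounds k with hb
  have hb1 : 1 ≤ b := rounds_pos hk
  have hn1 : (1 : ℝ) ≤ n := by exact_mod_cast hk.trans hkn
  have hn : n + 1 ≤ 2 ^ l := by
    have h1 : (n : ℝ) + 1 ≤ n / ε := by
      rw [le_div_iff₀ hε]
      nlinarith
    exact_mod_cast h1.trans hl
  have hl1 : 1 ≤ l := by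
    by_contra h0
    have h0' : l = 0 := by omega
    subst h0'
    have : 1 ≤ n := hk.trans hkn
    simp at hn
    omega
  have hεl : 1 / ε ≤ 2 ^ l := le_trans (by gcongr) hl
  have hM0 : (0 : ℝ) < testDraws n ε :=
    lt_of_lt_of_le (by positivity : (0 : ℝ) < ((n : ℝ) / ε) ^ 4) (le_testDraws n ε)
  refine ⟨smallBias_params hk hkn hε hl1 hn hεl, by positivity, by positivity, ?_,
    Nat.pos_of_ne_zero (by simp [params]), Nat.pos_of_ne_zero (by simp [params]),
    coeffNorm_params_pos l b, samplingError_params_le hn hb1, ?_⟩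
  · have h1 := localBound_mul_coeffNorm_le hn hb1
    have h2 := half_pow_le hεl hε
    have h3 : localBound n (params l b).r (params l b).flat *
        (coeffNorm (params l b) * (1 / 2) ^ precisionBits l b) ≤ (1 / 2) ^ (l + 4) := by
      rw [← mul_assoc, one_div_pow, one_div_pow, mul_one_div,
        div_le_div_iff₀ (by positivity) (by positivity), one_mul]
      exact h1
    linarith
  -- The number of iterations is `2^{(4l+14)b} = (2^{4l+10})^b * 16^b`. The first factor pays for
  -- `(1000 M)^b`, using `1000 ≤ 2^10`; the second supplies the required `16`.
  · have hM : 1000 * (testDraws n ε : ℝ) ≤ 2 ^ (4 * l + 10) := by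
      have h1 : (testDraws n ε : ℝ) ≤ 2 ^ (4 * l) := by exact_mod_cast testDraws_le hε hl
      rw [pow_add]
      nlinarith
    have hR : ((params l b).loops : ℝ) = (2 ^ (4 * l + 10)) ^ b * 16 ^ b := by
      change ((2 ^ loopBits l b : ℕ) : ℝ) = _
      rw [loopBits, ← mul_pow]
      push_cast
      rw [pow_mul, show 4 * l + 14 = 4 * l + 10 + 4 by ring, pow_add _ _ 4]
      norm_num
    rw [hR]
    have h2 : (1 / 2 ^ (4 * l + 10) : ℝ) ^ b ≤ (1 / (1000 * (testDraws n ε : ℝ))) ^ b :=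
      pow_le_pow_left₀ (by positivity) (one_div_le_one_div_of_le (by positivity) hM) b
    calc (16 : ℝ) = 16 ^ 1 := by norm_num
      _ ≤ 16 ^ b := pow_le_pow_right₀ (by norm_num) hb1
      _ = (2 ^ (4 * l + 10)) ^ b * 16 ^ b * (1 / 2 ^ (4 * l + 10)) ^ b := by
          rw [one_div_pow]
          field_simp
      _ ≤ _ := by gcongr

end JuntaTester

/-! ### The number of oracle calls -/

namespace JuntaTester

variable {n : ℕ}

lemma cost_noisyPoint_le (ρ : I) (V : Finset (Fin n)) (y : Cube n) :
    (noisyPoint ρ V y).cost ≤ 0 := by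
  refine (SampleAlg.cost_seqAll_le _ (c := 0) fun i => ?_).trans (by simp)
  split_ifs <;> simp [SampleAlg.cost]

lemma cost_queryBundle_le (P : TesterParams) (k : ℕ) (C : Finset (Fin n)) (x : Cube n) :
    (queryBundle P k C x).cost ≤ Fintype.card (BundleIndex n P) := by
  refine (SampleAlg.cost_seqAll_le _ (c := 1) fun b => ?_).trans (by simp)
  refine (SampleAlg.cost_bind_le _ _ (c := 1) fun z => by simp [SampleAlg.cost]).trans ?_
  exact (add_le_add_left (cost_noisyPoint_le _ _ _) _).trans (by simp)

lemma cost_iteration_le (P : TesterParams) (k : ℕ) (ε : ℝ)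
    (S : Fin (testDraws n ε) → Finset (Fin n)) :
    (iteration P k ε S).cost ≤ (rounds k + P.N * Fintype.card (BundleIndex n P) : ℕ) := by
  rw [iteration]
  push_cast
  refine (SampleAlg.cost_bind_le _ _ (c := P.N * Fintype.card (BundleIndex n P))
    fun A => ?_).trans (add_le_add_left ?_ _)
  · refine (SampleAlg.cost_bind_le _ _ (c := P.N * Fintype.card (BundleIndex n P))
      fun x => ?_).trans ?_
    · refine (SampleAlg.cost_bind_le _ _ (c := 0) fun B => le_rfl).trans ?_
      rw [add_zero]
      exact (SampleAlg.cost_seqAll_le _ fun j => cost_queryBundle_le P k _ (x j)).trans (by simp)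
    · refine (add_le_add_left (SampleAlg.cost_seqAll_le _ (c := 0) fun _ => ?_) _).trans (by simp)
      simp [SampleAlg.cost]
  · refine (SampleAlg.cost_seqAll_le _ (c := 1) fun _ => ?_).trans (by simp)
    simp [SampleAlg.cost]

lemma cost_distTester_le (P : TesterParams) (k : ℕ) (ε : ℝ) :
    (distTester P n k ε).cost ≤ (testDraws n ε +
      P.loops * (rounds k + P.N * Fintype.card (BundleIndex n P)) : ℕ) := by
  rw [distTester]
  refine (SampleAlg.cost_bind_le _ _ (c := 0) fun γ => le_rfl).trans ?_
  rw [add_zero, corrTester, Nat.cast_add, Nat.cast_mul]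
  refine (SampleAlg.cost_bind_le _ _
    (c := P.loops * (rounds k + P.N * Fintype.card (BundleIndex n P) : ℕ)) fun S => ?_).trans
    (add_le_add_left ?_ _)
  · refine (SampleAlg.cost_bind_le _ _ (c := 0) fun γ => le_rfl).trans ?_
    rw [add_zero]
    exact (SampleAlg.cost_seqAll_le _ fun _ => cost_iteration_le P k ε S).trans (by simp)
  · refine (SampleAlg.cost_seqAll_le _ (c := 1) fun _ => ?_).trans (by simp)
    simp [SampleAlg.cost]

/-- The binary logarithm of a bound for the total number of oracle calls. -/
def costBits (l b : ℕ) : ℕ :=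
  4 * l + (loopBits l b + (b + (pointBits l b +
    (l * estRadius l b + 8 * (l + 4) * noiseExponent l b + copyBits l b)) + 1)) + 1

lemma two_pow_add_le (x y : ℕ) : 2 ^ x + 2 ^ y ≤ 2 ^ (x + y + 1) := by
  rw [pow_succ, mul_two]
  exact add_le_add (Nat.pow_le_pow_right (by norm_num) (by omega))
    (Nat.pow_le_pow_right (by norm_num) (by omega))

lemma total_le_two_pow_costBits {k l : ℕ} {ε : ℝ} (hn : n + 1 ≤ 2 ^ l) (hε : 0 < ε)
    (hl : (n : ℝ) / ε ≤ 2 ^ l) :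
    testDraws n ε + (params l (rounds k)).loops * (rounds k + (params l (rounds k)).N *
      Fintype.card (BundleIndex n (params l (rounds k)))) ≤ 2 ^ costBits l (rounds k) := by
  set b := rounds k with hb
  have h1 := testDraws_le hε hl
  have h2 : Fintype.card (BundleIndex n (params l b)) ≤
      2 ^ (l * estRadius l b + 8 * (l + 4) * noiseExponent l b + copyBits l b) := by
    rw [Fintype.card_prod, Fintype.card_prod, Fintype.card_fin, Fintype.card_fin, ← mul_assoc,
      pow_add, pow_add]
    exact Nat.mul_le_mul_right _ (Nat.mul_le_mul (card_ball_le_two_pow hn _)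
      (Nat.succ_le_of_lt Nat.lt_two_pow_self))
  have h3 : b ≤ 2 ^ b := Nat.lt_two_pow_self.le
  set e := l * estRadius l b + 8 * (l + 4) * noiseExponent l b + copyBits l b with he
  have h4 : b + (params l b).N * Fintype.card (BundleIndex n (params l b)) ≤
      2 ^ (b + (pointBits l b + e) + 1) := by
    refine le_trans (add_le_add h3 ?_) (two_pow_add_le b (pointBits l b + e))
    rw [pow_add]
    exact Nat.mul_le_mul_left _ h2
  refine le_trans (add_le_add h1 ?_) (two_pow_add_le (4 * l) _)
  rw [pow_add]
  exact Nat.mul_le_mul_left _ h4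

/-- The Chebyshev degree, the radius, `Δ` and the precision are of order `b l`, `b l²`, `b l³` and
`b l⁴`; the remaining terms are no larger. -/
lemma exists_costBits_le : ∃ K : ℕ, ∀ l b, 1 ≤ l → 1 ≤ b → costBits l b ≤ K * b * l ^ 4 := by
  suffices h : ∃ K : ℕ, ∀ l b, costBits (l + 1) (b + 1) ≤ K * (b + 1) * (l + 1) ^ 4 by
    obtain ⟨K, hK⟩ := h
    refine ⟨K, fun l b hl hb => ?_⟩
    obtain ⟨l, rfl⟩ := Nat.exists_eq_add_of_le' hl
    obtain ⟨b, rfl⟩ := Nat.exists_eq_add_of_le' hb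
    exact hK l b
  -- Shifting both variables by one turns the claim into a comparison of polynomials with
  -- nonnegative coefficients, which `omega` performs monomial by monomial. The constant is
  -- generous.
  refine ⟨10 ^ 7, fun l b => ?_⟩
  simp only [costBits, copyBits, unionBits, pointBits, loopBits, precisionBits, noiseExponent,
    estRadius, chebDegree]
  ring_nf
  omega

/-- `⌈log₂(n/ε)⌉`. -/
noncomputable def inputBits (n : ℕ) (ε : ℝ) : ℕ := ⌈Real.logb 2 ((n : ℝ) / ε)⌉₊

lemma div_le_two_pow_inputBits {ε : ℝ} (hn : 1 ≤ n) (hε : 0 < ε) :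
    (n : ℝ) / ε ≤ 2 ^ inputBits n ε := by
  have hn' : (0 : ℝ) < n := by exact_mod_cast hn
  rw [← Real.rpow_natCast, ← Real.logb_le_iff_le_rpow (by norm_num) (by positivity)]
  exact Nat.le_ceil _

lemma natCast_add_one_le_div {ε : ℝ} (hn : 1 ≤ n) (hε : 0 < ε) (hε2 : ε ≤ 1 / 2) :
    (n : ℝ) + 1 ≤ n / ε := by
  have hn' : (1 : ℝ) ≤ n := by exact_mod_cast hn
  rw [le_div_iff₀ hε]
  nlinarith

lemma one_le_logb_div {k : ℕ} {ε : ℝ} (hk : 1 ≤ k) (hε : 0 < ε) (hε2 : ε ≤ 1 / 2) :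
    1 ≤ Real.logb 2 ((k : ℝ) / ε) := by
  have hk' : (1 : ℝ) ≤ k := by exact_mod_cast hk
  rw [Real.le_logb_iff_rpow_le (by norm_num) (by positivity), Real.rpow_one]
  linarith [natCast_add_one_le_div hk hε hε2]

/-- Since `1/ε ≤ k/ε`, the polynomial bound on `n` gives `n/ε ≤ (k/ε)^{c+1}`. Rounding up costs at
most `1`, which the logarithm of `k/ε` dominates as it is at least `1`. -/
lemma inputBits_le {k c : ℕ} {ε : ℝ} (hk : 1 ≤ k) (hkn : k ≤ n) (hε : 0 < ε) (hε2 : ε ≤ 1 / 2)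
    (hnc : (n : ℝ) ≤ ((k : ℝ) / ε) ^ c) :
    (inputBits n ε : ℝ) ≤ (c + 2) * Real.logb 2 ((k : ℝ) / ε) := by
  have hL := one_le_logb_div hk hε hε2
  have hk' : (1 : ℝ) ≤ k := by exact_mod_cast hk
  have hn' : (1 : ℝ) ≤ n := by exact_mod_cast hk.trans hkn
  have h1 : (n : ℝ) / ε ≤ ((k : ℝ) / ε) ^ (c + 1) := by
    rw [pow_succ]
    calc (n : ℝ) / ε = n * (1 / ε) := by ring
      _ ≤ ((k : ℝ) / ε) ^ c * ((k : ℝ) / ε) := by gcongr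
  have h2 : Real.logb 2 ((n : ℝ) / ε) ≤ (c + 1) * Real.logb 2 ((k : ℝ) / ε) := by
    refine (Real.logb_le_logb_of_le (by norm_num) (by positivity) h1).trans (le_of_eq ?_)
    rw [Real.logb_pow]
    push_cast
    rfl
  have h3 : 0 ≤ Real.logb 2 ((n : ℝ) / ε) :=
    Real.logb_nonneg (by norm_num)
      (by linarith [natCast_add_one_le_div (hk.trans hkn) hε hε2])
  have h4 := Nat.ceil_lt_add_one h3
  rw [inputBits]
  linarith

lemma rounds_le_two_mul {k : ℕ} (hk : 1 ≤ k) : (rounds k : ℝ) ≤ 2 * (k : ℝ) ^ ((1 : ℝ) / 3) := by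
  have hk' : (1 : ℝ) ≤ k := by exact_mod_cast hk
  have h1 : 1 ≤ (k : ℝ) ^ ((1 : ℝ) / 3) := Real.one_le_rpow hk' (by norm_num)
  have h2 := Nat.ceil_lt_add_one (by positivity : 0 ≤ (k : ℝ) ^ ((1 : ℝ) / 3))
  rw [rounds]
  linarith

lemma exists_costBits_inputBits_le (c : ℕ) : ∃ C : ℕ, ∀ (k n : ℕ) (ε : ℝ), 1 ≤ k → k ≤ n → 0 < ε →
    ε ≤ 1 / 2 → (n : ℝ) ≤ ((k : ℝ) / ε) ^ c →
    (costBits (inputBits n ε) (rounds k) : ℝ) ≤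
      (k : ℝ) ^ ((1 : ℝ) / 3) * (C * Real.logb 2 ((k : ℝ) / ε)) ^ C := by
  obtain ⟨K, hK⟩ := exists_costBits_le
  -- The same constant serves as factor and as exponent: it exceeds `2K(c+2)^4`, the product of the
  -- bounds for `rounds` and `inputBits`, and it is at least `4`, the degree in `l`.
  refine ⟨2 * K * (c + 2) ^ 4 + 4, fun k n ε hk hkn hε hε2 hnc => ?_⟩
  set L := Real.logb 2 ((k : ℝ) / ε) with hLdef
  have hL : 1 ≤ L := one_le_logb_div hk hε hε2
  have hl := inputBits_le hk hkn hε hε2 hnc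
  have hl1 : 1 ≤ inputBits n ε := by
    refine Nat.one_le_ceil_iff.mpr (Real.logb_pos (by norm_num) ?_)
    have hn' : (1 : ℝ) ≤ n := by exact_mod_cast hk.trans hkn
    linarith [natCast_add_one_le_div (hk.trans hkn) hε hε2]
  have h1 : (costBits (inputBits n ε) (rounds k) : ℝ) ≤ K * rounds k * (inputBits n ε : ℝ) ^ 4 := by
    exact_mod_cast hK _ _ hl1 (rounds_pos hk)
  set C : ℕ := 2 * K * (c + 2) ^ 4 + 4 with hC
  have hCK : (2 * K * (c + 2) ^ 4 : ℝ) ≤ C := by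
    rw [hC]
    push_cast
    linarith
  have hC4 : (4 : ℝ) ≤ C := by
    rw [hC]
    push_cast
    have : (0 : ℝ) ≤ 2 * K * (c + 2) ^ 4 := by positivity
    linarith
  calc (costBits (inputBits n ε) (rounds k) : ℝ) ≤ K * rounds k * (inputBits n ε : ℝ) ^ 4 := h1
    _ ≤ K * (2 * (k : ℝ) ^ ((1 : ℝ) / 3)) * ((c + 2) * L) ^ 4 := by
        have := rounds_le_two_mul hk
        gcongr
    _ = (k : ℝ) ^ ((1 : ℝ) / 3) * (2 * K * (c + 2) ^ 4 * L ^ 4) := by ring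
    _ ≤ (k : ℝ) ^ ((1 : ℝ) / 3) * (C * L) ^ C := by
        refine mul_le_mul_of_nonneg_left ?_ (by positivity)
        calc (2 * K * (c + 2) ^ 4 * L ^ 4 : ℝ) ≤ (C : ℝ) ^ 4 * L ^ 4 := by
              refine mul_le_mul_of_nonneg_right (hCK.trans ?_) (by positivity)
              exact le_self_pow₀ (by linarith) (by norm_num)
          _ = (C * L) ^ 4 := (mul_pow _ _ _).symm
          _ ≤ (C * L) ^ C := pow_le_pow_right₀ (by nlinarith) (by omega)

end JuntaTester

end

/-- With suitable parameters (depending on `k`, the number `n` of variables and `ε` only), the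
tester estimates `dist(f, J_k)` within `±ε` with probability at least `97/100`, both as a classical
algorithm with spectral-sample draws and as a quantum query algorithm; for `n ≤ poly(k, 1/ε)` it
makes at most `2^{k^{1/3} polylog(k, 1/ε)}` queries. -/
theorem theorem2 :
    ∃ P : ℕ → ℕ → ℝ → TesterParams,
      (∀ (k n : ℕ) (ε : ℝ) (f : Cube n → ℤˣ), 1 ≤ k → k ≤ n → 0 < ε → ε ≤ 1 / 2 →
        97 / 100 ≤ ((JuntaTester.distTester (P k n ε) n k ε).law f).toOuterMeasure
            {d : ℝ | |d - juntaDist k f| ≤ ε} ∧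
        97 / 100 ≤ ((JuntaTester.distTester (P k n ε) n k ε).toQuantum.law f).toOuterMeasure
            {d : ℝ | |d - juntaDist k f| ≤ ε}) ∧
      (∀ c : ℕ, ∃ C : ℕ, ∀ (k n : ℕ) (ε : ℝ), 1 ≤ k → k ≤ n → 0 < ε → ε ≤ 1 / 2 →
        (n : ℝ) ≤ ((k : ℝ) / ε) ^ c →
        ∃ q : ℕ,
          (JuntaTester.distTester (P k n ε) n k ε).cost ≤ (q : ℕ∞) ∧
          (JuntaTester.distTester (P k n ε) n k ε).toQuantum.queries ≤ (q : ℕ∞) ∧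
          (q : ℝ) ≤
            (2 : ℝ) ^ ((k : ℝ) ^ ((1 : ℝ) / 3) * (C * Real.logb 2 ((k : ℝ) / ε)) ^ C)) := by
  refine ⟨fun k n ε => JuntaTester.params (JuntaTester.inputBits n ε) (JuntaTester.rounds k),
    fun k n ε f hk hkn hε hε2 => ?_, fun c => ?_⟩
  · have h := JuntaTester.suitable_params hk hkn hε hε2
      (JuntaTester.div_le_two_pow_inputBits (hk.trans hkn) hε)
    rw [SampleAlg.law_toQuantum]
    exact ⟨h.le_prob f hk hkn hε hε2, h.le_prob f hk hkn hε hε2⟩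
  · obtain ⟨C, hC⟩ := JuntaTester.exists_costBits_inputBits_le c
    refine ⟨C, fun k n ε hk hkn hε hε2 hnc => ?_⟩
    have hl := JuntaTester.div_le_two_pow_inputBits (hk.trans hkn) hε
    have hn : n + 1 ≤ 2 ^ JuntaTester.inputBits n ε := by
      exact_mod_cast (JuntaTester.natCast_add_one_le_div (hk.trans hkn) hε hε2).trans hl
    have hcost := (JuntaTester.cost_distTester_le
      (JuntaTester.params (JuntaTester.inputBits n ε) (JuntaTester.rounds k)) k ε).trans
      (Nat.cast_le.mpr (JuntaTester.total_le_two_pow_costBits hn hε hl))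
    -- The number `2 ^ costBits` bounds both the classical and the quantum count.
    refine ⟨_, hcost, (SampleAlg.queries_toQuantum_le _).trans hcost, ?_⟩
    rw [Nat.cast_pow, Nat.cast_ofNat, ← Real.rpow_natCast]
    exact Real.rpow_le_rpow_of_exponent_le (by norm_num) (hC k n ε hk hkn hε hε2 hnc)
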